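/- For a finite simple undirected graph \(G\) and \(w\colon E(G)\to\{0,1\}\), the colour of a vertex \(v\) is the sum of the weights \(w(e)\) of the edges \(e\) incident with \(v\); \(w\) is proper if any two adjacent vertices have distinct colours. Vertex-Coloring \(\{0,1\}\)-Edge-Weighting asks, given \(G\), whether \(G\) has a proper \(w\). The all-ones Pre-edge-Weighting problem asks, given \(G\) and a set \(E_1\subseteq E(G)\) of edges pre-assigned the weight \(1\), whether \(G\) has a proper \(w\) with \(w(e)=1\) for all \(e\in E_1\). Let \(n=|V(G)|\), and let \(k\) be the size of a smallest vertex cover of \(G\). Graphs are given by \(n\), the number of edges and a list of the edges (for the second problem with a mark on the edges of \(E_1\)); \(k\) is not part of the input. Running times are numbers of steps of a word RAM whose words hold the numbers smaller than the stated time bound. Theorem. Both problems are fixed-parameter tractable parameterized by \(k\): each is decided in time \(f(k)\cdot (n+1)^{c}\) for some computable function \(f\) and some constant \(c\). More precisely, there is a constant \(C\) such that Vertex-Coloring \(\{0,1\}\)-Edge-Weighting is decided in time \(2^{C(k^4+1)}\cdot (n+1)\) (that is, \(2^{O(k^4)}\cdot n\)), and there is a constant \(C\) such that the all-ones Pre-edge-Weighting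 problem is decided in time \(3^{C(k^4+1)}\cdot (n+1)^{C}\) (that is, \(3^{O(k^4)}\cdot n^{O(1)}\)). -/

import Mathlib

/-! ## The machine model: a word RAM with structured control flow -/

namespace WordRAM

/-- Arithmetic and comparison operations on words. Comparisons return `1` for true and `0` for
false; subtraction is truncated at `0`. -/
inductive Op where
  | add | sub | mul | div | mod | lt | eq

/-- The value of an operation (before the overflow check). -/
def Op.eval : Op → ℕ → ℕ → ℕ
  | .add, a, b => a + b
  | .sub, a, b => a - b
  | .mul, a, b => a * b
  | .div, a, b => a / b
  | .mod, a, b => a % b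
  | .lt, a, b => if a < b then 1 else 0
  | .eq, a, b => if a = b then 1 else 0

/-- Programs. Registers and arrays are named by numerals that are fixed in the program text, so a
program uses only finitely many registers and finitely many arrays; array cells are addressed
indirectly, by the content of a register. -/
inductive Prog where
  /-- Do nothing. -/
  | skip : Prog
  /-- `const x c`: set register `x` to the constant `c`. -/
  | const (x c : ℕ) : Prog
  /-- `op o x y z`: set register `x` to the value of `o` on registers `y` and `z`. -/
  | op (o : Op) (x y z : ℕ) : Prog
  /-- `load x a y`: set register `x` to the cell of array `a` at the index held by register `y`. -/
  | load (x a y : ℕ) : Prog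
  /-- `store a y x`: set the cell of array `a` at the index held by register `y` to the content
  of register `x`. -/
  | store (a y x : ℕ) : Prog
  /-- Sequential composition. -/
  | seq (p q : Prog) : Prog
  /-- `ite x p q`: run `p` if register `x` is nonzero, and `q` otherwise. -/
  | ite (x : ℕ) (p q : Prog) : Prog
  /-- `loop x p`: while register `x` is nonzero, run `p`. -/
  | loop (x : ℕ) (p : Prog) : Prog

/-- A machine state: the contents of the registers and of the arrays. -/
@[ext]
structure State where
  /-- Contents of the registers. -/
  reg : ℕ → ℕ
  /-- `arr a i` is the content of cell `i` of array `a`. -/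
  arr : ℕ → ℕ → ℕ

/-- Write `v` into register `x`. -/
def State.setReg (s : State) (x v : ℕ) : State :=
  { s with reg := Function.update s.reg x v }

/-- Write `v` into cell `i` of array `a`. -/
def State.setArr (s : State) (a i v : ℕ) : State :=
  { s with arr := Function.update s.arr a (Function.update (s.arr a) i v) }

/-- `Exec W p s t s'`: on a machine whose words hold the numbers smaller than `W`, the program `p`
started in the state `s` halts in the state `s'` after exactly `t` steps. Every elementary
instruction and every test takes one step. There is no rule for an instruction that would produce
a number that does not fit into a word, so such a run does not count as halting. -/
inductive Exec (W : ℕ) : Prog → State → ℕ → State → Prop where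
  | skip (s : State) : Exec W .skip s 1 s
  | const (s : State) (x c : ℕ) (fits : c < W) : Exec W (.const x c) s 1 (s.setReg x c)
  | op (s : State) (o : Op) (x y z : ℕ) (fits : o.eval (s.reg y) (s.reg z) < W) :
      Exec W (.op o x y z) s 1 (s.setReg x (o.eval (s.reg y) (s.reg z)))
  | load (s : State) (x a y : ℕ) : Exec W (.load x a y) s 1 (s.setReg x (s.arr a (s.reg y)))
  | store (s : State) (a y x : ℕ) :
      Exec W (.store a y x) s 1 (s.setArr a (s.reg y) (s.reg x))
  | seq {p q : Prog} {s s₁ s₂ : State} {t₁ t₂ : ℕ} (hp : Exec W p s t₁ s₁)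
      (hq : Exec W q s₁ t₂ s₂) : Exec W (.seq p q) s (t₁ + t₂) s₂
  | iteTrue {x : ℕ} {p q : Prog} {s s₁ : State} {t : ℕ} (hx : s.reg x ≠ 0)
      (hp : Exec W p s t s₁) : Exec W (.ite x p q) s (t + 1) s₁
  | iteFalse {x : ℕ} {p q : Prog} {s s₁ : State} {t : ℕ} (hx : s.reg x = 0)
      (hq : Exec W q s t s₁) : Exec W (.ite x p q) s (t + 1) s₁
  | loopDone {x : ℕ} {p : Prog} {s : State} (hx : s.reg x = 0) : Exec W (.loop x p) s 1 s
  | loopStep {x : ℕ} {p : Prog} {s s₁ s₂ : State} {t₁ t₂ : ℕ} (hx : s.reg x ≠ 0)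
      (hp : Exec W p s t₁ s₁) (hl : Exec W (.loop x p) s₁ t₂ s₂) :
      Exec W (.loop x p) s (t₁ + t₂ + 1) s₂

/-- The initial state on a given input: array `0` holds the input, everything else is `0`. -/
def init (input : List ℕ) : State where
  reg _ := 0
  arr a i := if a = 0 then input.getD i 0 else 0

/-- The program `p` answers the question whether `answer` holds, on the given input: on a machine
with words of size `W` into which all entries of the input fit, `p` halts after at most `T` steps,
and register `0` then holds `1` if `answer` is true and `0` if it is false. -/
def Decides (p : Prog) (W T : ℕ) (input : List ℕ) (answer : Prop) : Prop :=
  (∀ a ∈ input, a < W) ∧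
    ∃ (t : ℕ) (s : State), Exec W p (init input) t s ∧ t ≤ T ∧
      (answer → s.reg 0 = 1) ∧ (¬ answer → s.reg 0 = 0)

end WordRAM

/-! ## Parameterized problems -/

/-- A parameterized decision problem on graphs: instances, each with the list of numbers that is
given to the machine, its size (the number of vertices), its parameter and its answer. The
parameter is not part of the input. -/
structure ParamProblem where
  /-- The instances. -/
  Inst : Type
  /-- The input that the machine receives. -/
  input : Inst → List ℕ
  /-- The number of vertices. -/
  size : Inst → ℕ
  /-- The parameter. -/
  param : Inst → ℕ
  /-- The yes-instances. -/
  IsYes : Inst → Prop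

namespace ParamProblem

/-- One program decides every instance with `n` vertices and parameter `k` in at most `T k n`
steps, on words that hold the numbers smaller than `T k n`, i.e. on words of `log (T k n)` bits. -/
def SolvableInTime (P : ParamProblem) (T : ℕ → ℕ → ℕ) : Prop :=
  ∃ p : WordRAM.Prog, ∀ x : P.Inst,
    WordRAM.Decides p (T (P.param x) (P.size x)) (T (P.param x) (P.size x)) (P.input x) (P.IsYes x)

/-- Fixed-parameter tractability: time `f(k) · n^c` for a computable function `f` and a
constant `c` (with `n + 1` for `n`, so that the graph without vertices is allowed). -/
def IsFPT (P : ParamProblem) : Prop :=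
  ∃ (f : ℕ → ℕ) (c : ℕ), Computable f ∧ P.SolvableInTime (fun k n => f k * (n + 1) ^ c)

end ParamProblem

/-! ## Vertex-colouring edge weightings -/

namespace EdgeWeighting

open Classical in
/-- The colour of a vertex under a `{0,1}`-weighting of the edges: the sum of the weights of the
edges incident with it. -/
noncomputable def color {V : Type} [Fintype V] {G : SimpleGraph V} (w : G.edgeSet → Fin 2) (v : V) : ℕ :=
  ∑ e : G.edgeSet, if v ∈ (e : Sym2 V) then (w e : ℕ) else 0

/-- A weighting is proper if adjacent vertices receive distinct colours. -/
def IsProper {V : Type} [Fintype V] {G : SimpleGraph V} (w : G.edgeSet → Fin 2) : Prop :=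
  ∀ ⦃u v : V⦄, G.Adj u v → color w u ≠ color w v

/-- A pre-weighting: a set of edges of `G` with a weight from `{0,1}` for each of them. -/
structure PreWeighting {V : Type} (G : SimpleGraph V) where
  /-- The pre-weighted edges. -/
  dom : Set (Sym2 V)
  /-- They are edges of the graph. -/
  dom_subset : dom ⊆ G.edgeSet
  /-- The pre-assigned weights. -/
  wt : dom → Fin 2

/-- The weighting `w` extends the pre-weighting `p`. -/
def Extends {V : Type} {G : SimpleGraph V} (w : G.edgeSet → Fin 2) (p : PreWeighting G) :
    Prop :=
  ∀ e : p.dom, w ⟨e, p.dom_subset e.2⟩ = p.wt e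

/-- A graph on the vertices `0, …, n - 1`, presented by a list of its edges. The list contains
every edge exactly once; the order of the edges and of the two ends of an edge is arbitrary. -/
structure GraphInput where
  /-- The number of vertices. -/
  n : ℕ
  /-- The graph. -/
  G : SimpleGraph (Fin n)
  /-- The edge list. -/
  edges : List (Fin n × Fin n)
  /-- No edge is listed twice. -/
  nodup : (edges.map fun e => s(e.1, e.2)).Nodup
  /-- Exactly the edges of the graph are listed. -/
  mem_iff : ∀ e : Sym2 (Fin n), e ∈ edges.map (fun e => s(e.1, e.2)) ↔ e ∈ G.edgeSet

/-- The vertex cover number of the graph. -/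
noncomputable def GraphInput.vc (x : GraphInput) : ℕ := x.G.vertexCoverNum.toNat

/-- The problem whether a graph has a proper `{0,1}`-weighting, parameterized by the vertex cover
number. The input is `n, m, u₁, v₁, …, uₘ, vₘ` for a graph with `n` vertices and the `m` edges
`uᵢvᵢ`. -/
noncomputable def problem : ParamProblem where
  Inst := GraphInput
  input x := x.n :: x.edges.length :: x.edges.flatMap fun e => [(e.1 : ℕ), (e.2 : ℕ)]
  size x := x.n
  param x := x.vc
  IsYes x := ∃ w : x.G.edgeSet → Fin 2, IsProper w

/-- A graph with a pre-weighting all of whose weights are `1`. -/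
structure OnesPreInput extends GraphInput where
  /-- The pre-weighting. -/
  pre : PreWeighting G
  /-- All pre-assigned weights are `1`. -/
  ones : ∀ e, pre.wt e = 1

open Classical in
/-- The problem whether a pre-weighting with all pre-assigned weights `1` extends to a proper
`{0,1}`-weighting, parameterized by the vertex cover number. The input is
`n, m, u₁, v₁, b₁, …, uₘ, vₘ, bₘ`, where `bᵢ = 1` if the edge `uᵢvᵢ` is pre-weighted (by `1`), and
`bᵢ = 0` otherwise. -/
noncomputable def onesPreProblem : ParamProblem where
  Inst := OnesPreInput
  input x := x.n :: x.edges.length :: x.edges.flatMap fun e =>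
    [(e.1 : ℕ), (e.2 : ℕ), if s(e.1, e.2) ∈ x.pre.dom then 1 else 0]
  size x := x.n
  param x := x.vc
  IsYes x := ∃ w : x.G.edgeSet → Fin 2, IsProper w ∧ Extends w x.pre

end EdgeWeighting

/-!
Both problems are decided by the same program; they differ only in how the list of edges, together
with a mark for each edge that must have weight `1`, is read from the input.

Let `S` be the set of vertices of a greedy maximal matching (`chooseCover`). It is a vertex cover
with `s ≤ 2 k` vertices. Every edge either has one end outside `S` or lies inside `S`. The *type*
of a vertex outside `S` records to which vertices of `S` it is joined, and by marked or unmarked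
edges; an edge inside `S` gets a type in the same format, as if it were a vertex in its middle. So
there are at most `3 ^ s` types, and the graph is described, up to irrelevant renaming, by the
number of vertices and of inner edges of each type (`vertexCount`, `edgeCount`) and by the graph on
`S`.

The weights at a vertex outside `S` are a `0`-`1`-vector indexed by `S` (a *pattern* of its type,
`patterns`). The colour of such a vertex is at most `s`, so it can be compared with the colours of
its neighbours in `S` as soon as these are known up to `s` exactly. The colours of `S` themselves
can be as large as `n`, and enumerating them would be too expensive. They are therefore kept only
modulo `wrap (s + 1) M`, that is, exactly up to `s`, and modulo `M` from `s + 1` on. This is a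
congruence for addition (`wrap_add_wrap`), so the set of reachable vectors of classes is a sumset
in a finite monoid with `(s + 1 + M) ^ s` elements, which is computed by repeated doubling in time
logarithmic in the multiplicities (`addMultiples`). For every candidate vector `τ` of classes, the
program checks that adjacent vertices of `S` have different classes in `τ`, and that the items can
produce `τ` with patterns compatible with `τ` (`IsTarget`). Different classes come from different
colours, so a hit yields a proper weighting (`hasWeighting_of_isTarget`).

Conversely, for a proper weighting, some modulus must separate the different colours on `S`. The
at most `s²` nonzero differences have at most `L = O(log n)` bits each, and some
`M ≤ 2 (s² L + 1)` divides none of them: otherwise every prime power dividing a central binomial coefficient would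
divide their product, which is too small (`exists_not_dvd`). So the search over all `M` in this
range is complete (`exists_isTarget`).

The time is `2 ^ O(s ^ 2)` times a power of `L` with exponent `O(s)`, apart from a linear part for
reading the input and counting. Since `x ^ a ≤ a ^ a * 2 ^ x`, such a power of `L` is at most
`2 ^ O(s ^ 2)` times `2 ^ L`, which is linear in `n + m`; and `m ≤ k n`. So the time is
`2 ^ O(k ^ 2) n`, a better bound than either problem requires (`solveTime_le`).

The program is written in a small language of expressions and loops, compiled to the word RAM.
`Runs W p s T Q` says that `p` started in the state `s` halts within `T` steps, without overflow of
words below `W`, in a state with the property `Q`, for all contents of the scratch registers from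
`100` on; the rules for it are those of a Hoare logic with running times. The use of the registers
and arrays below `100` is as follows.

* registers: `0` answer, `1` number of vertices, `2` number of edges, `3` size `s` of the cover,
  `5` bound for the moduli, `6` modulus `M`, `7` base `D = s + 1 + M`, `8` the number `D ^ s`, `9`
  the number `3 ^ s`, `10` candidate `τ`, `11` type, `19` multiplicity, `23` the number `s * s`,
  `24` and `26` loop variables, the others scratch space;
* arrays: `0` input, `1`, `2`, `3` ends and marks of the edges, `4` the numbering of the cover,
  `5` powers of `3`, `6` types of vertices, `7` and `8` numbers of vertices and of inner edges by
  type, `10` adjacency matrix of the cover, `11` powers of `D`, `12` digits of `τ`, `13` constant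
  `1`, `14` the table of sums, `15` the table of patterns, `16` auxiliary table.
-/

/-! ### Expressions and their compilation -/

namespace WordRAM

/-- Expressions over registers and arrays. -/
inductive Expr where
  /-- The content of a register. -/
  | var (x : ℕ) : Expr
  /-- A literal. -/
  | lit (c : ℕ) : Expr
  /-- An operation on the values of two expressions. -/
  | bin (o : Op) (a b : Expr) : Expr
  /-- The cell of array `a` at the index given by an expression. -/
  | get (a : ℕ) (i : Expr) : Expr

namespace Expr

/-- The value of an expression in a state. -/
def eval (s : State) : Expr → ℕ
  | var x => s.reg x
  | lit c => c
  | bin o a b => o.eval (a.eval s) (b.eval s)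
  | get a i => s.arr a (i.eval s)

/-- The program that leaves the value of an expression in register `d`, with the registers above
`d` as scratch space. A register is copied by adding `0` to it. -/
def compile : Expr → ℕ → Prog
  | var x, d => .seq (.const d 0) (.op .add d x d)
  | lit c, d => .const d c
  | bin o a b, d => .seq (a.compile d) (.seq (b.compile (d + 1)) (.op o d d (d + 1)))
  | get a i, d => .seq (i.compile d) (.load d a d)

/-- The number of steps that the compiled expression takes. -/
def cost : Expr → ℕ
  | var _ => 2
  | lit _ => 1
  | bin _ a b => a.cost + (b.cost + 1)
  | get _ i => i.cost + 1

end Expr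

/-- The result of the operation fits into a word whenever the arguments do; only sums and products
can overflow. -/
def Op.Safe (W : ℕ) : Op → ℕ → ℕ → Prop
  | .add, a, b => a + b < W
  | .mul, a, b => a * b < W
  | _, _, _ => True

/-- The expression uses only registers below `100`, and its evaluation does not overflow. -/
def Expr.Safe (W : ℕ) (s : State) : Expr → Prop
  | .var x => x < 100
  | .lit c => c < W
  | .bin o a b => a.Safe W s ∧ b.Safe W s ∧ o.Safe W (a.eval s) (b.eval s)
  | .get _ i => i.Safe W s

/-- All registers and cells hold words. -/
def State.Fits (W : ℕ) (s : State) : Prop :=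
  (∀ x, s.reg x < W) ∧ ∀ a i, s.arr a i < W

/-- Two states agree except possibly on the scratch registers, those from `100` on. -/
def State.Sim (r s : State) : Prop :=
  (∀ x < 100, r.reg x = s.reg x) ∧ r.arr = s.arr

@[simp] theorem State.setReg_reg (s : State) (x v y : ℕ) :
    (s.setReg x v).reg y = if y = x then v else s.reg y := by
  simp [State.setReg, Function.update_apply]

@[simp] theorem State.setReg_arr (s : State) (x v : ℕ) : (s.setReg x v).arr = s.arr := rfl

@[simp] theorem State.setArr_reg (s : State) (a i v : ℕ) : (s.setArr a i v).reg = s.reg := rfl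

@[simp] theorem State.setArr_arr (s : State) (a i v b j : ℕ) :
    (s.setArr a i v).arr b j = if b = a then if j = i then v else s.arr a j else s.arr b j := by
  simp only [State.setArr, Function.update_apply]
  split_ifs <;> simp_all

theorem Op.Safe.eval_lt {W : ℕ} (h1 : 1 < W) {o : Op} {a b : ℕ} (ha : a < W)
    (h : o.Safe W a b) : o.eval a b < W := by
  cases o <;> simp only [Op.Safe, Op.eval] at h ⊢
  · exact h
  · omega
  · exact h
  · exact (Nat.div_le_self _ _).trans_lt ha
  · exact (Nat.mod_le _ _).trans_lt ha
  · split_ifs <;> omega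
  · split_ifs <;> omega

theorem State.Fits.setReg {W : ℕ} {s : State} (h : s.Fits W) {x v : ℕ} (hv : v < W) :
    (s.setReg x v).Fits W := by
  refine ⟨fun y => ?_, h.2⟩
  rw [State.setReg_reg]
  split_ifs
  exacts [hv, h.1 y]

theorem State.Fits.setArr {W : ℕ} {s : State} (h : s.Fits W) {a i v : ℕ} (hv : v < W) :
    (s.setArr a i v).Fits W := by
  refine ⟨h.1, fun b j => ?_⟩
  rw [State.setArr_arr]
  split_ifs
  exacts [hv, h.2 _ _, h.2 _ _]

theorem Exec.fits {W : ℕ} {p : Prog} {s s' : State} {t : ℕ} (h : Exec W p s t s')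
    (hs : s.Fits W) : s'.Fits W := by
  induction h with
  | skip => exact hs
  | const s x c hc => exact hs.setReg hc
  | op s o x y z hf => exact hs.setReg hf
  | load s x a y => exact hs.setReg (hs.2 _ _)
  | store s a y x => exact hs.setArr (hs.1 _)
  | seq _ _ ih1 ih2 => exact ih2 (ih1 hs)
  | iteTrue _ _ ih => exact ih hs
  | iteFalse _ _ ih => exact ih hs
  | loopDone => exact hs
  | loopStep _ _ _ ih1 ih2 => exact ih2 (ih1 hs)

theorem Expr.exec_compile {W : ℕ} (h1 : 1 < W) (s : State) (e : Expr) :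
    ∀ (d : ℕ) (r : State), 100 ≤ d → r.Fits W → r.Sim s → e.Safe W s →
      ∃ r', Exec W (e.compile d) r e.cost r' ∧ r'.reg d = e.eval s ∧ r'.Sim s ∧
        ∀ x < d, r'.reg x = r.reg x := by
  induction e with
  | var x =>
    intro d r hd hr hs he
    have hx : x < 100 := he
    have hv : Op.eval .add ((r.setReg d 0).reg x) ((r.setReg d 0).reg d) = s.reg x := by
      have : x ≠ d := by omega
      simp [Op.eval, this, hs.1 x hx]
    refine ⟨_, .seq (.const _ _ _ (by omega)) (.op _ .add d x d ?_), ?_, ⟨?_, hs.2⟩, ?_⟩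
    · rw [hv, ← hs.1 x hx]
      exact hr.1 x
    · rw [hv]
      simp [Expr.eval]
    · intro y hy
      have : y ≠ d := by omega
      simp [this, hs.1 y hy]
    · intro y hy
      have : y ≠ d := by omega
      simp [this]
  | lit c =>
    intro d r hd hr hs he
    refine ⟨_, .const _ _ _ he, by simp [Expr.eval], ⟨?_, hs.2⟩, ?_⟩
    · intro y hy
      have : y ≠ d := by omega
      simp [this, hs.1 y hy]
    · intro y hy
      have : y ≠ d := by omega
      simp [this]
  | bin o a b iha ihb =>
    intro d r hd hr hs he
    obtain ⟨ha, hb, ho⟩ := he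
    obtain ⟨r1, e1, v1, s1, f1⟩ := iha d r hd hr hs ha
    have hr1 := e1.fits hr
    obtain ⟨r2, e2, v2, s2, f2⟩ := ihb (d + 1) r1 (by omega) hr1 s1 hb
    have hr2 := e2.fits hr1
    have hd2 : r2.reg d = a.eval s := by rw [f2 d (by omega), v1]
    refine ⟨_, .seq e1 (.seq e2 (.op _ o d d (d + 1) ?_)), ?_, ⟨?_, s2.2⟩, ?_⟩
    · refine Op.Safe.eval_lt h1 (hr2.1 d) ?_
      rw [hd2, v2]
      exact ho
    · simp [Expr.eval, hd2, v2]
    · intro y hy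
      have : y ≠ d := by omega
      simp [this, s2.1 y hy]
    · intro y hy
      have : y ≠ d := by omega
      rw [State.setReg_reg, if_neg this, f2 y (by omega), f1 y hy]
  | get a i ih =>
    intro d r hd hr hs he
    obtain ⟨r1, e1, v1, s1, f1⟩ := ih d r hd hr hs he
    refine ⟨_, .seq e1 (.load _ d a d), ?_, ⟨?_, s1.2⟩, ?_⟩
    · simp [Expr.eval, v1, s1.2]
    · intro y hy
      have : y ≠ d := by omega
      simp [this, s1.1 y hy]
    · intro y hy
      have : y ≠ d := by omega
      rw [State.setReg_reg, if_neg this, f1 y hy]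

/-! ### Statements with expressions -/

infixr:60 " ;; " => Prog.seq

/-- Assign the value of an expression to a register. -/
def Prog.assign (x : ℕ) (e : Expr) : Prog :=
  e.compile 100 ;; .const 101 0 ;; .op .add x 100 101

/-- Assign the value of the expression `e` to the cell `i` of array `a`. -/
def Prog.put (a : ℕ) (i e : Expr) : Prog :=
  i.compile 100 ;; e.compile 101 ;; .store a 100 101

/-- Branch on whether an expression is nonzero. -/
def Prog.branch (e : Expr) (p q : Prog) : Prog :=
  e.compile 100 ;; .ite 100 p q

/-- Run `p` if the expression is nonzero. -/
def Prog.when (e : Expr) (p : Prog) : Prog := .branch e p .skip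

/-- Repeat `p` while the expression is nonzero. -/
def Prog.while_ (e : Expr) (p : Prog) : Prog :=
  e.compile 100 ;; .loop 100 (p ;; e.compile 100)

/-- Run `p` with register `x` ranging over the numbers below the content of register `y`. -/
def Prog.for_ (x y : ℕ) (p : Prog) : Prog :=
  .assign x (.lit 0) ;;
    .while_ (.bin .lt (.var x) (.var y)) (p ;; .assign x (.bin .add (.var x) (.lit 1)))

/-- Does the program write to register `x`? -/
def Prog.setsReg (x : ℕ) : Prog → Bool
  | .skip => false
  | .const y _ => x == y
  | .op _ y _ _ => x == y
  | .load y _ _ => x == y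
  | .store _ _ _ => false
  | .seq p q => p.setsReg x || q.setsReg x
  | .ite _ p q => p.setsReg x || q.setsReg x
  | .loop _ p => p.setsReg x

/-- Does the program write to array `a`? -/
def Prog.setsArr (a : ℕ) : Prog → Bool
  | .skip => false
  | .const _ _ => false
  | .op _ _ _ _ => false
  | .load _ _ _ => false
  | .store b _ _ => a == b
  | .seq p q => p.setsArr a || q.setsArr a
  | .ite _ p q => p.setsArr a || q.setsArr a
  | .loop _ p => p.setsArr a

@[simp] theorem Expr.setsArr_compile (a : ℕ) (e : Expr) (d : ℕ) :
    (e.compile d).setsArr a = false := by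
  induction e generalizing d <;> simp_all [Expr.compile, Prog.setsArr]

/-- The states `s` and `s'` agree on everything that `p` does not write to, apart from the scratch
registers. -/
structure Frame (p : Prog) (s s' : State) : Prop where
  reg : ∀ x < 100, p.setsReg x = false → s'.reg x = s.reg x
  arr : ∀ a, p.setsArr a = false → s'.arr a = s.arr a

theorem Frame.refl (p : Prog) (s : State) : Frame p s s := ⟨fun _ _ _ => rfl, fun _ _ => rfl⟩

theorem Exec.reg_eq {W : ℕ} {p : Prog} {s s' : State} {t : ℕ} (h : Exec W p s t s') {x : ℕ}
    (hx : p.setsReg x = false) : s'.reg x = s.reg x := by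
  induction h with
  | skip => rfl
  | const s y c hc => simp_all [Prog.setsReg]
  | op s o y _ _ hf => simp_all [Prog.setsReg]
  | load s y a _ => simp_all [Prog.setsReg]
  | store s a y x => rfl
  | seq _ _ ih1 ih2 =>
    simp only [Prog.setsReg, Bool.or_eq_false_iff] at hx
    rw [ih2 hx.2, ih1 hx.1]
  | iteTrue _ _ ih =>
    simp only [Prog.setsReg, Bool.or_eq_false_iff] at hx
    exact ih hx.1
  | iteFalse _ _ ih =>
    simp only [Prog.setsReg, Bool.or_eq_false_iff] at hx
    exact ih hx.2
  | loopDone => rfl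
  | loopStep _ _ _ ih1 ih2 => rw [ih2 hx, ih1 hx]

theorem Exec.arr_eq {W : ℕ} {p : Prog} {s s' : State} {t : ℕ} (h : Exec W p s t s') {a : ℕ}
    (ha : p.setsArr a = false) : s'.arr a = s.arr a := by
  induction h with
  | skip => rfl
  | const s y c hc => rfl
  | op s o y _ _ hf => rfl
  | load s y a _ => rfl
  | store s b y x =>
    funext j
    simp_all [Prog.setsArr]
  | seq _ _ ih1 ih2 =>
    simp only [Prog.setsArr, Bool.or_eq_false_iff] at ha
    rw [ih2 ha.2, ih1 ha.1]
  | iteTrue _ _ ih =>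
    simp only [Prog.setsArr, Bool.or_eq_false_iff] at ha
    exact ih ha.1
  | iteFalse _ _ ih =>
    simp only [Prog.setsArr, Bool.or_eq_false_iff] at ha
    exact ih ha.2
  | loopDone => rfl
  | loopStep _ _ _ ih1 ih2 => rw [ih2 ha, ih1 ha]

/-! ### A program logic with running times -/

/-- Started in any state of words that agrees with `s` up to scratch registers, `p` halts within
`T` steps, in a state that agrees up to scratch registers with one that satisfies `Q`. -/
def Runs (W : ℕ) (p : Prog) (s : State) (T : ℕ) (Q : State → Prop) : Prop :=
  ∀ r : State, r.Sim s → r.Fits W →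
    ∃ t r' s', Exec W p r t r' ∧ t ≤ T ∧ r'.Sim s' ∧ Q s'

section Runs

variable {W T T' T₁ T₂ : ℕ} {p q : Prog} {s : State} {Q Q' : State → Prop} {e : Expr}

theorem Runs.mono (h : Runs W p s T₁ Q) (hT : T₁ ≤ T₂) : Runs W p s T₂ Q := fun r h1 h2 =>
  let ⟨t, r', s', he, ht, hq⟩ := h r h1 h2
  ⟨t, r', s', he, ht.trans hT, hq⟩

/-- The final state agrees with the initial one on everything that the program does not write
to. -/
theorem Runs.frame (h : Runs W p s T Q) : Runs W p s T fun s' => Frame p s s' ∧ Q s' := by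
  intro r h1 h2
  obtain ⟨t, r', s', he, ht, hs, hq⟩ := h r h1 h2
  refine ⟨t, r', s', he, ht, hs, ⟨fun x hx hp => ?_, fun a hp => ?_⟩, hq⟩
  · rw [← hs.1 x hx, he.reg_eq hp, h1.1 x hx]
  · rw [← hs.2, he.arr_eq hp, h1.2]

theorem Runs.imp (h : Runs W p s T Q) (hq : ∀ s', Frame p s s' → Q s' → Q' s') :
    Runs W p s T Q' := fun r h1 h2 =>
  let ⟨t, r', s', he, ht, hs, hf, h⟩ := h.frame r h1 h2
  ⟨t, r', s', he, ht, hs, hq s' hf h⟩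

theorem Runs.seq (hp : Runs W p s T₁ Q) (hT : T₁ ≤ T)
    (hq : ∀ s', Frame p s s' → Q s' → Runs W q s' (T - T₁) Q') : Runs W (p ;; q) s T Q' := by
  intro r h1 h2
  obtain ⟨t, r', s', he, ht, hs, hf, hQ⟩ := hp.frame r h1 h2
  obtain ⟨t2, r2, s2, he2, ht2, hs2, hQ2⟩ := hq s' hf hQ r' hs (he.fits h2)
  exact ⟨_, r2, s2, .seq he he2, by omega, hs2, hQ2⟩

theorem Runs.skip (hQ : Q s) (hT : 1 ≤ T) : Runs W .skip s T Q := fun r h1 _ =>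
  ⟨1, r, s, .skip r, hT, h1, hQ⟩

theorem Runs.assign {x v : ℕ} (h1 : 1 < W) (he : e.Safe W s) (hv : e.eval s = v)
    (hQ : Q (s.setReg x v)) (hT : e.cost + 2 ≤ T) : Runs W (.assign x e) s T Q := by
  subst hv
  intro r hs hr
  obtain ⟨r1, e1, v1, s1, f1⟩ := e.exec_compile h1 s 100 r le_rfl hr hs he
  have hv : Op.eval .add ((r1.setReg 101 0).reg 100) ((r1.setReg 101 0).reg 101) = e.eval s := by
    simp [Op.eval, v1]
  refine ⟨_, _, s.setReg x (e.eval s), .seq e1 (.seq (.const _ _ _ (by omega))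
    (.op _ .add x 100 101 ?_)), by omega, ⟨?_, s1.2⟩, hQ⟩
  · rw [hv, ← v1]
    exact (e1.fits hr).1 100
  · intro y hy
    rw [hv]
    have : y ≠ 101 := by omega
    simp [this, s1.1 y hy]

theorem Runs.seq_assign {x v : ℕ} (h1 : 1 < W) (he : e.Safe W s) (hv : e.eval s = v)
    (hT : e.cost + 2 ≤ T) (hq : Runs W q (s.setReg x v) (T - (e.cost + 2)) Q) :
    Runs W (.assign x e ;; q) s T Q :=
  (Runs.assign (Q := (· = s.setReg x v)) h1 he hv rfl le_rfl).seq hT fun _ _ h => h ▸ hq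

theorem Runs.put {a k v : ℕ} {i : Expr} (h1 : 1 < W) (hi : i.Safe W s) (he : e.Safe W s)
    (hk : i.eval s = k) (hv : e.eval s = v) (hQ : Q (s.setArr a k v))
    (hT : i.cost + e.cost + 1 ≤ T) : Runs W (.put a i e) s T Q := by
  subst hk hv
  intro r hs hr
  obtain ⟨r1, e1, v1, s1, f1⟩ := i.exec_compile h1 s 100 r le_rfl hr hs hi
  obtain ⟨r2, e2, v2, s2, f2⟩ := e.exec_compile h1 s 101 r1 (by norm_num) (e1.fits hr) s1 he
  refine ⟨_, _, s.setArr a (i.eval s) (e.eval s), .seq e1 (.seq e2 (.store _ a 100 101)),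
    by omega, ⟨s2.1, ?_⟩, hQ⟩
  rw [f2 100 (by norm_num), v1, v2]
  funext b j
  simp [s2.2]

theorem Runs.seq_put {a k v : ℕ} {i : Expr} (h1 : 1 < W) (hi : i.Safe W s) (he : e.Safe W s)
    (hk : i.eval s = k) (hv : e.eval s = v) (hT : i.cost + e.cost + 1 ≤ T)
    (hq : Runs W q (s.setArr a k v) (T - (i.cost + e.cost + 1)) Q) :
    Runs W (.put a i e ;; q) s T Q :=
  (Runs.put (Q := (· = s.setArr a k v)) h1 hi he hk hv rfl le_rfl).seq hT fun _ _ h => h ▸ hq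

theorem Runs.branch (h1 : 1 < W) (he : e.Safe W s) (hT : e.cost + 1 ≤ T)
    (hp : e.eval s ≠ 0 → Runs W p s (T - (e.cost + 1)) Q)
    (hq : e.eval s = 0 → Runs W q s (T - (e.cost + 1)) Q) :
    Runs W (.branch e p q) s T Q := by
  intro r hs hr
  obtain ⟨r1, e1, v1, s1, f1⟩ := e.exec_compile h1 s 100 r le_rfl hr hs he
  by_cases h : e.eval s = 0
  · obtain ⟨t, r', s', he', ht, hs', hQ'⟩ := hq h r1 s1 (e1.fits hr)
    exact ⟨_, _, _, .seq e1 (.iteFalse (v1.trans h) he'), by omega, hs', hQ'⟩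
  · obtain ⟨t, r', s', he', ht, hs', hQ'⟩ := hp h r1 s1 (e1.fits hr)
    exact ⟨_, _, _, .seq e1 (.iteTrue (by rwa [v1]) he'), by omega, hs', hQ'⟩

theorem Runs.when (h1 : 1 < W) (he : e.Safe W s) (hT : e.cost + 2 ≤ T)
    (hp : e.eval s ≠ 0 → Runs W p s (T - (e.cost + 1)) Q) (hq : e.eval s = 0 → Q s) :
    Runs W (.when e p) s T Q :=
  Runs.branch h1 he (by omega) hp fun h => Runs.skip (hq h) (by omega)

theorem Frame.trans {s s' s'' : State} (h : Frame p s s') (h' : Frame p s' s'') :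
    Frame p s s'' :=
  ⟨fun x hx hp => (h'.reg x hx hp).trans (h.reg x hx hp),
    fun a ha => (h'.arr a ha).trans (h.arr a ha)⟩

theorem Frame.while_ {s s' : State} (h : Frame p s s') : Frame (.while_ e p) s s' := by
  refine ⟨fun x hx hp => h.reg x hx ?_, fun a ha => h.arr a ?_⟩
  · simp only [Prog.while_, Prog.setsReg, Bool.or_eq_false_iff] at hp
    exact hp.2.1
  · simp only [Prog.while_, Prog.setsArr, Bool.or_eq_false_iff] at ha
    exact ha.2.1

/-- The rule for loops, with an invariant `I k` in which `k` bounds the number of iterations that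
remain. -/
theorem Runs.while_ {I : ℕ → State → Prop} (T : ℕ) (h1 : 1 < W) {k : ℕ} (h0 : I k s)
    (hsafe : ∀ k s', Frame (.while_ e p) s s' → I k s' → e.Safe W s')
    (hstep : ∀ k s', Frame (.while_ e p) s s' → I k s' → e.eval s' ≠ 0 →
      ∃ k', k = k' + 1 ∧ Runs W p s' T (I k'))
    (hT : k * (T + (e.cost + 1)) + (e.cost + 1) ≤ T') :
    Runs W (.while_ e p) s T' fun s' => e.eval s' = 0 ∧ ∃ k, I k s' := by
  refine Runs.mono ?_ hT
  suffices H : ∀ k s' r, r.Sim s' → r.Fits W → Frame (.while_ e p) s s' → I k s' →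
      r.reg 100 = e.eval s' →
      ∃ t r' s'', Exec W (.loop 100 (p ;; e.compile 100)) r t r' ∧ t ≤ k * (T + (e.cost + 1)) + 1 ∧
        r'.Sim s'' ∧ e.eval s'' = 0 ∧ ∃ k, I k s'' by
    intro r hs hr
    obtain ⟨r1, e1, v1, s1, f1⟩ :=
      e.exec_compile h1 s 100 r le_rfl hr hs (hsafe k s (.refl _ _) h0)
    obtain ⟨t, r', s'', he, ht, hs', hQ⟩ := H k s r1 s1 (e1.fits hr) (.refl _ _) h0 v1
    exact ⟨_, r', s'', .seq e1 he, by omega, hs', hQ⟩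
  intro k
  induction k with
  | zero =>
    intro s' r hs hr hf hI hv
    by_cases h : e.eval s' = 0
    · exact ⟨1, r, s', .loopDone (hv.trans h), by omega, hs, h, _, hI⟩
    · obtain ⟨k', hk, _⟩ := hstep 0 s' hf hI h
      omega
  | succ k ih =>
    intro s' r hs hr hf hI hv
    by_cases h : e.eval s' = 0
    · exact ⟨1, r, s', .loopDone (hv.trans h), by omega, hs, h, _, hI⟩
    · obtain ⟨k', hk, hrun⟩ := hstep _ s' hf hI h
      obtain rfl : k = k' := by omega
      obtain ⟨t, r1, s1, he, ht, hs1, hf1, hI1⟩ := hrun.frame r hs hr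
      have hf1 := hf.trans hf1.while_
      obtain ⟨r2, e2, v2, s2, f2⟩ :=
        e.exec_compile h1 s1 100 r1 le_rfl (he.fits hr) hs1 (hsafe k s1 hf1 hI1)
      obtain ⟨t3, r3, s3, he3, ht3, hs3, hQ3⟩ :=
        ih s1 r2 s2 (e2.fits (he.fits hr)) hf1 hI1 v2
      refine ⟨_, r3, s3, .loopStep (by rwa [hv]) (.seq he e2) he3, ?_, hs3, hQ3⟩
      rw [Nat.add_mul]
      omega

/-- The rule for counting loops: `I j` holds before iteration `j`. The invariant may not speak
about the loop variable. -/
theorem Runs.for_ {I : ℕ → State → Prop} {x y N : ℕ} (T : ℕ) (h1 : 1 < W) (hN : s.reg y = N) (hNW : N < W)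
    (hI : ∀ j s' v, I j s' → I j (s'.setReg x v)) (h0 : I 0 s)
    (hstep : ∀ j s', j < N → s'.reg x = j → Frame (.for_ x y p) s s' → I j s' →
      Runs W p s' T (I (j + 1)))
    (hT : N * (T + 12) + 12 ≤ T') (hx : x < 100 := by norm_num) (hy : y < 100 := by norm_num) (hxy : y ≠ x := by norm_num)
    (hpx : p.setsReg x = false := by rfl) (hpy : p.setsReg y = false := by rfl) :
    Runs W (.for_ x y p) s T' (I N) := by
  have hfor : ∀ {s'}, Frame (.while_ (.bin .lt (.var x) (.var y))
      (p ;; Prog.assign x (.bin .add (.var x) (.lit 1)))) (s.setReg x 0) s' →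
      Frame (.for_ x y p) s s' := by
    refine fun {s'} hf => ⟨fun z hz hp => ?_, fun a ha => ?_⟩
    · simp only [Prog.for_, Prog.setsReg, Bool.or_eq_false_iff] at hp
      rw [hf.reg z hz (by simpa [Prog.setsReg] using hp.2), State.setReg_reg, if_neg]
      rintro rfl
      simp [Prog.assign, Prog.setsReg] at hp
    · simp only [Prog.for_, Prog.setsArr, Bool.or_eq_false_iff] at ha
      rw [hf.arr a (by simpa [Prog.setsArr] using ha.2)]
      rfl
  have hyf : (Prog.for_ x y p).setsReg y = false := by
    have h100 : y ≠ 100 := by omega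
    have h101 : y ≠ 101 := by omega
    simp [Prog.for_, Prog.assign, Prog.while_, Prog.setsReg, Expr.compile, hpy, hxy, h100, h101]
  have hlit : (Expr.lit 0).Safe W s := Nat.lt_trans Nat.zero_lt_one h1
  refine Runs.seq_assign h1 hlit rfl (by simp [Expr.cost]; omega) ?_
  refine (Runs.while_ (T := T + 6) (I := fun k s' => ∃ j, j + k = N ∧ s'.reg x = j ∧
    Frame (.for_ x y p) s s' ∧ I j s') h1 (k := N) ⟨0, by simp, by simp, hfor (.refl _ _), hI _ _ _ h0⟩
    ?_ ?_ (by simp [Expr.cost, Nat.add_assoc]; omega)).imp ?_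
  · exact fun _ _ _ _ => ⟨hx, hy, trivial⟩
  · rintro k s' hf ⟨j, hj, hxj, hf', hIj⟩ hne
    have hyN : s'.reg y = N := (hf'.reg y hy hyf).trans hN
    have hjN : j < N := by
      by_contra hc
      simp [Expr.eval, Op.eval, hxj, hyN, hc] at hne
    obtain ⟨k, rfl⟩ : ∃ k', k = k' + 1 := ⟨k - 1, by omega⟩
    refine ⟨k, rfl, (hstep j s' hjN hxj hf' hIj).seq (by omega) fun s'' hf'' hI'' => ?_⟩
    have hxj' : s''.reg x = j := (hf''.reg x hx hpx).trans hxj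
    have hw : Frame (.for_ x y p) s s'' := by
      refine hf'.trans ⟨fun z hz hp => hf''.reg z hz ?_, fun a ha => hf''.arr a ?_⟩
      · simp only [Prog.for_, Prog.while_, Prog.setsReg, Bool.or_eq_false_iff] at hp
        exact hp.2.2.1.1
      · simp only [Prog.for_, Prog.while_, Prog.setsArr, Bool.or_eq_false_iff] at ha
        exact ha.2.2.1.1
    refine Runs.assign h1 ⟨hx, h1, ?_⟩ (v := j + 1) ?_ ⟨j + 1, by omega, ?_, ?_, hI _ _ _ hI''⟩
      (by simp [Expr.cost])
    · simp only [Op.Safe, Expr.eval, hxj']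
      omega
    · simp [Expr.eval, Op.eval, hxj']
    · simp
    · refine hw.trans ⟨fun z hz hp => ?_, fun a ha => rfl⟩
      rw [State.setReg_reg, if_neg]
      rintro rfl
      simp [Prog.for_, Prog.assign, Prog.setsReg] at hp
  · rintro s' hf ⟨he, k, j, hj, hxj, hf', hIj⟩
    have hyN : s'.reg y = N := (hf'.reg y hy hyf).trans hN
    have : ¬ j < N := by
      intro hc
      simp [Expr.eval, Op.eval, hxj, hyN, hc] at he
    obtain rfl : j = N := by omega
    exact hIj

end Runs

end WordRAM

namespace WordRAM

/-! ### Digit expansions and residues that are exact on small numbers -/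

/-- The number whose `s` lowest digits to base `D` are given by `f`. -/
def pack (D s : ℕ) (f : ℕ → ℕ) : ℕ := ∑ i ∈ Finset.range s, f i * D ^ i

/-- The digit of `x` to base `D` at position `i`. -/
def digit (D x i : ℕ) : ℕ := x / D ^ i % D

theorem pack_succ (D s : ℕ) (f : ℕ → ℕ) : pack D (s + 1) f = pack D s f + f s * D ^ s :=
  Finset.sum_range_succ _ _

theorem pack_succ' (D s : ℕ) (f : ℕ → ℕ) :
    pack D (s + 1) f = f 0 + D * pack D s fun i => f (i + 1) := by
  rw [pack, Finset.sum_range_succ', pack, Finset.mul_sum, add_comm]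
  simp [pow_succ, mul_comm, mul_assoc]

theorem pack_congr {D s : ℕ} {f g : ℕ → ℕ} (h : ∀ i < s, f i = g i) : pack D s f = pack D s g :=
  Finset.sum_congr rfl fun i hi => by rw [h i (Finset.mem_range.1 hi)]

theorem pack_lt {D : ℕ} (s : ℕ) {f : ℕ → ℕ} (h : ∀ i < s, f i < D) : pack D s f < D ^ s := by
  induction s with
  | zero => simp [pack]
  | succ s ih =>
    have h1 := ih fun i hi => h i (hi.trans s.lt_succ_self)
    have h2 := Nat.mul_le_mul_right (D ^ s) (h s s.lt_succ_self)
    rw [pack_succ, pow_succ']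
    rw [Nat.succ_mul] at h2
    omega

theorem digit_succ (D x i : ℕ) : digit D x (i + 1) = digit D (x / D) i := by
  rw [digit, digit, Nat.div_div_eq_div_mul, pow_succ']

theorem digit_pack {D : ℕ} (s : ℕ) {f : ℕ → ℕ} (h : ∀ i < s, f i < D) {i : ℕ} (hi : i < s) :
    digit D (pack D s f) i = f i := by
  induction s generalizing f i with
  | zero => omega
  | succ s ih =>
    have h0 := h 0 (by omega)
    rw [pack_succ']
    cases i with
    | zero => simp [digit, Nat.add_mul_mod_self_left, Nat.mod_eq_of_lt h0]
    | succ i =>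
      rw [digit_succ, Nat.add_mul_div_left _ _ (by omega), Nat.div_eq_of_lt h0, zero_add]
      exact ih (fun j hj => h (j + 1) (by omega)) (by omega)

theorem digit_lt {D : ℕ} (hD : 0 < D) (x i : ℕ) : digit D x i < D := Nat.mod_lt _ hD

theorem pack_digit {D : ℕ} (s : ℕ) {x : ℕ} (hx : x < D ^ s) : pack D s (digit D x) = x := by
  induction s generalizing x with
  | zero => simp [pack] at hx ⊢; omega
  | succ s ih =>
    rw [pack_succ']
    simp only [digit_succ]
    rw [ih (Nat.div_lt_of_lt_mul (by rwa [← pow_succ']))]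
    simp [digit, Nat.mod_add_div]

/-- The class of `x` under the congruence on `ℕ` that is trivial on the numbers below `B` and
identifies two numbers from `B` on if they are congruent modulo `M`. The classes are represented by
the numbers below `B + M`. -/
def wrap (B M x : ℕ) : ℕ := if x < B then x else B + (x - B) % M

theorem wrap_lt (B : ℕ) {M : ℕ} (hM : 0 < M) (x : ℕ) : wrap B M x < B + M := by
  have := Nat.mod_lt (x - B) hM
  unfold wrap
  split_ifs <;> omega

theorem wrap_of_lt {B M x : ℕ} (h : x < B) : wrap B M x = x := if_pos h

theorem le_wrap {B M x : ℕ} (h : B ≤ x) : B ≤ wrap B M x := by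
  rw [wrap, if_neg (by omega)]
  omega

theorem wrap_modEq (B M x : ℕ) : wrap B M x ≡ x [MOD M] := by
  unfold wrap
  split_ifs with h
  · rfl
  · have : B + (x - B) % M ≡ B + (x - B) [MOD M] := (Nat.mod_modEq _ _).add_left _
    rwa [Nat.add_sub_cancel' (by omega)] at this

theorem wrap_eq_of_modEq {B M x y : ℕ} (hx : B ≤ x) (hy : B ≤ y) (h : x ≡ y [MOD M]) :
    wrap B M x = wrap B M y := by
  rw [wrap, wrap, if_neg (by omega), if_neg (by omega)]
  have : x - B ≡ y - B [MOD M] := by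
    refine Nat.ModEq.add_right_cancel' B ?_
    rwa [Nat.sub_add_cancel hx, Nat.sub_add_cancel hy]
  rw [this]

/-- Classes can be added. -/
theorem wrap_add_wrap (B M x y : ℕ) :
    wrap B M (wrap B M x + wrap B M y) = wrap B M (x + y) := by
  by_cases hx : x < B
  · by_cases hy : y < B
    · rw [wrap_of_lt hx, wrap_of_lt hy]
    · have := le_wrap (M := M) (not_lt.1 hy)
      exact wrap_eq_of_modEq (by omega) (by omega) ((wrap_modEq _ _ _).add (wrap_modEq _ _ _))
  · have := le_wrap (M := M) (not_lt.1 hx)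
    exact wrap_eq_of_modEq (by omega) (by omega) ((wrap_modEq _ _ _).add (wrap_modEq _ _ _))

/-! ### Arithmetic notation for expressions -/

instance : Add Expr := ⟨.bin .add⟩
instance : Sub Expr := ⟨.bin .sub⟩
instance : Mul Expr := ⟨.bin .mul⟩
instance : Div Expr := ⟨.bin .div⟩
instance : Mod Expr := ⟨.bin .mod⟩

@[simp] theorem Op.eval_lt (x y : ℕ) : Op.lt.eval x y = if x < y then 1 else 0 := rfl

@[simp] theorem Op.eval_eq (x y : ℕ) : Op.eq.eval x y = if x = y then 1 else 0 := rfl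

namespace Expr

variable (W : ℕ) (s : State) (a b : Expr)

@[simp] theorem eval_var (x : ℕ) : (var x).eval s = s.reg x := rfl
@[simp] theorem eval_lit (c : ℕ) : (lit c).eval s = c := rfl
@[simp] theorem eval_get (x : ℕ) : (get x a).eval s = s.arr x (a.eval s) := rfl
@[simp] theorem eval_add : (a + b).eval s = a.eval s + b.eval s := rfl
@[simp] theorem eval_sub : (a - b).eval s = a.eval s - b.eval s := rfl
@[simp] theorem eval_mul : (a * b).eval s = a.eval s * b.eval s := rfl
@[simp] theorem eval_div : (a / b).eval s = a.eval s / b.eval s := rfl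
@[simp] theorem eval_mod : (a % b).eval s = a.eval s % b.eval s := rfl
@[simp] theorem eval_lt : (bin .lt a b).eval s = Op.lt.eval (a.eval s) (b.eval s) := rfl
@[simp] theorem eval_eq : (bin .eq a b).eval s = Op.eq.eval (a.eval s) (b.eval s) := rfl

@[simp] theorem safe_var (x : ℕ) : (var x).Safe W s ↔ x < 100 := .rfl
@[simp] theorem safe_lit (c : ℕ) : (lit c).Safe W s ↔ c < W := .rfl
@[simp] theorem safe_get (x : ℕ) : (get x a).Safe W s ↔ a.Safe W s := .rfl
@[simp] theorem safe_add :
    (a + b).Safe W s ↔ a.Safe W s ∧ b.Safe W s ∧ a.eval s + b.eval s < W := .rfl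
@[simp] theorem safe_mul :
    (a * b).Safe W s ↔ a.Safe W s ∧ b.Safe W s ∧ a.eval s * b.eval s < W := .rfl
@[simp] theorem safe_sub : (a - b).Safe W s ↔ a.Safe W s ∧ b.Safe W s := by
  change _ ∧ _ ∧ True ↔ _
  simp
@[simp] theorem safe_div : (a / b).Safe W s ↔ a.Safe W s ∧ b.Safe W s := by
  change _ ∧ _ ∧ True ↔ _
  simp
@[simp] theorem safe_mod : (a % b).Safe W s ↔ a.Safe W s ∧ b.Safe W s := by
  change _ ∧ _ ∧ True ↔ _
  simp
@[simp] theorem safe_lt : (bin .lt a b).Safe W s ↔ a.Safe W s ∧ b.Safe W s := by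
  change _ ∧ _ ∧ True ↔ _
  simp
@[simp] theorem safe_eq : (bin .eq a b).Safe W s ↔ a.Safe W s ∧ b.Safe W s := by
  change _ ∧ _ ∧ True ↔ _
  simp

@[simp] theorem cost_var (x : ℕ) : (var x).cost = 2 := rfl
@[simp] theorem cost_lit (c : ℕ) : (lit c).cost = 1 := rfl
@[simp] theorem cost_get (x : ℕ) : (get x a).cost = a.cost + 1 := rfl
@[simp] theorem cost_add : (a + b).cost = a.cost + (b.cost + 1) := rfl
@[simp] theorem cost_sub : (a - b).cost = a.cost + (b.cost + 1) := rfl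
@[simp] theorem cost_mul : (a * b).cost = a.cost + (b.cost + 1) := rfl
@[simp] theorem cost_div : (a / b).cost = a.cost + (b.cost + 1) := rfl
@[simp] theorem cost_mod : (a % b).cost = a.cost + (b.cost + 1) := rfl
@[simp] theorem cost_lt : (bin .lt a b).cost = a.cost + (b.cost + 1) := rfl
@[simp] theorem cost_eq : (bin .eq a b).cost = a.cost + (b.cost + 1) := rfl

end Expr

/-! ### Sumsets of tables of digit vectors -/

/-- The values of the registers and of the tables of powers on which the operations on digit vectors
depend: vectors have `s` digits to base `D = s + 1 + M`. -/
structure Params (W s M : ℕ) (σ : State) : Prop where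
  one_lt : 1 < W
  M_pos : 0 < M
  D_lt : 3 * (s + 1 + M) < W
  N_lt : 3 * (s + 1 + M) ^ s < W
  sum_lt : s * (s + 1 + M) < W
  reg_s : σ.reg 3 = s
  reg_M : σ.reg 6 = M
  reg_D : σ.reg 7 = s + 1 + M
  reg_N : σ.reg 8 = (s + 1 + M) ^ s
  pow_D : ∀ i < s, σ.arr 11 i = (s + 1 + M) ^ i
  pow_3 : ∀ i < s, σ.arr 5 i = 3 ^ i

theorem Params.of_frame {W s M : ℕ} {σ σ' : State} {p : Prog} (h : Params W s M σ)
    (hf : Frame p σ σ') (h3 : p.setsReg 3 = false := by rfl) (h6 : p.setsReg 6 = false := by rfl)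
    (h7 : p.setsReg 7 = false := by rfl) (h8 : p.setsReg 8 = false := by rfl)
    (h11 : p.setsArr 11 = false := by rfl) (h5 : p.setsArr 5 = false := by rfl) :
    Params W s M σ' where
  one_lt := h.one_lt
  M_pos := h.M_pos
  D_lt := h.D_lt
  N_lt := h.N_lt
  sum_lt := h.sum_lt
  reg_s := (hf.reg 3 (by norm_num) h3).trans h.reg_s
  reg_M := (hf.reg 6 (by norm_num) h6).trans h.reg_M
  reg_D := (hf.reg 7 (by norm_num) h7).trans h.reg_D
  reg_N := (hf.reg 8 (by norm_num) h8).trans h.reg_N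
  pow_D := fun i hi => by rw [hf.arr 11 h11, h.pow_D i hi]
  pow_3 := fun i hi => by rw [hf.arr 5 h5, h.pow_3 i hi]

theorem Params.setReg {W s M : ℕ} {σ : State} (h : Params W s M σ) {x v : ℕ}
    (h3 : 3 ≠ x := by norm_num) (h6 : 6 ≠ x := by norm_num) (h7 : 7 ≠ x := by norm_num)
    (h8 : 8 ≠ x := by norm_num) : Params W s M (σ.setReg x v) :=
  ⟨h.one_lt, h.M_pos, h.D_lt, h.N_lt, h.sum_lt, by simp [h3, h.reg_s], by simp [h6, h.reg_M],
    by simp [h7, h.reg_D], by simp [h8, h.reg_N], h.pow_D, h.pow_3⟩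

theorem Params.setArr {W s M : ℕ} {σ : State} (h : Params W s M σ) {a i v : ℕ}
    (h11 : 11 ≠ a := by norm_num) (h5 : 5 ≠ a := by norm_num) : Params W s M (σ.setArr a i v) :=
  ⟨h.one_lt, h.M_pos, h.D_lt, h.N_lt, h.sum_lt, h.reg_s, h.reg_M, h.reg_D, h.reg_N,
    fun i hi => by simp [h11, h.pow_D i hi], fun i hi => by simp [h5, h.pow_3 i hi]⟩

/-- The digit at position `i` (register `12`) of the number in register `x`. -/
def Expr.digitOf (x : ℕ) : Expr := .var x / .get 11 (.var 12) % .var 7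

theorem Params.eval_digitOf {W s M : ℕ} {σ : State} (h : Params W s M σ) {i x : ℕ} (hi : i < s)
    (h12 : σ.reg 12 = i) : (Expr.digitOf x).eval σ = digit (s + 1 + M) (σ.reg x) i := by
  simp [Expr.digitOf, h12, h.reg_D, h.pow_D i hi, digit]

/-- Add the digit vectors in registers `14` and `15`, digit by digit as classes of `wrap`, and leave
the result in register `16`. -/
def addVectors : Prog :=
  .assign 16 (.lit 0) ;;
  .for_ 12 3 (
    .assign 17 (.digitOf 14 + .digitOf 15) ;;
    .branch (.bin .lt (.var 17) (.var 3 + .lit 1)) .skip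
      (.assign 17 (.var 3 + .lit 1 + (.var 17 - (.var 3 + .lit 1)) % .var 6)) ;;
    .assign 16 (.var 16 + .var 17 * .get 11 (.var 12)))

theorem runs_addVectors {W s M : ℕ} {σ : State} (h : Params W s M σ) {a b : ℕ}
    (ha : σ.reg 14 = a) (hb : σ.reg 15 = b) :
    Runs W addVectors σ (100 * (s + 1)) fun σ' =>
      σ'.reg 16 = pack (s + 1 + M) s fun i =>
        wrap (s + 1) M (digit (s + 1 + M) a i + digit (s + 1 + M) b i) := by
  have h1 := h.one_lt
  have hs : s < W := by have := h.D_lt; omega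
  set f : ℕ → ℕ := fun i => wrap (s + 1) M (digit (s + 1 + M) a i + digit (s + 1 + M) b i)
  have hf : ∀ i, f i < s + 1 + M := fun i => wrap_lt _ h.M_pos _
  refine Runs.seq_assign (v := 0) h1 (by simp; omega) rfl (by simp; omega) ?_
  refine Runs.for_ (I := fun j σ' => σ'.reg 16 = pack (s + 1 + M) j f) 80 h1 (by simp [h.reg_s]) hs
    (by intros; simpa) (by simp [pack]) ?_ (by simp; omega)
  intro j σ₁ hj hj12 hf1 hI
  have ha1 : σ₁.reg 14 = a := (hf1.reg 14 (by norm_num) rfl).trans (by simpa)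
  have hb1 : σ₁.reg 15 = b := (hf1.reg 15 (by norm_num) rfl).trans (by simpa)
  have hp : Params W s M σ₁ := (h.setReg (x := 16)).of_frame hf1
  have hda := digit_lt (show 0 < s + 1 + M by omega) a j
  have hdb := digit_lt (show 0 < s + 1 + M by omega) b j
  have hD := h.D_lt
  refine Runs.seq_assign (v := digit (s + 1 + M) a j + digit (s + 1 + M) b j) h1
    ?_ (by simp [hp.eval_digitOf hj hj12, ha1, hb1]) (by simp [Expr.digitOf]) ?_
  · rw [Expr.safe_add, hp.eval_digitOf hj hj12, hp.eval_digitOf hj hj12, ha1, hb1]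
    refine ⟨by simp [Expr.digitOf], by simp [Expr.digitOf], by omega⟩
  refine Runs.seq (T₁ := 30) (Q := fun σ' => σ'.reg 17 = f j) ?_ (by simp [Expr.digitOf]) ?_
  · refine Runs.branch h1 ?_ (by simp) (fun hlt => Runs.skip ?_ (by simp)) (fun hlt => ?_)
    · simp [hp.reg_s]
      omega
    · simp [hp.reg_s] at hlt
      simp [f, wrap, hlt]
    · have hlt : ¬ digit (s + 1 + M) a j + digit (s + 1 + M) b j < s + 1 := by
        simpa [hp.reg_s, Nat.lt_succ_iff] using hlt
      have hm := Nat.mod_lt (digit (s + 1 + M) a j + digit (s + 1 + M) b j - (s + 1)) h.M_pos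
      refine Runs.assign (v := f j) h1 ?_ ?_ (by simp) (by simp)
      · simp [hp.reg_s, hp.reg_M]
        omega
      · simp only [f, wrap, if_neg hlt]
        simp [hp.reg_s, hp.reg_M]
  · intro σ₂ hf2 h17
    have hp2 : Params W s M σ₂ := (hp.setReg (x := 17)).of_frame hf2
    have h12 : σ₂.reg 12 = j := (hf2.reg 12 (by norm_num) rfl).trans (by simpa)
    have h16 : σ₂.reg 16 = pack (s + 1 + M) j f :=
      (hf2.reg 16 (by norm_num) rfl).trans (by simpa)
    have hlt : pack (s + 1 + M) (j + 1) f < W := by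
      have h3 := pack_lt (j + 1) fun i _ => hf i
      have h4 : (s + 1 + M) ^ (j + 1) ≤ (s + 1 + M) ^ s := Nat.pow_le_pow_right (by omega) hj
      have := h.N_lt
      omega
    rw [pack_succ] at hlt
    refine Runs.assign (v := pack (s + 1 + M) (j + 1) f) h1 ?_ ?_ (by simp) (by simp [Expr.digitOf])
    · simp [h17, h12, h16, hp2.pow_D j hj]
      have : f j * (s + 1 + M) ^ j < W := by omega
      omega
    · simp [h17, h12, h16, hp2.pow_D j hj, pack_succ]

/-- The cells of array `a` with index below `D ^ s` mark the vectors of classes of the members of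
`X`. -/
def Marks (s M a : ℕ) (X : Set (ℕ → ℕ)) (σ : State) : Prop :=
  ∀ c < (s + 1 + M) ^ s,
    σ.arr a c ≠ 0 ↔ ∃ x ∈ X, pack (s + 1 + M) s (fun i => wrap (s + 1) M (x i)) = c

theorem Marks.of_frame {s M a : ℕ} {X : Set (ℕ → ℕ)} {σ σ' : State} {p : Prog}
    (h : Marks s M a X σ) (hf : Frame p σ σ') (ha : p.setsArr a = false := by rfl) :
    Marks s M a X σ' := by
  intro c hc
  rw [hf.arr a ha]
  exact h c hc

theorem Marks.congr {s M a b : ℕ} {X : Set (ℕ → ℕ)} {σ σ' : State} (h : Marks s M a X σ)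
    (hab : ∀ c < (s + 1 + M) ^ s, σ'.arr b c = σ.arr a c) : Marks s M b X σ' := by
  intro c hc
  rw [hab c hc]
  exact h c hc

/-- Fill array `16` with the sumset of arrays `a` and `b`. -/
def sumTables (a b : ℕ) : Prog :=
  .for_ 13 8 (.put 16 (.var 13) (.lit 0)) ;;
  .for_ 14 8 (.when (.get a (.var 14))
    (.for_ 15 8 (.when (.get b (.var 15)) (addVectors ;; .put 16 (.var 16) (.lit 1)))))

theorem setsArr_sumTables {a b x : ℕ} (hx : x ≠ 16) :
    (sumTables a b).setsArr x = false := by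
  simp [sumTables, Prog.setsArr, Prog.for_, Prog.assign, Prog.put, Prog.while_, Prog.when,
    Prog.branch, addVectors, hx]

theorem wrap_digit_pack (s : ℕ) {M : ℕ} (hM : 0 < M) (x y : ℕ → ℕ) :
    (pack (s + 1 + M) s fun i =>
      wrap (s + 1) M (digit (s + 1 + M) (pack (s + 1 + M) s fun i => wrap (s + 1) M (x i)) i +
        digit (s + 1 + M) (pack (s + 1 + M) s fun i => wrap (s + 1) M (y i)) i)) =
    pack (s + 1 + M) s fun i => wrap (s + 1) M (x i + y i) := by
  refine pack_congr fun i hi => ?_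
  rw [digit_pack s (fun i _ => wrap_lt _ hM _) hi, digit_pack s (fun i _ => wrap_lt _ hM _) hi,
    wrap_add_wrap]

open Pointwise in
theorem runs_sumTables {W s M : ℕ} {σ : State} (h : Params W s M σ) {a b : ℕ} (ha : a ≠ 16)
    (hb : b ≠ 16) {X Y : Set (ℕ → ℕ)} (hX : Marks s M a X σ) (hY : Marks s M b Y σ) :
    Runs W (sumTables a b) σ (200 * (s + 1) * ((s + 1 + M) ^ s + 1) ^ 2)
      (Marks s M 16 (X + Y)) := by
  have h1 := h.one_lt
  set D := s + 1 + M with hD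
  set N := D ^ s with hN
  have hNW : N < W := by have : 3 * N < W := h.N_lt; omega
  set g : ℕ → ℕ → ℕ := fun a b => pack D s fun i => wrap (s + 1) M (digit D a i + digit D b i)
    with hg
  have hgN : ∀ a b, g a b < N := fun a b => pack_lt s fun i _ => wrap_lt _ h.M_pos _
  have hT : 200 * (s + 1) * (N + 1) ^ 2 =
      200 * (s + 1) * N ^ 2 + 400 * (s + 1) * N + 200 * (s + 1) := by ring
  have hT1 : N * (20 + 12) + 12 ≤ 200 * (s + 1) * (N + 1) ^ 2 := by nlinarith
  refine Runs.seq (Q := fun σ' => ∀ c < N, σ'.arr 16 c = 0) (T₁ := N * (20 + 12) + 12)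
    (Runs.for_ (I := fun j σ' => ∀ c < j, σ'.arr 16 c = 0) 20 h1 (N := N) h.reg_N hNW (by simp) (by simp)
      ?_ le_rfl) hT1 ?_
  · intro j σ₁ hj h13 hf hI
    refine Runs.put (k := j) (v := 0) h1 (by simp) (by simp; omega) (by simpa) rfl ?_ (by simp)
    intro c hc
    by_cases hcj : c = j
    · simp [hcj]
    · simp [hcj, hI c (by omega)]
  intro σ₁ hf₁ hz
  have hp₁ : Params W s M σ₁ := h.of_frame hf₁
  set body : Prog := .for_ 15 8 (.when (.get b (.var 15)) (addVectors ;; .put 16 (.var 16) (.lit 1)))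
  have hframe : ∀ x, x ≠ 16 → (Prog.for_ 14 8 (.when (.get a (.var 14)) body)).setsArr x = false := by
    intro x hx
    have := setsArr_sumTables (a := a) (b := b) hx
    simp only [sumTables, Prog.setsArr, Bool.or_eq_false_iff] at this
    exact this.2
  have hframe' : ∀ x, x ≠ 16 → body.setsArr x = false := by
    intro x hx
    have := hframe x hx
    simp only [Prog.for_, Prog.while_, Prog.when, Prog.branch, Prog.setsArr,
      Bool.or_eq_false_iff] at this
    exact this.2.2.1.1.2.1
  have hfr : ∀ x, x ≠ 16 → (Prog.for_ 13 8 (.put 16 (.var 13) (.lit 0))).setsArr x = false := by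
    intro x hx
    have := setsArr_sumTables (a := a) (b := b) hx
    simp only [sumTables, Prog.setsArr, Bool.or_eq_false_iff] at this
    exact this.1
  refine (Runs.for_ (I := fun j σ' => ∀ c < N, σ'.arr 16 c ≠ 0 ↔
    ∃ u v, u < j ∧ v < N ∧ σ.arr a u ≠ 0 ∧ σ.arr b v ≠ 0 ∧ g u v = c)
    (N * (100 * (s + 1) + 30 + 12) + 12 + 20) h1 (N := N) hp₁.reg_N hNW (by simp) ?_ ?_ ?_).imp ?_
  · intro c hc
    simp [hz c hc]
  · intro u σ₂ hu h14 hf₂ hI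
    have hp₂ : Params W s M σ₂ := hp₁.of_frame hf₂
    have hua : σ₂.arr a = σ.arr a := (hf₂.arr a (hframe a ha)).trans (hf₁.arr a (hfr a ha))
    have hub : σ₂.arr b = σ.arr b := (hf₂.arr b (hframe b hb)).trans (hf₁.arr b (hfr b hb))
    refine Runs.when h1 (by simp) (by simp) (fun hau => ?_) (fun hau => ?_)
    · simp only [Expr.eval_get, Expr.eval_var, h14, hua] at hau
      refine (Runs.for_ (I := fun j σ' => ∀ c < N, σ'.arr 16 c ≠ 0 ↔
        ∃ u' v, (u' < u ∨ u' = u ∧ v < j) ∧ v < N ∧ σ.arr a u' ≠ 0 ∧ σ.arr b v ≠ 0 ∧ g u' v = c)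
        (100 * (s + 1) + 30) h1 (N := N) hp₂.reg_N hNW (by simp) ?_ ?_ (by simp)).imp ?_
      · simpa using hI
      · intro v σ₃ hv h15 hf₃ hI₃
        have hp₃ : Params W s M σ₃ := hp₂.of_frame hf₃
        have h14' : σ₃.reg 14 = u := (hf₃.reg 14 (by norm_num) rfl).trans h14
        have hvb : σ₃.arr b = σ.arr b := (hf₃.arr b (hframe' b hb)).trans hub
        refine Runs.when h1 (by simp) (by simp) (fun hbv => ?_) (fun hbv => ?_)
        · simp only [Expr.eval_get, Expr.eval_var, h15, hvb] at hbv
          refine (runs_addVectors hp₃ h14' h15).seq (by simp) fun σ₄ hf₄ h16 => ?_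
          have harr : σ₄.arr = σ₃.arr := funext fun x => hf₄.arr x rfl
          refine Runs.put (k := g u v) (v := 1) h1 (by simp) (by simpa) (by simpa) rfl ?_
            (by simp)
          intro c hc
          by_cases hcg : c = g u v
          · simp only [State.setArr_arr, if_true, if_pos hcg, ne_eq, one_ne_zero,
              not_false_eq_true, true_iff]
            exact ⟨u, v, .inr ⟨rfl, by omega⟩, hv, hau, hbv, hcg.symm⟩
          · simp only [State.setArr_arr, if_true, if_neg hcg, harr, hI₃ c hc]
            constructor
            · rintro ⟨u', v', h, h'⟩
              exact ⟨u', v', by omega, h'⟩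
            · rintro ⟨u', v', h, h', h3, h4, h5⟩
              refine ⟨u', v', ?_, h', h3, h4, h5⟩
              by_contra hc'
              obtain ⟨rfl, rfl⟩ : u' = u ∧ v' = v := by omega
              exact hcg h5.symm
        · simp only [Expr.eval_get, Expr.eval_var, h15, hvb] at hbv
          intro c hc
          rw [hI₃ c hc]
          constructor
          · rintro ⟨u', v', h, h'⟩
            exact ⟨u', v', by omega, h'⟩
          · rintro ⟨u', v', h, h', h3, h4, h5⟩
            refine ⟨u', v', ?_, h', h3, h4, h5⟩
            by_contra hc'
            obtain ⟨rfl, rfl⟩ : u' = u ∧ v' = v := by omega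
            exact h4 hbv
      · intro σ₃ hf₃ hI₃ c hc
        rw [hI₃ c hc]
        constructor
        · rintro ⟨u', v', h, h', h''⟩
          exact ⟨u', v', by omega, h', h''⟩
        · rintro ⟨u', v', h, h', h''⟩
          exact ⟨u', v', by omega, h', h''⟩
    · simp only [Expr.eval_get, Expr.eval_var, h14, hua] at hau
      intro c hc
      rw [hI c hc]
      constructor
      · rintro ⟨u', v', h, h'⟩
        exact ⟨u', v', by omega, h'⟩
      · rintro ⟨u', v', h, h', h3, h4⟩
        refine ⟨u', v', ?_, h', h3, h4⟩
        by_contra hc'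
        obtain rfl : u' = u := by omega
        exact h3 hau
  · have : N * (N * (100 * (s + 1) + 30 + 12) + 12 + 20 + 12) =
        100 * (s + 1) * N ^ 2 + 42 * N ^ 2 + 44 * N := by ring
    rw [this, hT]
    have h3 : 42 * N ^ 2 ≤ 42 * (s + 1) * N ^ 2 := by nlinarith [sq_nonneg N]
    have h4 : 100 * N ≤ 100 * (s + 1) * N := by nlinarith
    have h5 : 100 * (s + 1) * N ^ 2 + 42 * (s + 1) * N ^ 2 ≤ 200 * (s + 1) * N ^ 2 := by
      nlinarith [sq_nonneg N]
    have h6 : 100 * (s + 1) * N ≤ 400 * (s + 1) * N := by nlinarith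
    omega
  · intro σ₂ hf₂ hI c hc
    rw [hI c hc]
    constructor
    · rintro ⟨u, v, hu, hv, hau, hbv, rfl⟩
      obtain ⟨x, hx, rfl⟩ := (hX u hu).1 hau
      obtain ⟨y, hy, rfl⟩ := (hY v hv).1 hbv
      exact ⟨x + y, Set.add_mem_add hx hy, (wrap_digit_pack s h.M_pos x y).symm⟩
    · rintro ⟨_, ⟨x, hx, y, hy, rfl⟩, rfl⟩
      have hlt : ∀ z : ℕ → ℕ, pack D s (fun i => wrap (s + 1) M (z i)) < N :=
        fun z => pack_lt s fun i _ => wrap_lt _ h.M_pos _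
      exact ⟨_, _, hlt x, hlt y, (hX _ (hlt x)).2 ⟨x, hx, rfl⟩, (hY _ (hlt y)).2 ⟨y, hy, rfl⟩,
        wrap_digit_pack s h.M_pos x y⟩

end WordRAM

open scoped Pointwise

namespace WordRAM

/-! ### Multiples of a set of patterns -/

/-- Copy array `16` to array `a`. -/
def copyTable (a : ℕ) : Prog := .for_ 13 8 (.put a (.var 13) (.get 16 (.var 13)))

theorem runs_copyTable {W s M : ℕ} {σ : State} (h : Params W s M σ) {a : ℕ} (ha : a ≠ 16)
    {X : Set (ℕ → ℕ)} (hX : Marks s M 16 X σ) :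
    Runs W (copyTable a) σ (40 * ((s + 1 + M) ^ s + 1)) (Marks s M a X) := by
  have h1 := h.one_lt
  set N := (s + 1 + M) ^ s with hN
  have hNW : N < W := by have : 3 * N < W := h.N_lt; omega
  refine (Runs.for_ (I := fun j σ' => ∀ c < j, σ'.arr a c = σ.arr 16 c) 20 h1 (N := N) h.reg_N hNW
    (by simp) (by simp) ?_ (by omega)).imp fun σ' _ hI => hX.congr hI
  intro j σ₁ hj h13 hf hI
  have h16 : σ₁.arr 16 = σ.arr 16 := hf.arr 16 (by
    simp [Prog.setsArr, Prog.for_, Prog.assign, Prog.put, Prog.while_, ha.symm])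
  refine Runs.put (k := j) (v := σ.arr 16 j) h1 (by simp) (by simp) (by simpa) (by simp [h13, h16])
    ?_ (by simp)
  intro c hc
  by_cases hcj : c = j
  · simp [hcj]
  · simp [hcj, hI c (by omega)]

/-- The `c`-fold sumset of `Y`. -/
def multiple (c : ℕ) (Y : Set (ℕ → ℕ)) : Set (ℕ → ℕ) := ∑ _i ∈ Finset.range c, Y

theorem multiple_two_mul (c : ℕ) (Y : Set (ℕ → ℕ)) : multiple (2 * c) Y = multiple c (Y + Y) := by
  rw [multiple, multiple, Finset.sum_add_distrib, two_mul, Finset.sum_range_add]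

/-- Add the set in array `15` to the one in array `14` as often as register `19` says, by repeated
doubling. -/
def addMultiples : Prog :=
  .while_ (.var 19) (
    .when (.var 19 % .lit 2) (sumTables 14 15 ;; copyTable 14) ;;
    sumTables 15 15 ;; copyTable 15 ;;
    .assign 19 (.var 19 / .lit 2))

theorem runs_addMultiples {W s M L c : ℕ} {σ : State} (h : Params W s M σ) {X Y : Set (ℕ → ℕ)}
    (hX : Marks s M 14 X σ) (hY : Marks s M 15 Y σ) (hc : σ.reg 19 = c) (hcL : c < 2 ^ L)
    (h2 : 2 < W) :
    Runs W addMultiples σ (1000 * (L + 1) * ((s + 1) * ((s + 1 + M) ^ s + 1) ^ 2))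
      (Marks s M 14 (X + multiple c Y)) := by
  have h1 := h.one_lt
  set N := (s + 1 + M) ^ s with hN
  set R := (s + 1) * (N + 1) ^ 2 with hR
  have hR1 : N + 1 ≤ R := by nlinarith
  have hR' : 200 * (s + 1) * ((s + 1 + M) ^ s + 1) ^ 2 = 200 * R := by rw [← hN, hR]; ring
  refine (Runs.while_ (I := fun k σ' => σ'.reg 19 < 2 ^ k ∧ ∃ X' Y', Marks s M 14 X' σ' ∧
    Marks s M 15 Y' σ' ∧ X' + multiple (σ'.reg 19) Y' = X + multiple c Y) (600 * R) h1 (k := L)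
    ⟨by rwa [hc], X, Y, hX, hY, by rw [hc]⟩ (by simp) ?_ ?_).imp ?_
  · rintro k σ₁ hf ⟨hk, X', Y', hX', hY', hXY⟩ hne
    have hp : Params W s M σ₁ := h.of_frame hf
    simp only [Expr.eval_var] at hne
    cases k with
    | zero => simp at hk; omega
    | succ k =>
      refine ⟨k, rfl, ?_⟩
      refine Runs.seq (T₁ := 300 * R) (Q := Marks s M 14 (X' + multiple (σ₁.reg 19 % 2) Y')) ?_
        (by omega) ?_
      · refine Runs.when h1 (by simp; omega) (by simp; omega) (fun hodd => ?_) (fun heven => ?_)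
        · simp only [Expr.eval_mod, Expr.eval_var, Expr.eval_lit] at hodd
          have hodd : σ₁.reg 19 % 2 = 1 := by omega
          refine (runs_sumTables hp (by norm_num) (by norm_num) hX' hY').seq (by simp; omega)
            fun σ₂ hf₂ h16 => ?_
          rw [hodd, multiple, Finset.sum_range_one]
          exact (runs_copyTable (hp.of_frame hf₂) (by norm_num) h16).mono (by simp; omega)
        · simp only [Expr.eval_mod, Expr.eval_var, Expr.eval_lit] at heven
          rwa [heven, multiple, Finset.sum_range_zero, add_zero]
      · intro σ₂ hf₂ h14
        have hp₂ : Params W s M σ₂ := hp.of_frame hf₂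
        have h15 : Marks s M 15 Y' σ₂ := hY'.of_frame hf₂
        refine (runs_sumTables hp₂ (by norm_num) (by norm_num) h15 h15).seq (by omega)
            fun σ₃ hf₃ h16 => ?_
        have hp₃ : Params W s M σ₃ := hp₂.of_frame hf₃
        refine (runs_copyTable hp₃ (by norm_num) h16).seq (by omega) fun σ₄ hf₄ h15' => ?_
        have h19 : σ₄.reg 19 = σ₁.reg 19 := (hf₄.reg 19 (by norm_num) rfl).trans
          ((hf₃.reg 19 (by norm_num) rfl).trans (hf₂.reg 19 (by norm_num) rfl))
        have h14' := (h14.of_frame hf₃).of_frame hf₄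
        refine Runs.assign (v := σ₁.reg 19 / 2) h1 (by simp; omega) (by simp [h19])
          ⟨?_, _, _, h14', h15', ?_⟩ (by simp; omega)
        · simp only [State.setReg_reg, if_true]
          rw [pow_succ] at hk
          omega
        · simp only [State.setReg_reg, if_true]
          rw [← hXY, ← multiple_two_mul, add_assoc]
          congr 1
          rw [multiple, multiple, ← Finset.sum_range_add, Nat.mod_add_div, multiple]
  · simp only [Expr.cost_var]
    nlinarith
  · rintro σ' hf ⟨h0, k, hk, X', Y', hX', hY', hXY⟩
    simp only [Expr.eval_var] at h0
    rw [h0, multiple, Finset.sum_range_zero, add_zero] at hXY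
    rwa [← hXY]

end WordRAM

namespace WordRAM

/-! ### The patterns of a type -/

/-- The contributions `y` of one item to the colours of the `s` cover vertices that an item of type
`t` may make if `col` are the (classes of the) colours of the cover vertices: `t i` is `0` if the
item is not joined to the cover vertex `i`, `1` if it is joined by an edge, and `2` if it is joined
by an edge of prescribed weight `1`. The colour of the item itself, which is the sum of the `y i`,
has to differ from the colours of its neighbours. -/
def patterns (s : ℕ) (t col : ℕ → ℕ) : Set (ℕ → ℕ) :=
  {y | ∀ i < s, y i ≤ t i ∧ y i ≤ 1 ∧ t i / 2 ≤ y i ∧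
    (t i ≠ 0 → ∑ j ∈ Finset.range s, y j ≠ col i)}

theorem mem_patterns_congr {s : ℕ} {t col y z : ℕ → ℕ} (h : ∀ i < s, y i = z i) :
    y ∈ patterns s t col ↔ z ∈ patterns s t col := by
  have hsum : ∑ j ∈ Finset.range s, y j = ∑ j ∈ Finset.range s, z j :=
    Finset.sum_congr rfl fun i hi => h i (Finset.mem_range.1 hi)
  refine forall₂_congr fun i hi => ?_
  rw [h i hi, hsum]

theorem exists_patterns_iff {s M : ℕ} (hM : 0 < M) {t col : ℕ → ℕ} {c : ℕ}
    (hc : c < (s + 1 + M) ^ s) :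
    (∃ y ∈ patterns s t col, pack (s + 1 + M) s (fun i => wrap (s + 1) M (y i)) = c) ↔
      digit (s + 1 + M) c ∈ patterns s t col := by
  constructor
  · rintro ⟨y, hy, rfl⟩
    refine (mem_patterns_congr fun i hi => ?_).1 hy
    rw [digit_pack s (fun i _ => wrap_lt _ hM _) hi, wrap_of_lt]
    have := (hy i hi).2.1
    omega
  · refine fun h => ⟨_, h, ?_⟩
    conv_rhs => rw [← pack_digit s hc]
    refine pack_congr fun i hi => wrap_of_lt ?_
    have := (h i hi).2.1
    omega

/-- The condition that the digit in register `17` violates the type in register `21`. The sum of the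
digits is in register `18`, and array `a` holds the colours. -/
def Expr.violated (a : ℕ) : Expr :=
  .bin .lt (.var 21) (.var 17) + (.bin .lt (.lit 1) (.var 17) +
    (.bin .lt (.var 17) (.var 21 / .lit 2) +
      .bin .lt (.lit 0) (.var 21) * .bin .eq (.var 18) (.get a (.var 12))))

theorem eval_violated (a : ℕ) (σ : State) : (Expr.violated a).eval σ = 0 ↔
    σ.reg 17 ≤ σ.reg 21 ∧ σ.reg 17 ≤ 1 ∧ σ.reg 21 / 2 ≤ σ.reg 17 ∧
      (σ.reg 21 ≠ 0 → σ.reg 18 ≠ σ.arr a (σ.reg 12)) := by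
  simp [Expr.violated]
  tauto

theorem safe_violated {W : ℕ} (hW : 4 < W) (a : ℕ) (σ : State) :
    (Expr.violated a).Safe W σ := by
  have h : ∀ (p : Prop) [Decidable p], (if p then 1 else 0) ≤ 1 := by
    intro p _
    split_ifs <;> omega
  have h1 := h (σ.reg 21 < σ.reg 17)
  have h2 := h (1 < σ.reg 17)
  have h3 := h (σ.reg 17 < σ.reg 21 / 2)
  have h4 := h (0 < σ.reg 21)
  have h5 := h (σ.reg 18 = σ.arr a (σ.reg 12))
  have h6 := Nat.mul_le_mul h4 h5
  simp only [Expr.violated, Expr.safe_add, Expr.safe_mul, Expr.safe_lt, Expr.safe_eq,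
    Expr.safe_var, Expr.safe_lit, Expr.safe_div, Expr.safe_get, Expr.eval_add, Expr.eval_mul,
    Expr.eval_lt, Expr.eval_eq, Op.eval_lt, Op.eval_eq, Expr.eval_var, Expr.eval_lit, Expr.eval_div, Expr.eval_get]
  refine ⟨?_, ⟨?_, ⟨?_, ⟨?_, ?_, ?_⟩, ?_⟩, ?_⟩, ?_⟩ <;> omega

/-- Fill array `15` with the patterns of the type in register `11` for the colours in array `a`. -/
def patternTable (a : ℕ) : Prog :=
  .for_ 13 8 (
    .assign 18 (.lit 0) ;;
    .for_ 12 3 (.assign 18 (.var 18 + .digitOf 13)) ;;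
    .assign 20 (.lit 0) ;;
    .for_ 12 3 (
      .assign 17 (.digitOf 13) ;;
      .assign 21 (.var 11 / .get 5 (.var 12) % .lit 3) ;;
      .when (.violated a) (.assign 20 (.lit 1))) ;;
    .put 15 (.var 13) (.bin .eq (.var 20) (.lit 0)))

theorem runs_patternTable {W s M T : ℕ} {σ : State} (h : Params W s M σ) {a : ℕ} (ha : a ≠ 15)
    (hT : σ.reg 11 = T) :
    Runs W (patternTable a) σ (300 * ((s + 1) * ((s + 1 + M) ^ s + 1) ^ 2))
      (Marks s M 15 (patterns s (digit 3 T) (σ.arr a))) := by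
  have h1 := h.one_lt
  set N := (s + 1 + M) ^ s with hN
  have hNW : N < W := by have : 3 * N < W := h.N_lt; omega
  have hDW := h.D_lt
  have hsW : s < W := by omega
  have hM := h.M_pos
  set R := (s + 1) * (N + 1) ^ 2 with hR
  have hR1 : (s + 1) * (N + 1) ≤ R := by nlinarith
  have hT' : N * (250 * (s + 1) + 12) + 12 ≤ 300 * R := by
    clear_value N R
    nlinarith
  have hfr : (patternTable a).setsArr a = false := by
    simp [patternTable, Prog.setsArr, Prog.for_, Prog.assign, Prog.put, Prog.while_, Prog.when,
      Prog.branch, ha]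
  refine (Runs.for_ (I := fun j σ' => ∀ c < j, σ'.arr 15 c ≠ 0 ↔
    digit (s + 1 + M) c ∈ patterns s (digit 3 T) (σ.arr a)) (250 * (s + 1)) h1 (N := N) h.reg_N hNW
    (by simp) (by simp) ?_ hT').imp ?_
  · intro y σ₁ hy h13 hf hI
    have hp : Params W s M σ₁ := h.of_frame hf
    have h11 : σ₁.reg 11 = T := (hf.reg 11 (by norm_num) rfl).trans hT
    have hcol : σ₁.arr a = σ.arr a := hf.arr a hfr
    set d := digit (s + 1 + M) y with hd
    have hdD : ∀ i, d i < s + 1 + M := digit_lt (by omega) y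
    refine Runs.seq_assign (v := 0) h1 (by simp; omega) rfl (by simp; omega) ?_
    refine Runs.seq (T₁ := s * (20 + 12) + 12) (Runs.for_ (I := fun j σ' =>
      σ'.reg 18 = ∑ i ∈ Finset.range j, d i) 20 h1 (N := s) (by simp [hp.reg_s]) hsW
      (by simp) (by simp) ?_ le_rfl) (by simp; omega) ?_
    · intro i σ₂ hi h12 hf₂ hI₂
      have hp₂ : Params W s M σ₂ := (hp.setReg (x := 18)).of_frame hf₂
      have h13₂ : σ₂.reg 13 = y := (hf₂.reg 13 (by norm_num) rfl).trans (by simpa)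
      have hev : (Expr.digitOf 13).eval σ₂ = d i := by rw [hp₂.eval_digitOf hi h12, h13₂]
      refine Runs.assign (v := ∑ i ∈ Finset.range (i + 1), d i) h1 ?_
        (by simp [hI₂, hev, Finset.sum_range_succ]) (by simp) (by simp [Expr.digitOf])
      rw [Expr.safe_add, hev, Expr.eval_var, hI₂, ← Finset.sum_range_succ]
      refine ⟨by simp, by simp [Expr.digitOf], ?_⟩
      calc ∑ i ∈ Finset.range (i + 1), d i ≤ ∑ i ∈ Finset.range (i + 1), (s + 1 + M) :=
            Finset.sum_le_sum fun i _ => (hdD i).le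
        _ = (i + 1) * (s + 1 + M) := by simp
        _ ≤ s * (s + 1 + M) := Nat.mul_le_mul_right _ hi
        _ < W := h.sum_lt
    intro σ₂ hf₂ h18
    have hp₂ : Params W s M σ₂ := (hp.setReg (x := 18)).of_frame hf₂
    have h13₂ : σ₂.reg 13 = y := (hf₂.reg 13 (by norm_num) rfl).trans (by simpa)
    have h11₂ : σ₂.reg 11 = T := (hf₂.reg 11 (by norm_num) rfl).trans (by simpa)
    have harr₂ : σ₂.arr = σ₁.arr := funext fun x => hf₂.arr x (by
      simp [Prog.setsArr, Prog.for_, Prog.assign, Prog.while_])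
    set S := ∑ i ∈ Finset.range s, d i
    set P : ℕ → Prop := fun i => d i ≤ digit 3 T i ∧ d i ≤ 1 ∧ digit 3 T i / 2 ≤ d i ∧
      (digit 3 T i ≠ 0 → S ≠ σ.arr a i) with hP
    refine Runs.seq_assign (v := 0) h1 (by simp; omega) rfl (by simp; omega) ?_
    refine Runs.seq (T₁ := s * (80 + 12) + 12) (Runs.for_ (I := fun j σ' =>
      σ'.reg 20 = 0 ↔ ∀ i < j, P i) 80 h1 (N := s) (by simp [hp₂.reg_s]) hsW
      (by simp) (by simp) ?_ le_rfl) (by simp; omega) ?_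
    · intro i σ₃ hi h12 hf₃ hI₃
      have hp₃ : Params W s M σ₃ := (hp₂.setReg (x := 20)).of_frame hf₃
      have h13₃ : σ₃.reg 13 = y := (hf₃.reg 13 (by norm_num) rfl).trans (by simpa)
      have h11₃ : σ₃.reg 11 = T := (hf₃.reg 11 (by norm_num) rfl).trans (by simpa)
      have h18₃ : σ₃.reg 18 = S := (hf₃.reg 18 (by norm_num) rfl).trans (by simpa)
      have hcol₃ : σ₃.arr a = σ.arr a := by
        rw [← hcol, ← harr₂]
        exact hf₃.arr a (by
          simp [Prog.setsArr, Prog.for_, Prog.assign, Prog.while_, Prog.when, Prog.branch])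
      refine Runs.seq_assign (v := d i) h1 (by simp [Expr.digitOf])
        (by rw [hp₃.eval_digitOf hi h12, h13₃]) (by simp [Expr.digitOf]) ?_
      refine Runs.seq_assign (v := digit 3 T i) h1 (by simp; omega)
        (by simp [h12, h11₃, hp₃.pow_3 i hi, digit]) (by simp [Expr.digitOf]) ?_
      have hv : ∀ σ₄ : State, σ₄ = (σ₃.setReg 17 (d i)).setReg 21 (digit 3 T i) →
          ((Expr.violated a).eval σ₄ = 0 ↔ P i) := by
        rintro _ rfl
        rw [eval_violated]
        simp [hP, h18₃, h12, hcol₃]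
      refine Runs.when h1 (safe_violated (by omega) _ _) (by simp [Expr.digitOf, Expr.violated])
        (fun hne => ?_) (fun h0 => ?_)
      · rw [ne_eq, hv _ rfl] at hne
        refine Runs.assign (v := 1) h1 (by simpa) rfl ?_ (by simp [Expr.digitOf, Expr.violated])
        simp only [State.setReg_reg, if_true, one_ne_zero, false_iff]
        exact fun hc => hne (hc i (by omega))
      · rw [hv _ rfl] at h0
        simp only [State.setReg_reg, Nat.reduceEqDiff, if_false, hI₃]
        refine ⟨fun hc k hk => ?_, fun hc k hk => hc k (by omega)⟩
        rcases Nat.lt_succ_iff_lt_or_eq.1 hk with hk | rfl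
        exacts [hc k hk, h0]
    · intro σ₃ hf₃ h20
      have h13₃ : σ₃.reg 13 = y := (hf₃.reg 13 (by norm_num) rfl).trans (by simpa)
      have harr₃ : σ₃.arr 15 = σ₁.arr 15 := by
        rw [← harr₂]
        exact hf₃.arr 15 rfl
      refine Runs.put (k := y) (v := (Expr.bin .eq (.var 20) (.lit 0)).eval σ₃) h1 (by simp)
        (by simp; omega) (by simpa) rfl ?_ (by simp; omega)
      intro c hc
      by_cases hcy : c = y
      · subst hcy
        simp [patterns, ← hd, h20, P, S]
      · simp only [State.setArr_arr, if_true, if_neg hcy, harr₃]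
        exact hI c (by omega)
  · intro σ' hf hI c hc
    rw [hI c hc, exists_patterns_iff hM hc]

end WordRAM

namespace WordRAM

/-! ### All contributions of the items -/

theorem patterns_congr {s : ℕ} {t col col' : ℕ → ℕ} (h : ∀ i < s, col i = col' i) :
    patterns s t col = patterns s t col' := by
  ext y
  refine forall₂_congr fun i hi => ?_
  rw [h i hi]

/-- All contributions to the colours of the cover vertices that the items can make together, if
there are `cv T` items of type `T` that are vertices outside the cover and `ce T` items of type `T`
that are edges inside the cover. The types are encoded as digit vectors to base `3`. An edge is
treated like a vertex in its middle whose colour must not be `1`, so that its two halves have the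
same weight. -/
def contributions (s : ℕ) (cv ce : ℕ → ℕ) (col : ℕ → ℕ) : Set (ℕ → ℕ) :=
  ∑ T ∈ Finset.range (3 ^ s), (multiple (cv T) (patterns s (digit 3 T) col) +
    multiple (ce T) (patterns s (digit 3 T) fun _ => 1))

theorem contributions_congr {s : ℕ} {cv ce col col' : ℕ → ℕ} (h : ∀ i < s, col i = col' i) :
    contributions s cv ce col = contributions s cv ce col' := by
  simp only [contributions, patterns_congr h]

/-- The digit vector `τ` consists of the classes of the colours of the cover vertices in a proper
weighting: the classes of adjacent cover vertices are different, and the items can produce them. -/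
def IsTarget (s M : ℕ) (cv ce adj : ℕ → ℕ) (τ : ℕ) : Prop :=
  (∀ q < s * s, adj q ≠ 0 → digit (s + 1 + M) τ (q / s) ≠ digit (s + 1 + M) τ (q % s)) ∧
    ∃ x ∈ contributions s cv ce (digit (s + 1 + M) τ),
      pack (s + 1 + M) s (fun i => wrap (s + 1) M (x i)) = τ

/-- The registers and arrays that hold the summary of a graph: the numbers of items of each type and
the adjacency matrix of the cover. -/
structure Summary (W s L : ℕ) (cv ce adj : ℕ → ℕ) (σ : State) : Prop where
  types_lt : 3 ^ s < W
  sq_lt : s * s < W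
  cv_lt : ∀ T < 3 ^ s, cv T < 2 ^ L
  ce_lt : ∀ T < 3 ^ s, ce T < 2 ^ L
  reg_types : σ.reg 9 = 3 ^ s
  reg_sq : σ.reg 23 = s * s
  arr_cv : σ.arr 7 = cv
  arr_ce : σ.arr 8 = ce
  arr_adj : σ.arr 10 = adj
  arr_ones : ∀ i < s, σ.arr 13 i = 1

theorem Summary.of_frame {W s L : ℕ} {cv ce adj : ℕ → ℕ} {σ σ' : State} {p : Prog}
    (h : Summary W s L cv ce adj σ) (hf : Frame p σ σ') (h9 : p.setsReg 9 = false := by rfl)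
    (h23 : p.setsReg 23 = false := by rfl) (h7 : p.setsArr 7 = false := by rfl)
    (h8 : p.setsArr 8 = false := by rfl) (h10 : p.setsArr 10 = false := by rfl)
    (h13 : p.setsArr 13 = false := by rfl) : Summary W s L cv ce adj σ' where
  types_lt := h.types_lt
  sq_lt := h.sq_lt
  cv_lt := h.cv_lt
  ce_lt := h.ce_lt
  reg_types := (hf.reg 9 (by norm_num) h9).trans h.reg_types
  reg_sq := (hf.reg 23 (by norm_num) h23).trans h.reg_sq
  arr_cv := (hf.arr 7 h7).trans h.arr_cv
  arr_ce := (hf.arr 8 h8).trans h.arr_ce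
  arr_adj := (hf.arr 10 h10).trans h.arr_adj
  arr_ones := fun i hi => by rw [hf.arr 13 h13, h.arr_ones i hi]

theorem Summary.setReg {W s L : ℕ} {cv ce adj : ℕ → ℕ} {σ : State}
    (h : Summary W s L cv ce adj σ) {x v : ℕ} (h9 : 9 ≠ x := by norm_num)
    (h23 : 23 ≠ x := by norm_num) : Summary W s L cv ce adj (σ.setReg x v) :=
  ⟨h.types_lt, h.sq_lt, h.cv_lt, h.ce_lt, by simp [h9, h.reg_types], by simp [h23, h.reg_sq],
    h.arr_cv, h.arr_ce, h.arr_adj, h.arr_ones⟩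

/-- Fill array `14` with the contributions of all items, for the colours in array `12`. -/
def contributionTable : Prog :=
  .for_ 13 8 (.put 14 (.var 13) (.lit 0)) ;;
  .put 14 (.lit 0) (.lit 1) ;;
  .for_ 11 9 (
    patternTable 12 ;; .assign 19 (.get 7 (.var 11)) ;; addMultiples ;;
    patternTable 13 ;; .assign 19 (.get 8 (.var 11)) ;; addMultiples)

theorem runs_contributionTable {W s M L : ℕ} {cv ce adj : ℕ → ℕ} {σ : State}
    (h : Params W s M σ) (hsum : Summary W s L cv ce adj σ) :
    Runs W contributionTable σ (3000 * 3 ^ s * (L + 1) * ((s + 1) * ((s + 1 + M) ^ s + 1) ^ 2))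
      (Marks s M 14 (contributions s cv ce (σ.arr 12))) := by
  have h1 := h.one_lt
  have hDW := h.D_lt
  have hM := h.M_pos
  have hone : (pack (s + 1 + M) s fun i => wrap (s + 1) M ((0 : ℕ → ℕ) i)) = 0 := by
    simp [pack, wrap]
  set N := (s + 1 + M) ^ s with hN
  have hNpos : 0 < N := by positivity
  have hNW : N < W := by have : 3 * N < W := h.N_lt; omega
  set R := (s + 1) * (N + 1) ^ 2 with hR
  have hR1 : N + 1 ≤ R := by
    clear_value N
    nlinarith
  have hcost : (s + 1) * ((s + 1 + M) ^ s + 1) ^ 2 = R := rfl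
  have hcount : 1000 * (L + 1) * ((s + 1) * ((s + 1 + M) ^ s + 1) ^ 2) = 1000 * ((L + 1) * R) := by
    rw [hcost, mul_assoc]
  have hRL : R ≤ (L + 1) * R := Nat.le_mul_of_pos_left _ (by omega)
  have hRT : (L + 1) * R ≤ 3 ^ s * ((L + 1) * R) := Nat.le_mul_of_pos_left _ (by positivity)
  have hT : 3000 * 3 ^ s * (L + 1) * R = 3000 * (3 ^ s * ((L + 1) * R)) := by ring
  have hT' : 3 ^ s * (2800 * ((L + 1) * R) + 12) + 12 ≤ 2900 * (3 ^ s * ((L + 1) * R)) := by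
    have : 3 ^ s * 1 ≤ 3 ^ s * ((L + 1) * R) := Nat.mul_le_mul_left _ (by omega)
    have : 1 ≤ 3 ^ s := Nat.one_le_pow _ _ (by norm_num)
    rw [Nat.mul_add, Nat.mul_left_comm]
    omega
  rw [hT]
  refine Runs.seq (Q := fun σ' => ∀ c < N, σ'.arr 14 c = 0) (T₁ := N * (20 + 12) + 12)
    (Runs.for_ (I := fun j σ' => ∀ c < j, σ'.arr 14 c = 0) 20 h1 (N := N) h.reg_N hNW (by simp)
      (by simp) ?_ le_rfl) (by omega) ?_
  · intro j σ₁ hj h13 hf hI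
    refine Runs.put (k := j) (v := 0) h1 (by simp) (by simp; omega) (by simpa) rfl ?_ (by simp)
    intro c hc
    by_cases hcj : c = j
    · simp [hcj]
    · simp [hcj, hI c (by omega)]
  intro σ₁ hf₁ hz
  have hp₁ : Params W s M σ₁ := h.of_frame hf₁
  have hs₁ : Summary W s L cv ce adj σ₁ := hsum.of_frame hf₁
  have h12₁ : σ₁.arr 12 = σ.arr 12 := hf₁.arr 12 rfl
  refine Runs.seq_put (k := 0) (v := 1) h1 (by simp; omega) (by simpa) rfl rfl (by simp; omega) ?_
  refine (Runs.for_ (I := fun j σ' => Marks s M 14 (∑ T ∈ Finset.range j,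
    (multiple (cv T) (patterns s (digit 3 T) (σ.arr 12)) +
      multiple (ce T) (patterns s (digit 3 T) fun _ => 1))) σ')
    (2800 * ((L + 1) * R)) h1 (N := 3 ^ s) hs₁.reg_types hsum.types_lt ?_ ?_ ?_ ?_)
  · exact fun j σ' v h => h
  · intro c hc
    rw [Finset.sum_range_zero]
    by_cases hc0 : c = 0
    · subst hc0
      exact ⟨fun _ => ⟨0, Set.zero_mem_zero, hone⟩, fun _ => by simp⟩
    · simp only [State.setArr_arr, if_true, if_neg hc0, hz c hc, ne_eq, not_true_eq_false,
        false_iff, not_exists, not_and]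
      rintro x rfl
      rw [hone]
      exact fun h => hc0 h.symm
  · intro T σ₂ hT h11 hf₂ hI
    have hp₂ : Params W s M σ₂ := (hp₁.setArr (a := 14)).of_frame hf₂
    have hs₂ : Summary W s L cv ce adj σ₂ :=
      Summary.of_frame (σ := σ₁.setArr 14 0 1) ⟨hs₁.types_lt, hs₁.sq_lt, hs₁.cv_lt, hs₁.ce_lt,
        hs₁.reg_types, hs₁.reg_sq, hs₁.arr_cv, hs₁.arr_ce, hs₁.arr_adj, hs₁.arr_ones⟩ hf₂
    have h12₂ : σ₂.arr 12 = σ.arr 12 := (hf₂.arr 12 rfl).trans h12₁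
    refine (runs_patternTable hp₂ (by norm_num) h11).seq (by omega) fun σ₃ hf₃ h15 => ?_
    rw [h12₂] at h15
    have hp₃ : Params W s M σ₃ := hp₂.of_frame hf₃
    have hs₃ : Summary W s L cv ce adj σ₃ := hs₂.of_frame hf₃
    have h14₃ := hI.of_frame hf₃
    have h11₃ : σ₃.reg 11 = T := (hf₃.reg 11 (by norm_num) rfl).trans h11
    refine Runs.seq_assign (v := cv T) h1 (by simp) (by simp [h11₃, hs₃.arr_cv])
      (by simp; omega) ?_
    refine (runs_addMultiples (hp₃.setReg (x := 19)) (X := _) (Y := _)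
      (h14₃.congr fun _ _ => rfl) (h15.congr fun _ _ => rfl)
      (by simp) (hsum.cv_lt T hT) (by omega)).seq (by rw [hcount]; simp; omega)
      fun σ₄ hf₄ h14₄ => ?_
    have hp₄ : Params W s M σ₄ := (hp₃.setReg (x := 19)).of_frame hf₄
    have hs₄ : Summary W s L cv ce adj σ₄ := (hs₃.setReg (x := 19)).of_frame hf₄
    have h11₄ : σ₄.reg 11 = T := (hf₄.reg 11 (by norm_num) rfl).trans (by simpa)
    refine (runs_patternTable hp₄ (by norm_num) h11₄).seq (by rw [hcount]; simp; omega)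
      fun σ₅ hf₅ h15 => ?_
    rw [patterns_congr (col' := fun _ => 1) hs₄.arr_ones] at h15
    have hp₅ : Params W s M σ₅ := hp₄.of_frame hf₅
    have hs₅ : Summary W s L cv ce adj σ₅ := hs₄.of_frame hf₅
    have h14₅ := h14₄.of_frame hf₅
    have h11₅ : σ₅.reg 11 = T := (hf₅.reg 11 (by norm_num) rfl).trans h11₄
    refine Runs.seq_assign (v := ce T) h1 (by simp) (by simp [h11₅, hs₅.arr_ce])
      (by rw [hcount]; simp; omega) ?_
    refine ((runs_addMultiples (hp₅.setReg (x := 19)) (X := _) (Y := _)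
      (h14₅.congr fun _ _ => rfl) (h15.congr fun _ _ => rfl)
      (by simp) (hsum.ce_lt T hT) (by omega)).imp fun σ₆ hf₆ h14₆ => ?_).mono
      (by rw [hcount]; simp; omega)
    rw [Finset.sum_range_succ, ← add_assoc]
    exact h14₆
  · simp
    omega

end WordRAM

namespace WordRAM

/-! ### The search -/

/-- Test whether the number in register `10` is a target, and set register `0` to `1` if so. -/
def tryTarget : Prog :=
  .for_ 12 3 (.put 12 (.var 12) (.digitOf 10)) ;;
  .assign 22 (.lit 1) ;;
  .for_ 24 23 (.when (.get 10 (.var 24))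
    (.when (.bin .eq (.get 12 (.var 24 / .var 3)) (.get 12 (.var 24 % .var 3)))
      (.assign 22 (.lit 0)))) ;;
  .when (.var 22) (contributionTable ;; .when (.get 14 (.var 10)) (.assign 0 (.lit 1)))

theorem runs_tryTarget {W s M L τ : ℕ} {cv ce adj : ℕ → ℕ} {σ : State}
    (h : Params W s M σ) (hsum : Summary W s L cv ce adj σ) (hτ : σ.reg 10 = τ)
    (hτN : τ < (s + 1 + M) ^ s) :
    Runs W tryTarget σ (4000 * (3 ^ s * (L + 1) * ((s + 1) ^ 2 * ((s + 1 + M) ^ s + 1) ^ 2)))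
      fun σ' => (IsTarget s M cv ce adj τ → σ'.reg 0 = 1) ∧
        (¬ IsTarget s M cv ce adj τ → σ'.reg 0 = σ.reg 0) := by
  have h1 := h.one_lt
  have hDW := h.D_lt
  have hM := h.M_pos
  have hsW : s < W := by omega
  set D := s + 1 + M with hD
  set N := D ^ s with hN
  have hNW : N < W := by have : 3 * N < W := h.N_lt; omega
  set d := digit D τ with hd
  set R := 3 ^ s * (L + 1) * ((s + 1) ^ 2 * (N + 1) ^ 2) with hR
  have hR1 : (s + 1) ^ 2 ≤ R := by
    have h3 : 1 ≤ 3 ^ s * (L + 1) := Nat.mul_pos (by positivity) (by omega)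
    have h4 : 1 ≤ (N + 1) ^ 2 := Nat.one_le_pow _ _ (by omega)
    calc (s + 1) ^ 2 = 1 * ((s + 1) ^ 2 * 1) := by ring
      _ ≤ R := Nat.mul_le_mul h3 (Nat.mul_le_mul_left _ h4)
  have hR2 : s * s + 2 * s + 1 ≤ R := by
    calc s * s + 2 * s + 1 = (s + 1) ^ 2 := by ring
      _ ≤ R := hR1
  have hR3 : 3000 * 3 ^ s * (L + 1) * ((s + 1) * ((s + 1 + M) ^ s + 1) ^ 2) ≤ 3000 * R := by
    rw [hR, ← hD, ← hN, mul_assoc 3000, mul_assoc 3000]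
    gcongr
    nlinarith
  refine Runs.seq (T₁ := s * (20 + 12) + 12) (Q := fun σ' => ∀ i < s, σ'.arr 12 i = d i)
    (Runs.for_ (I := fun j σ' => ∀ i < j, σ'.arr 12 i = d i) 20 h1 (N := s) h.reg_s hsW (by simp)
      (by simp) ?_ le_rfl) (by omega) ?_
  · intro j σ₁ hj h12 hf hI
    have hp : Params W s M σ₁ := h.of_frame hf
    refine Runs.put (k := j) (v := d j) h1 (by simp) (by simp [Expr.digitOf]) (by simpa)
      ?_ ?_ (by simp [Expr.digitOf])
    · rw [hp.eval_digitOf hj h12, hf.reg 10 (by norm_num) rfl, hτ]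
    intro i hi
    by_cases hij : i = j
    · simp [hij]
    · simp [hij, hI i (by omega)]
  intro σ₁ hf₁ h12
  have hp₁ : Params W s M σ₁ := h.of_frame hf₁
  have hs₁ : Summary W s L cv ce adj σ₁ := hsum.of_frame hf₁
  refine Runs.seq_assign (v := 1) h1 (by simpa) rfl (by simp; omega) ?_
  refine Runs.seq (T₁ := s * s * (40 + 12) + 12) (Q := fun σ' => σ'.reg 22 ≠ 0 ↔
      ∀ q < s * s, adj q ≠ 0 → d (q / s) ≠ d (q % s))
    (Runs.for_ (I := fun j σ' => σ'.reg 22 ≠ 0 ↔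
      ∀ q < j, adj q ≠ 0 → d (q / s) ≠ d (q % s)) 40 h1 (N := s * s) (by simp [hs₁.reg_sq])
      hsum.sq_lt (by simp) (by simp) ?_ le_rfl) (by simp; omega) ?_
  · intro q σ₂ hq h24 hf₂ hI
    have hp₂ : Params W s M σ₂ := (hp₁.setReg (x := 22)).of_frame hf₂
    have hs₂ : Summary W s L cv ce adj σ₂ := (hs₁.setReg (x := 22)).of_frame hf₂
    have h12₂ : ∀ i < s, σ₂.arr 12 i = d i := fun i hi => by
      rw [hf₂.arr 12 rfl]
      exact h12 i hi
    have hs0 : 0 < s := Nat.pos_of_mul_pos_right (show 0 < s * s by omega)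
    have hq1 : q / s < s := Nat.div_lt_of_lt_mul hq
    have hq2 : q % s < s := Nat.mod_lt _ hs0
    have key : ∀ P : Prop, (P ↔ (adj q ≠ 0 → d (q / s) ≠ d (q % s))) →
        ((∀ q' < q + 1, adj q' ≠ 0 → d (q' / s) ≠ d (q' % s)) ↔
          (∀ q' < q, adj q' ≠ 0 → d (q' / s) ≠ d (q' % s)) ∧ P) := by
      intro P hP
      rw [hP]
      refine ⟨fun h => ⟨fun q' hq' => h q' (by omega), h q (by omega)⟩, fun h q' hq' => ?_⟩
      rcases Nat.lt_succ_iff_lt_or_eq.1 hq' with hq' | rfl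
      exacts [h.1 q' hq', h.2]
    refine Runs.when h1 (by simp) (by simp) (fun ha => ?_) (fun ha => ?_)
    · simp only [Expr.eval_get, Expr.eval_var, h24, hs₂.arr_adj] at ha
      refine Runs.when h1 (by simp) (by simp) (fun he => ?_) (fun he => ?_)
      · simp only [Expr.eval_eq, Op.eval_eq, Expr.eval_get, Expr.eval_var, Expr.eval_div,
          Expr.eval_mod, h24, hp₂.reg_s, h12₂ _ hq1, h12₂ _ hq2, ne_eq, ite_eq_right_iff,
          one_ne_zero, imp_false, not_not] at he
        refine Runs.assign (v := 0) h1 (by simp; omega) rfl ?_ (by simp)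
        rw [key False (by simp [ha, he])]
        simp
      · simp only [Expr.eval_eq, Op.eval_eq, Expr.eval_get, Expr.eval_var, Expr.eval_div,
          Expr.eval_mod, h24, hp₂.reg_s, h12₂ _ hq1, h12₂ _ hq2, ite_eq_right_iff,
          one_ne_zero, imp_false] at he
        rw [key True (by simp [he]), hI, and_true]
    · simp only [Expr.eval_get, Expr.eval_var, h24, hs₂.arr_adj] at ha
      rw [key True (by simp [ha]), hI, and_true]
  intro σ₂ hf₂ h22
  have hp₂ : Params W s M σ₂ := (hp₁.setReg (x := 22)).of_frame hf₂
  have hs₂ : Summary W s L cv ce adj σ₂ := (hs₁.setReg (x := 22)).of_frame hf₂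
  have h12₂ : ∀ i < s, σ₂.arr 12 i = d i := fun i hi => by
    rw [hf₂.arr 12 rfl]
    exact h12 i hi
  have h10₂ : σ₂.reg 10 = τ := (hf₂.reg 10 (by norm_num) rfl).trans
    ((by simp : _ = σ₁.reg 10).trans ((hf₁.reg 10 (by norm_num) rfl).trans hτ))
  have h0₂ : σ₂.reg 0 = σ.reg 0 := (hf₂.reg 0 (by norm_num) rfl).trans
    ((by simp : _ = σ₁.reg 0).trans (hf₁.reg 0 (by norm_num) rfl))
  refine Runs.when h1 (by simp) (by simp; omega) (fun hok => ?_) (fun hok => ?_)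
  · refine (runs_contributionTable hp₂ hs₂).seq (by simp; omega) fun σ₃ hf₃ h14 => ?_
    rw [contributions_congr h12₂] at h14
    have h10₃ : σ₃.reg 10 = τ := (hf₃.reg 10 (by norm_num) rfl).trans h10₂
    have h0₃ : σ₃.reg 0 = σ.reg 0 := (hf₃.reg 0 (by norm_num) rfl).trans h0₂
    have hiff : σ₃.arr 14 τ ≠ 0 ↔ IsTarget s M cv ce adj τ := by
      rw [h14 τ hτN, IsTarget, iff_and_self]
      exact fun _ => h22.1 hok
    refine Runs.when h1 (by simp) (by simp; omega) (fun ha => ?_) (fun ha => ?_)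
    · simp only [Expr.eval_get, Expr.eval_var, h10₃, hiff] at ha
      refine Runs.assign (v := 1) h1 (by simpa) rfl ?_ (by simp; omega)
      simp [ha]
    · simp only [Expr.eval_get, Expr.eval_var, h10₃] at ha
      have : ¬ IsTarget s M cv ce adj τ := fun hc => hiff.2 hc ha
      simp [this, h0₃]
  · have : ¬ IsTarget s M cv ce adj τ := fun hc => h22.2 hc.1 hok
    simp [this, h0₂]

/-- Fill array `a` with the powers of the content of register `b` with exponents below the content
of register `3`, and leave the next power in register `25`. -/
def powers (a b : ℕ) : Prog :=
  .assign 25 (.lit 1) ;;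
  .for_ 12 3 (.put a (.var 12) (.var 25) ;; .assign 25 (.var 25 * .var b))

theorem runs_powers {W s B a b : ℕ} {σ : State} (h1 : 1 < W) (hs : σ.reg 3 = s) (hsW : s < W)
    (hb : σ.reg b = B) (hB : 0 < B) (hW : B ^ s < W) (hb' : b < 100) (h12 : b ≠ 12)
    (h25 : b ≠ 25) :
    Runs W (powers a b) σ (60 * (s + 1)) fun σ' => σ'.reg 25 = B ^ s ∧
      ∀ i < s, σ'.arr a i = B ^ i := by
  refine Runs.seq_assign (v := 1) h1 (by simpa) rfl (by simp; omega) ?_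
  refine Runs.for_ (I := fun j σ' => σ'.reg 25 = B ^ j ∧ ∀ i < j, σ'.arr a i = B ^ i) 30 h1
    (N := s) (by simpa) hsW (by simp) (by simp) ?_ (by simp; omega)
  rintro j σ₁ hj hj12 hf ⟨h25', hI⟩
  have hb₁ : σ₁.reg b = B := by
    rw [hf.reg b hb' (by
      have : b ≠ 100 := by omega
      have : b ≠ 101 := by omega
      simp [Prog.for_, Prog.setsReg, Prog.assign, Prog.put, Prog.while_, Expr.compile, *])]
    simp [h25, hb]
  refine Runs.seq_put (k := j) (v := B ^ j) h1 (by simp) (by simp) (by simpa) (by simpa)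
    (by simp) ?_
  refine Runs.assign (v := B ^ (j + 1)) h1 ?_ ?_ ⟨by simp, fun i hi => ?_⟩ (by simp)
  · simp [hb', h25', hb₁, ← pow_succ]
    exact (Nat.pow_le_pow_right hB hj).trans_lt hW
  · simp [h25', hb₁, pow_succ]
  · by_cases hij : i = j
    · simp [hij]
    · simp [hij, hI i (by omega)]

/-- Search for a target with the modulus that follows the number in register `26`. -/
def tryModulus : Prog :=
  .assign 6 (.var 26 + .lit 1) ;;
  .assign 7 (.var 3 + .lit 1 + .var 6) ;;
  powers 11 7 ;;
  .assign 8 (.var 25) ;;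
  .for_ 10 8 tryTarget

/-- Search for a target for all moduli up to the content of register `5`. -/
def search : Prog := .for_ 26 5 tryModulus

/-- A bound for the number of steps of the search with the moduli up to `Q`, where `s + 1 + Q`
bounds the base and `L` the number of bits of the multiplicities. -/
def searchTime (s L Q : ℕ) : ℕ :=
  6000 * ((Q + 1) * (3 ^ s * (L + 1) * ((s + 1) ^ 2 * ((s + 1 + Q) ^ s + 1) ^ 3)))

theorem runs_tryModulus {W s L Q M : ℕ} {cv ce adj : ℕ → ℕ} {σ : State} (h1 : 1 < W)
    (hs : σ.reg 3 = s) (h3 : ∀ i < s, σ.arr 5 i = 3 ^ i)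
    (hD : 3 * (s + 1 + Q) < W) (hN : 3 * (s + 1 + Q) ^ s < W) (hsD : s * (s + 1 + Q) < W)
    (hsum : Summary W s L cv ce adj σ) (hM : σ.reg 26 = M) (hMQ : M < Q) :
    Runs W tryModulus σ
      (5000 * (3 ^ s * (L + 1) * ((s + 1) ^ 2 * ((s + 1 + Q) ^ s + 1) ^ 3)))
      fun σ' => ((∃ τ < (s + 1 + (M + 1)) ^ s, IsTarget s (M + 1) cv ce adj τ) → σ'.reg 0 = 1) ∧
        ((¬ ∃ τ < (s + 1 + (M + 1)) ^ s, IsTarget s (M + 1) cv ce adj τ) →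
          σ'.reg 0 = σ.reg 0) := by
  have hpow : (s + 1 + (M + 1)) ^ s ≤ (s + 1 + Q) ^ s := Nat.pow_le_pow_left (by omega) s
  have hmul : s * (s + 1 + (M + 1)) ≤ s * (s + 1 + Q) := Nat.mul_le_mul_left s (by omega)
  set N := (s + 1 + Q) ^ s with hN'
  set R := 3 ^ s * (L + 1) * ((s + 1) ^ 2 * (N + 1) ^ 3) with hR
  set R' := 3 ^ s * (L + 1) * ((s + 1) ^ 2 * (N + 1) ^ 2) with hR'
  have hRR : R = (N + 1) * R' := by
    rw [hR, hR']
    ring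
  have hR1 : s + 1 ≤ R' := by
    have h3 : 1 ≤ 3 ^ s * (L + 1) := Nat.mul_pos (by positivity) (by omega)
    have h4 : 1 ≤ (N + 1) ^ 2 := Nat.one_le_pow _ _ (by omega)
    calc s + 1 ≤ (s + 1) ^ 2 := Nat.le_self_pow (by norm_num) _
      _ = 1 * ((s + 1) ^ 2 * 1) := by ring
      _ ≤ R' := Nat.mul_le_mul h3 (Nat.mul_le_mul_left _ h4)
  have hR2 : R = N * R' + R' := by rw [hRR]; ring
  have hcost : N * (4000 * R' + 12) + 12 ≤ 4500 * R := by
    clear_value R' N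
    rw [hR2]
    nlinarith
  refine Runs.seq_assign (v := M + 1) h1 (by simp [hM]; omega) (by simp [hM]) (by simp; omega) ?_
  refine Runs.seq_assign (v := s + 1 + (M + 1)) h1 (by simp [hs]; omega) (by simp [hs])
    (by simp; omega) ?_
  refine (runs_powers (s := s) (B := s + 1 + (M + 1)) h1 (by simpa) (by omega) (by simp) (by omega)
    (by omega) (by norm_num) (by norm_num) (by norm_num)).seq (by simp; omega) ?_
  rintro σ₁ hf₁ ⟨h25, h11⟩
  have hreg : ∀ x < 100, x ≠ 6 → x ≠ 7 → (powers 11 7).setsReg x = false → σ₁.reg x = σ.reg x := by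
    intro x hx h6 h7 hpx
    rw [hf₁.reg x hx hpx]
    simp [h6, h7]
  have harr : ∀ a, a ≠ 11 → σ₁.arr a = σ.arr a := by
    intro a ha
    refine hf₁.arr a ?_
    simp [powers, Prog.for_, Prog.setsArr, Prog.assign, Prog.put, Prog.while_, ha]
  refine Runs.seq_assign (v := (s + 1 + (M + 1)) ^ s) h1 (by simp) (by simp [h25])
    (by simp; omega) ?_
  have hp : Params W s (M + 1) (σ₁.setReg 8 ((s + 1 + (M + 1)) ^ s)) := by
    refine ⟨h1, by omega, by omega, by omega, by omega, ?_, ?_, ?_, by simp, h11, ?_⟩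
    · simp [hreg 3 (by norm_num) (by norm_num) (by norm_num) rfl, hs]
    · simp [hf₁.reg 6 (by norm_num) rfl]
    · simp [hf₁.reg 7 (by norm_num) rfl]
    · simpa [harr 5 (by norm_num)] using h3
  have hs₁ : Summary W s L cv ce adj (σ₁.setReg 8 ((s + 1 + (M + 1)) ^ s)) := by
    refine ⟨hsum.types_lt, hsum.sq_lt, hsum.cv_lt, hsum.ce_lt, ?_, ?_, ?_, ?_, ?_, ?_⟩
    · simp [hreg 9 (by norm_num) (by norm_num) (by norm_num) rfl, hsum.reg_types]
    · simp [hreg 23 (by norm_num) (by norm_num) (by norm_num) rfl, hsum.reg_sq]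
    · simp [harr 7 (by norm_num), hsum.arr_cv]
    · simp [harr 8 (by norm_num), hsum.arr_ce]
    · simp [harr 10 (by norm_num), hsum.arr_adj]
    · simpa [harr 13 (by norm_num)] using hsum.arr_ones
  have h0 : σ₁.reg 0 = σ.reg 0 := hreg 0 (by norm_num) (by norm_num) (by norm_num) rfl
  refine Runs.for_ (I := fun j σ' =>
    ((∃ τ < j, IsTarget s (M + 1) cv ce adj τ) → σ'.reg 0 = 1) ∧
      ((¬ ∃ τ < j, IsTarget s (M + 1) cv ce adj τ) → σ'.reg 0 = σ.reg 0)) (4000 * R') h1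
    (N := (s + 1 + (M + 1)) ^ s) (by simp) (by omega) (by simp) (by simp [h0]) ?_ ?_
  · rintro τ σ₂ hτ h10 hf₂ ⟨hI1, hI2⟩
    have hp₂ := hp.of_frame hf₂
    have hs₂ := hs₁.of_frame hf₂
    refine ((runs_tryTarget hp₂ hs₂ h10 hτ).mono ?_).imp ?_
    · rw [hR']
      gcongr
    · rintro σ₃ hf₃ ⟨h5, h6⟩
      by_cases hτ' : IsTarget s (M + 1) cv ce adj τ
      · exact ⟨fun _ => h5 hτ', fun hn => absurd ⟨τ, by omega, hτ'⟩ hn⟩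
      · rw [h6 hτ']
        refine ⟨?_, fun hn => hI2 fun ⟨τ', h, h'⟩ => hn ⟨τ', by omega, h'⟩⟩
        rintro ⟨τ', h, h'⟩
        rcases Nat.lt_succ_iff_lt_or_eq.1 h with h | rfl
        exacts [hI1 ⟨τ', h, h'⟩, absurd h' hτ']
  · have : (s + 1 + (M + 1)) ^ s * (4000 * R' + 12) ≤ N * (4000 * R' + 12) :=
      Nat.mul_le_mul_right _ hpow
    have h7 : R' ≤ R := by omega
    simp
    omega

theorem runs_search {W s L Q : ℕ} {cv ce adj : ℕ → ℕ} {σ : State} (h1 : 1 < W)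
    (hs : σ.reg 3 = s) (h3 : ∀ i < s, σ.arr 5 i = 3 ^ i)
    (hD : 3 * (s + 1 + Q) < W) (hN : 3 * (s + 1 + Q) ^ s < W) (hsD : s * (s + 1 + Q) < W)
    (hsum : Summary W s L cv ce adj σ) (hQ : σ.reg 5 = Q) (h0 : σ.reg 0 = 0) :
    Runs W search σ (searchTime s L Q) fun σ' =>
      ((∃ M < Q, ∃ τ < (s + 1 + (M + 1)) ^ s, IsTarget s (M + 1) cv ce adj τ) → σ'.reg 0 = 1) ∧
      ((¬ ∃ M < Q, ∃ τ < (s + 1 + (M + 1)) ^ s, IsTarget s (M + 1) cv ce adj τ) →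
        σ'.reg 0 = 0) := by
  set R := 3 ^ s * (L + 1) * ((s + 1) ^ 2 * ((s + 1 + Q) ^ s + 1) ^ 3) with hR
  have hR1 : 1 ≤ R := Nat.mul_pos (Nat.mul_pos (by positivity) (by omega)) (by positivity)
  refine Runs.for_ (I := fun j σ' =>
    ((∃ M < j, ∃ τ < (s + 1 + (M + 1)) ^ s, IsTarget s (M + 1) cv ce adj τ) → σ'.reg 0 = 1) ∧
      ((¬ ∃ M < j, ∃ τ < (s + 1 + (M + 1)) ^ s, IsTarget s (M + 1) cv ce adj τ) →
        σ'.reg 0 = 0)) (5000 * R) h1 (N := Q) hQ (by omega) (by simp) (by simp [h0]) ?_ ?_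
  · rintro M σ₁ hM h26 hf ⟨hI1, hI2⟩
    refine (runs_tryModulus h1 ((hf.reg 3 (by norm_num) rfl).trans hs) ?_ hD hN hsD
      (hsum.of_frame hf) h26 hM).imp ?_
    · rw [hf.arr 5 rfl]
      exact h3
    · rintro σ₂ hf₂ ⟨h5, h6⟩
      by_cases hM' : ∃ τ < (s + 1 + (M + 1)) ^ s, IsTarget s (M + 1) cv ce adj τ
      · exact ⟨fun _ => h5 hM', fun hn => absurd ⟨M, by omega, hM'⟩ hn⟩
      · rw [h6 hM']
        refine ⟨?_, fun hn => hI2 fun ⟨M', h, h'⟩ => hn ⟨M', by omega, h'⟩⟩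
        rintro ⟨M', h, h'⟩
        rcases Nat.lt_succ_iff_lt_or_eq.1 h with h | rfl
        exacts [hI1 ⟨M', h, h'⟩, absurd h' hM']
  · have : searchTime s L Q = 6000 * (Q * R) + 6000 * R := by
      rw [searchTime, ← hR]
      ring
    rw [this]
    clear_value R
    nlinarith

end WordRAM

namespace EdgeWeighting

/-! ### Edge lists and the types of vertices and edges -/

/-- A graph on the vertices `0, …, n - 1` with `m` edges, the edge `e` joining `U e` and `V e`; its
mark `B e` is `1` if the edge has the prescribed weight `1`, and `0` otherwise. -/
structure EdgeList where
  /-- The number of vertices. -/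
  n : ℕ
  /-- The number of edges. -/
  m : ℕ
  /-- The first ends of the edges. -/
  U : ℕ → ℕ
  /-- The second ends of the edges. -/
  V : ℕ → ℕ
  /-- The marks of the edges. -/
  B : ℕ → ℕ

namespace EdgeList

/-- The list describes a simple graph. -/
structure Valid (G : EdgeList) : Prop where
  U_lt : ∀ e < G.m, G.U e < G.n
  V_lt : ∀ e < G.m, G.V e < G.n
  U_ne_V : ∀ e < G.m, G.U e ≠ G.V e
  B_le : ∀ e < G.m, G.B e ≤ 1
  inj : ∀ e < G.m, ∀ e' < G.m, G.U e = G.U e' ∧ G.V e = G.V e' ∨ G.U e = G.V e' ∧ G.V e = G.U e' →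
    e = e'

/-- The vertices `v` with `idx v ≠ 0` form a vertex cover with `s` elements, and `idx` numbers them
by `1, …, s`. -/
structure IsCoverIndex (G : EdgeList) (s : ℕ) (idx : ℕ → ℕ) : Prop where
  le : ∀ v, idx v ≤ s
  lt_n : ∀ v, idx v ≠ 0 → v < G.n
  surj : ∀ i, i ≠ 0 → i ≤ s → ∃ v, idx v = i
  inj : ∀ u v, idx u = idx v → idx u ≠ 0 → u = v
  cover : ∀ e < G.m, idx (G.U e) ≠ 0 ∨ idx (G.V e) ≠ 0

/-- The contribution of the edge `e` to the type of the vertex `v` outside the cover. -/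
def typeTerm (G : EdgeList) (idx : ℕ → ℕ) (v e : ℕ) : ℕ :=
  if idx (G.U e) ≠ 0 ∧ idx (G.V e) = 0 ∧ v = G.V e then (1 + G.B e) * 3 ^ (idx (G.U e) - 1)
  else if idx (G.U e) = 0 ∧ v = G.U e then (1 + G.B e) * 3 ^ (idx (G.V e) - 1) else 0

/-- The type of a vertex outside the cover, as a number to base `3`: the digit at position `i` is
`0` if the vertex is not joined to the cover vertex with index `i + 1`, and otherwise it is `1` plus the
mark of the edge between them. -/
def vertexType (G : EdgeList) (idx : ℕ → ℕ) (v : ℕ) : ℕ :=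
  ∑ e ∈ Finset.range G.m, G.typeTerm idx v e

/-- The type of an edge inside the cover, which is encoded like the type of a vertex joined to both
ends of the edge by edges with the mark of that edge. -/
def edgeType (G : EdgeList) (idx : ℕ → ℕ) (e : ℕ) : ℕ :=
  (1 + G.B e) * (3 ^ (idx (G.U e) - 1) + 3 ^ (idx (G.V e) - 1))

/-- The number of vertices below `j` outside the cover that have type `T`. -/
def vertexCount (G : EdgeList) (idx : ℕ → ℕ) (j T : ℕ) : ℕ :=
  ∑ v ∈ Finset.range j, if idx v = 0 ∧ G.vertexType idx v = T then 1 else 0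

/-- The number of edges below `j` inside the cover that have type `T`. -/
def edgeCount (G : EdgeList) (idx : ℕ → ℕ) (j T : ℕ) : ℕ :=
  ∑ e ∈ Finset.range j,
    if idx (G.U e) ≠ 0 ∧ idx (G.V e) ≠ 0 ∧ G.edgeType idx e = T then 1 else 0

theorem vertexCount_succ (G : EdgeList) (idx : ℕ → ℕ) (j T : ℕ) :
    G.vertexCount idx (j + 1) T = G.vertexCount idx j T +
      if idx j = 0 ∧ G.vertexType idx j = T then 1 else 0 :=
  Finset.sum_range_succ _ _

theorem edgeCount_succ (G : EdgeList) (idx : ℕ → ℕ) (j T : ℕ) :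
    G.edgeCount idx (j + 1) T = G.edgeCount idx j T +
      if idx (G.U j) ≠ 0 ∧ idx (G.V j) ≠ 0 ∧ G.edgeType idx j = T then 1 else 0 :=
  Finset.sum_range_succ _ _

end EdgeList

end EdgeWeighting

namespace WordRAM

open EdgeWeighting

/-! ### Reading the graph and choosing a vertex cover -/

/-- The number of vertices, the number of edges and the edges are stored in registers `1`, `2` and
in arrays `1`, `2`, `3`. -/
structure Stores (W : ℕ) (G : EdgeList) (σ : State) : Prop where
  one_lt : 1 < W
  n_lt : G.n < W
  m_lt : G.m < W
  reg_n : σ.reg 1 = G.n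
  reg_m : σ.reg 2 = G.m
  arr_U : ∀ e < G.m, σ.arr 1 e = G.U e
  arr_V : ∀ e < G.m, σ.arr 2 e = G.V e
  arr_B : ∀ e < G.m, σ.arr 3 e = G.B e

theorem Stores.of_frame {W : ℕ} {G : EdgeList} {σ σ' : State} {p : Prog} (h : Stores W G σ)
    (hf : Frame p σ σ') (hr1 : p.setsReg 1 = false := by rfl)
    (hr2 : p.setsReg 2 = false := by rfl) (h1 : p.setsArr 1 = false := by rfl)
    (h2 : p.setsArr 2 = false := by rfl) (h3 : p.setsArr 3 = false := by rfl) :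
    Stores W G σ' where
  one_lt := h.one_lt
  n_lt := h.n_lt
  m_lt := h.m_lt
  reg_n := (hf.reg 1 (by norm_num) hr1).trans h.reg_n
  reg_m := (hf.reg 2 (by norm_num) hr2).trans h.reg_m
  arr_U := fun e he => by rw [hf.arr 1 h1, h.arr_U e he]
  arr_V := fun e he => by rw [hf.arr 2 h2, h.arr_V e he]
  arr_B := fun e he => by rw [hf.arr 3 h3, h.arr_B e he]

/-- Read the graph from array `0`; the two ends and the mark of edge number `e` (register `24`) are
given by expressions. -/
def readEdges (u v b : Expr) : Prog :=
  .assign 1 (.get 0 (.lit 0)) ;;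
  .assign 2 (.get 0 (.lit 1)) ;;
  .for_ 24 2 (.put 1 (.var 24) u ;; .put 2 (.var 24) v ;; .put 3 (.var 24) b)

@[simp] theorem Expr.setsReg_compile {x : ℕ} (hx : x < 100) (e : Expr) {d : ℕ}
    (hd : 100 ≤ d) : (e.compile d).setsReg x = false := by
  induction e generalizing d with
  | var y => simp [Expr.compile, Prog.setsReg]; omega
  | lit c => simp [Expr.compile, Prog.setsReg]; omega
  | bin o a b iha ihb =>
    simp [Expr.compile, Prog.setsReg, iha hd, ihb (show 100 ≤ d + 1 by omega)]
    omega
  | get a i ih => simp [Expr.compile, Prog.setsReg, ih hd]; omega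

theorem runs_readEdges {W : ℕ} {G : EdgeList} {u v b : Expr} {σ : State} (h1 : 1 < W)
    (hnW : G.n < W) (hmW : G.m < W) (hn : σ.arr 0 0 = G.n) (hm : σ.arr 0 1 = G.m)
    (hu : ∀ σ' : State, σ'.arr 0 = σ.arr 0 → σ'.reg 24 < G.m → u.Safe W σ' ∧
      u.eval σ' = G.U (σ'.reg 24))
    (hv : ∀ σ' : State, σ'.arr 0 = σ.arr 0 → σ'.reg 24 < G.m → v.Safe W σ' ∧
      v.eval σ' = G.V (σ'.reg 24))
    (hb : ∀ σ' : State, σ'.arr 0 = σ.arr 0 → σ'.reg 24 < G.m → b.Safe W σ' ∧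
      b.eval σ' = G.B (σ'.reg 24)) (hcu : u.cost ≤ 20) (hcv : v.cost ≤ 20) (hcb : b.cost ≤ 20) :
    Runs W (readEdges u v b) σ (200 * (G.m + 1)) (Stores W G) := by
  refine Runs.seq_assign (v := G.n) h1 (by simp; omega) (by simp [hn]) (by simp; omega) ?_
  refine Runs.seq_assign (v := G.m) h1 (by simp; omega) (by simp [hm]) (by simp; omega) ?_
  refine (Runs.for_ (I := fun j σ' => ∀ e < j, σ'.arr 1 e = G.U e ∧ σ'.arr 2 e = G.V e ∧
    σ'.arr 3 e = G.B e) 100 h1 (N := G.m) (by simp) hmW (by simp) (by simp) ?_ (by simp; omega)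
    (hpx := by simp [Prog.setsReg, Prog.put]) (hpy := by simp [Prog.setsReg, Prog.put])).imp ?_
  · intro e σ₁ he h24 hf hI
    have h0 : σ₁.arr 0 = σ.arr 0 :=
      hf.arr 0 (by simp [Prog.for_, Prog.setsArr, Prog.assign, Prog.put, Prog.while_])
    obtain ⟨hu1, hu2⟩ := hu σ₁ h0 (by omega)
    refine Runs.seq_put (k := e) (v := G.U e) h1 (by simp) hu1 (by simpa) (by rw [hu2, h24])
      (by simp; omega) ?_
    obtain ⟨hv1, hv2⟩ := hv (σ₁.setArr 1 e (G.U e)) (by funext i; simp [h0]) (by simp; omega)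
    refine Runs.seq_put (k := e) (v := G.V e) h1 (by simp) hv1 (by simpa) (by rw [hv2]; simp [h24])
      (by simp; omega) ?_
    obtain ⟨hb1, hb2⟩ := hb ((σ₁.setArr 1 e (G.U e)).setArr 2 e (G.V e)) (by funext i; simp [h0])
      (by simp; omega)
    refine Runs.put (k := e) (v := G.B e) h1 (by simp) hb1 (by simpa) (by rw [hb2]; simp [h24])
      ?_ (by simp; omega)
    intro e' he'
    by_cases hee : e' = e
    · simp [hee]
    · simpa [hee] using hI e' (by omega)
  · intro σ' hf hI
    refine ⟨h1, hnW, hmW, ?_, ?_, fun e he => (hI e he).1, fun e he => (hI e he).2.1,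
      fun e he => (hI e he).2.2⟩
    · rw [hf.reg 1 (by norm_num) (by
        simp [Prog.for_, Prog.setsReg, Prog.assign, Prog.put, Prog.while_])]
      simp
    · rw [hf.reg 2 (by norm_num) (by
        simp [Prog.for_, Prog.setsReg, Prog.assign, Prog.put, Prog.while_])]
      simp

/-- Number the ends of the edges of a greedily chosen maximal matching, in array `4`; register `3`
holds their number. -/
def chooseCover : Prog :=
  .for_ 24 2 (
    .when (.bin .eq (.get 4 (.get 1 (.var 24))) (.lit 0)) (
      .when (.bin .eq (.get 4 (.get 2 (.var 24))) (.lit 0)) (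
        .assign 3 (.var 3 + .lit 1) ;; .put 4 (.get 1 (.var 24)) (.var 3) ;;
        .assign 3 (.var 3 + .lit 1) ;; .put 4 (.get 2 (.var 24)) (.var 3))))

/-- The ends of a maximal matching form a vertex cover that is at most twice as large as any vertex
cover `C`, because `C` contains an end of each edge of the matching. -/
theorem runs_chooseCover {W : ℕ} {G : EdgeList} {σ : State} (h : Stores W G σ) (hG : G.Valid)
    (hs : σ.reg 3 = 0) (h4 : ∀ v, σ.arr 4 v = 0) (C : Finset ℕ)
    (hC : ∀ e < G.m, G.U e ∈ C ∨ G.V e ∈ C) (hCW : 2 * C.card < W) :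
    Runs W chooseCover σ (200 * (G.m + 1)) fun σ' =>
      G.IsCoverIndex (σ'.reg 3) (σ'.arr 4) ∧ σ'.reg 3 ≤ 2 * C.card := by
  have h1 := h.one_lt
  refine (Runs.for_ (I := fun j σ' => EdgeList.IsCoverIndex { G with m := j } (σ'.reg 3) (σ'.arr 4)
    ∧ σ'.reg 3 ≤ 2 * (C.filter fun v => σ'.arr 4 v ≠ 0).card) 100 h1 (x := 24) (N := G.m) h.reg_m h.m_lt
    (fun _ _ _ h => h) ?_ ?_ (by omega)).imp ?_
  · refine ⟨⟨by simp [h4], by simp [h4], by simp [hs]; omega, by simp [h4], by simp⟩, by simp [hs]⟩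
  · rintro e σ₁ he h24 hf ⟨hI, hle⟩
    have hS := h.of_frame hf
    set idx := σ₁.arr 4 with hidx
    set s := σ₁.reg 3 with hs
    have hUV := hG.U_ne_V e he
    have hskip : idx (G.U e) ≠ 0 ∨ idx (G.V e) ≠ 0 →
        EdgeList.IsCoverIndex { G with m := e + 1 } s idx := fun hc =>
      ⟨hI.le, hI.lt_n, hI.surj, hI.inj, fun e' he' => by
        rcases Nat.lt_succ_iff_lt_or_eq.1 he' with he' | rfl
        exacts [hI.cover e' he', hc]⟩
    refine Runs.when h1 (by simp; omega) (by simp) (fun hu => ?_) (fun hu => ?_)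
    · have hu : idx (G.U e) = 0 := by simpa [h24, hS.arr_U e he] using hu
      refine Runs.when h1 (by simp; omega) (by simp) (fun hv => ?_) (fun hv => ?_)
      · have hv : idx (G.V e) = 0 := by simpa [h24, hS.arr_V e he] using hv
        set idx' : ℕ → ℕ := fun v => if v = G.V e then s + 1 + 1 else if v = G.U e then s + 1
          else idx v with hidx'
        have hmono : (C.filter fun v => idx v ≠ 0).card + 1 ≤
            (C.filter fun v => idx' v ≠ 0).card := by
          obtain ⟨x, hxC, hx0, hx1⟩ : ∃ x ∈ C, idx x = 0 ∧ idx' x ≠ 0 := by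
            rcases hC e he with hc | hc
            · exact ⟨_, hc, hu, by simp [hidx', hUV]⟩
            · exact ⟨_, hc, hv, by simp [hidx']⟩
          have hx2 : x ∉ C.filter fun v => idx v ≠ 0 := by simp [hx0]
          rw [← Finset.card_insert_of_notMem hx2]
          refine Finset.card_le_card fun y hy => ?_
          rcases Finset.mem_insert.1 hy with rfl | hy
          · exact Finset.mem_filter.2 ⟨hxC, hx1⟩
          · rw [Finset.mem_filter] at hy ⊢
            refine ⟨hy.1, ?_⟩
            simp only [hidx']
            split_ifs
            exacts [by omega, by omega, hy.2]
        have hcard := Finset.card_filter_le C fun v => idx' v ≠ 0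
        refine Runs.seq_assign (v := s + 1) h1 (by simp [← hs]; omega) (by simp [← hs]) (by simp) ?_
        refine Runs.seq_put (k := G.U e) (v := s + 1) h1 (by simp) (by simp)
          (by simp [h24, hS.arr_U e he]) (by simp) (by simp) ?_
        refine Runs.seq_assign (v := s + 1 + 1) h1 (by simp; omega) (by simp) (by simp) ?_
        refine Runs.put (k := G.V e) (v := s + 1 + 1) h1 (by simp) (by simp)
          (by simp [h24, hS.arr_V e he]) (by simp) ?_ (by simp)
        have harr : ((((σ₁.setReg 3 (s + 1)).setArr 4 (G.U e) (s + 1)).setReg 3 (s + 1 + 1)).setArr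
            4 (G.V e) (s + 1 + 1)).arr 4 = idx' := by
          funext v
          simp [hidx', hidx]
        rw [harr]
        have hle' : ∀ v, idx v ≤ s := hI.le
        simp only [State.setArr_reg, State.setReg_reg, if_true]
        refine ⟨⟨fun v => ?_, fun v hv => ?_, fun i hi his => ?_, fun x y hxy hx => ?_,
          fun e' he' => ?_⟩, by omega⟩
        · have := hle' v
          simp only [hidx']
          split_ifs <;> omega
        · simp only [hidx'] at hv
          split_ifs at hv with hv1 hv2
          · rw [hv1]
            exact hG.V_lt e he
          · rw [hv2]
            exact hG.U_lt e he
          · exact hI.lt_n v hv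
        · by_cases hi1 : i = s + 1 + 1
          · exact ⟨G.V e, by simp [hidx', hi1]⟩
          by_cases hi2 : i = s + 1
          · exact ⟨G.U e, by simp [hidx', hi2, hUV]⟩
          · obtain ⟨v, rfl⟩ := hI.surj i hi (by omega)
            refine ⟨v, ?_⟩
            simp only [hidx']
            rw [if_neg, if_neg]
            · rintro rfl
              exact hi hu
            · rintro rfl
              exact hi hv
        · have hx' := hle' x
          have hy' := hle' y
          simp only [hidx'] at hxy hx
          split_ifs at hxy hx with h1 h2 h3 h4 h5 h6 h7 h8 <;> first | omega | skip
          exact hI.inj x y hxy hx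
        · rcases Nat.lt_succ_iff_lt_or_eq.1 he' with he' | rfl
          · rcases hI.cover e' he' with hc | hc
            · left
              simp only [hidx']
              split_ifs
              exacts [by omega, by omega, hc]
            · right
              simp only [hidx']
              split_ifs
              exacts [by omega, by omega, hc]
          · right
            simp [hidx']
      · have hv : idx (G.V e) ≠ 0 := by simpa [h24, hS.arr_V e he] using hv
        exact ⟨hskip (.inr hv), hle⟩
    · have hu : idx (G.U e) ≠ 0 := by simpa [h24, hS.arr_U e he] using hu
      exact ⟨hskip (.inl hu), hle⟩
  · rintro σ' hf ⟨hI, hle⟩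
    exact ⟨hI, hle.trans (Nat.mul_le_mul_left 2 (Finset.card_filter_le _ _))⟩

end WordRAM

namespace WordRAM

open EdgeWeighting

/-! ### Summarizing the graph -/

/-- Prepare the tables of powers of `3` and of ones, and the numbers of types and of pairs of cover
vertices. -/
def prepare : Prog :=
  .assign 26 (.lit 3) ;;
  powers 5 26 ;;
  .assign 9 (.var 25) ;;
  .assign 23 (.var 3 * .var 3) ;;
  .for_ 12 3 (.put 13 (.var 12) (.lit 1))

theorem runs_prepare {W s : ℕ} {σ : State} (h3 : 3 < W) (hs : σ.reg 3 = s) (hsW : s < W)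
    (hpow : 3 ^ s < W) (hsq : s * s < W) :
    Runs W prepare σ (200 * (s + 1)) fun σ' => σ'.reg 9 = 3 ^ s ∧ σ'.reg 23 = s * s ∧
      (∀ i < s, σ'.arr 5 i = 3 ^ i) ∧ ∀ i < s, σ'.arr 13 i = 1 := by
  have h1 : 1 < W := by omega
  refine Runs.seq_assign (v := 3) h1 (by simpa) rfl (by simp; omega) ?_
  refine (runs_powers (s := s) (B := 3) h1 (by simpa) hsW (by simp) (by norm_num) hpow
    (by norm_num) (by norm_num) (by norm_num)).seq (by simp; omega) ?_
  rintro σ₁ hf₁ ⟨h25, h5⟩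
  have hs₁ : σ₁.reg 3 = s := (hf₁.reg 3 (by norm_num) rfl).trans (by simpa)
  refine Runs.seq_assign (v := 3 ^ s) h1 (by simp) (by simpa) (by simp; omega) ?_
  refine Runs.seq_assign (v := s * s) h1 (by simpa [hs₁]) (by simp [hs₁]) (by simp; omega) ?_
  refine (Runs.for_ (I := fun j σ' => ∀ i < j, σ'.arr 13 i = 1) 40 h1 (N := s) (by simpa) hsW
    (by simp) (by simp) ?_ (by simp; omega)).imp ?_
  · intro i σ₂ hi h12 hf hI
    refine Runs.put (k := i) (v := 1) h1 (by simp) (by simpa) (by simpa) rfl ?_ (by simp)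
    intro i' hi'
    by_cases hii : i' = i
    · simp [hii]
    · simp [hii, hI i' (by omega)]
  · intro σ₂ hf h13
    refine ⟨?_, ?_, ?_, h13⟩
    · rw [hf.reg 9 (by norm_num) rfl]
      simp
    · rw [hf.reg 23 (by norm_num) rfl]
      simp
    · rw [hf.arr 5 rfl]
      exact h5

/-- Compute the types of the vertices outside the cover in array `6`, count the edges inside the
cover by type in array `8`, and mark the adjacent pairs of cover vertices in array `10`. -/
def scanEdges : Prog :=
  .for_ 24 2 (
    .assign 20 (.get 4 (.get 1 (.var 24))) ;;
    .assign 21 (.get 4 (.get 2 (.var 24))) ;;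
    .branch (.var 20)
      (.branch (.var 21)
        (.assign 22 ((.lit 1 + .get 3 (.var 24)) *
          (.get 5 (.var 20 - .lit 1) + .get 5 (.var 21 - .lit 1))) ;;
        .put 8 (.var 22) (.get 8 (.var 22) + .lit 1) ;;
        .put 10 ((.var 20 - .lit 1) * .var 3 + (.var 21 - .lit 1)) (.lit 1))
        (.put 6 (.get 2 (.var 24)) (.get 6 (.get 2 (.var 24)) +
          (.lit 1 + .get 3 (.var 24)) * .get 5 (.var 20 - .lit 1))))
      (.put 6 (.get 1 (.var 24)) (.get 6 (.get 1 (.var 24)) +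
        (.lit 1 + .get 3 (.var 24)) * .get 5 (.var 21 - .lit 1))))

/-- The adjacent pairs of cover vertices, each pair encoded as a number. -/
def IsAdj (G : EdgeList) (s : ℕ) (idx : ℕ → ℕ) (j q : ℕ) : Prop :=
  ∃ e < j, idx (G.U e) ≠ 0 ∧ idx (G.V e) ≠ 0 ∧
    q = (idx (G.U e) - 1) * s + (idx (G.V e) - 1)

theorem runs_scanEdges {W s : ℕ} {G : EdgeList} {idx : ℕ → ℕ} {σ : State} (h : Stores W G σ)
    (hG : G.Valid) (hidx : G.IsCoverIndex s idx) (h3 : σ.reg 3 = s) (h4 : σ.arr 4 = idx)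
    (h5 : ∀ i < s, σ.arr 5 i = 3 ^ i) (h6 : ∀ v, σ.arr 6 v = 0) (h8 : ∀ T, σ.arr 8 T = 0)
    (h10 : ∀ q, σ.arr 10 q = 0) (hsq : s * s < W) (hpow : 3 ^ s < W) (h2 : 2 < W)
    (hvt : ∀ v, G.vertexType idx v < 3 ^ s)
    (het : ∀ e < G.m, idx (G.U e) ≠ 0 → idx (G.V e) ≠ 0 → G.edgeType idx e < 3 ^ s) :
    Runs W scanEdges σ (200 * (G.m + 1)) fun σ' => (∀ v, σ'.arr 6 v = G.vertexType idx v) ∧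
      (∀ T, σ'.arr 8 T = G.edgeCount idx G.m T) ∧
      ∀ q, σ'.arr 10 q ≠ 0 ↔ IsAdj G s idx G.m q := by
  have h1 := h.one_lt
  refine Runs.for_ (I := fun j σ' => (∀ v, σ'.arr 6 v = ∑ e ∈ Finset.range j, G.typeTerm idx v e) ∧
    (∀ T, σ'.arr 8 T = G.edgeCount idx j T) ∧ ∀ q, σ'.arr 10 q ≠ 0 ↔ IsAdj G s idx j q) 150 h1
    (N := G.m) h.reg_m h.m_lt (by simp) ?_ ?_ (by omega)
  · exact ⟨by simp [h6], by simp [h8, EdgeList.edgeCount], by simp [h10, IsAdj]⟩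
  rintro e σ₁ he h24 hf ⟨hI6, hI8, hI10⟩
  have hS := h.of_frame hf
  have h3₁ : σ₁.reg 3 = s := (hf.reg 3 (by norm_num) rfl).trans h3
  have h4₁ : σ₁.arr 4 = idx := (hf.arr 4 rfl).trans h4
  have h5₁ : ∀ i < s, σ₁.arr 5 i = 3 ^ i := by
    rw [hf.arr 5 rfl]
    exact h5
  have hU := hS.arr_U e he
  have hV := hS.arr_V e he
  have hB := hS.arr_B e he
  have hB1 := hG.B_le e he
  have hus := hidx.le (G.U e)
  have hvs := hidx.le (G.V e)
  have hUV := hG.U_ne_V e he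
  have hpart : ∀ v, ∑ e ∈ Finset.range e, G.typeTerm idx v e + G.typeTerm idx v e < W := by
    intro v
    rw [← Finset.sum_range_succ]
    refine lt_of_le_of_lt ?_ ((hvt v).trans hpow)
    exact Finset.sum_le_sum_of_subset (Finset.range_mono he)
  have hadj : ∀ q, IsAdj G s idx (e + 1) q ↔ IsAdj G s idx e q ∨ (idx (G.U e) ≠ 0 ∧
      idx (G.V e) ≠ 0 ∧ q = (idx (G.U e) - 1) * s + (idx (G.V e) - 1)) := by
    intro q
    constructor
    · rintro ⟨e', he', h'⟩
      rcases Nat.lt_succ_iff_lt_or_eq.1 he' with he' | rfl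
      exacts [.inl ⟨e', he', h'⟩, .inr h']
    · rintro (⟨e', he', h'⟩ | h')
      exacts [⟨e', by omega, h'⟩, ⟨e, by omega, h'⟩]
  refine Runs.seq_assign (v := idx (G.U e)) h1 (by simp) (by simp [h24, hU, h4₁]) (by simp) ?_
  refine Runs.seq_assign (v := idx (G.V e)) h1 (by simp) (by simp [h24, hV, h4₁]) (by simp) ?_
  refine Runs.branch h1 (by simp) (by simp) (fun hu => ?_) (fun hu => ?_)
  · have hu : idx (G.U e) ≠ 0 := by simpa using hu
    have hpu := h5₁ (idx (G.U e) - 1) (by omega)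
    refine Runs.branch h1 (by simp) (by simp) (fun hv => ?_) (fun hv => ?_)
    · have hv : idx (G.V e) ≠ 0 := by simpa using hv
      have hpv := h5₁ (idx (G.V e) - 1) (by omega)
      have ht := het e he hu hv
      have hsum : 3 ^ (idx (G.U e) - 1) + 3 ^ (idx (G.V e) - 1) ≤ G.edgeType idx e :=
        Nat.le_mul_of_pos_left _ (by omega)
      have hq : (idx (G.U e) - 1) * s + (idx (G.V e) - 1) < s * s := by
        have : (idx (G.U e) - 1 + 1) * s ≤ s * s := Nat.mul_le_mul_right s (by omega)
        rw [Nat.succ_mul] at this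
        omega
      have hcount : G.edgeCount idx e (G.edgeType idx e) ≤ e := by
        refine (Finset.sum_le_card_nsmul _ _ 1 fun x _ => ?_).trans (by simp)
        split_ifs <;> omega
      have hmW := h.m_lt
      refine Runs.seq_assign (v := G.edgeType idx e) h1 ?_
        (by simp [h24, hB, hpu, hpv, EdgeList.edgeType]) (by simp) ?_
      · simp [h24, hB, hpu, hpv]
        have : G.edgeType idx e =
          (1 + G.B e) * (3 ^ (idx (G.U e) - 1) + 3 ^ (idx (G.V e) - 1)) := rfl
        omega
      refine Runs.seq_put (k := G.edgeType idx e) (v := G.edgeCount idx e (G.edgeType idx e) + 1) h1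
        (by simp) (by simp [hI8]; omega) (by simp) (by simp [hI8]) (by simp) ?_
      refine Runs.put (k := (idx (G.U e) - 1) * s + (idx (G.V e) - 1)) (v := 1) h1 ?_ (by simpa)
        (by simp [h3₁]) rfl ⟨fun v => ?_, fun T => ?_, fun q => ?_⟩ (by simp)
      · simp [h3₁]
        omega
      · rw [Finset.sum_range_succ, ← hI6]
        simp [EdgeList.typeTerm, hu, hv]
      · rw [EdgeList.edgeCount_succ]
        by_cases hT : T = G.edgeType idx e
        · simp [hT, hu, hv]
        · simp [hT, hu, hv, Ne.symm hT, hI8]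
      · rw [hadj, ← hI10]
        by_cases hqe : q = (idx (G.U e) - 1) * s + (idx (G.V e) - 1)
        · simp [hqe, hu, hv]
        · simp [hqe]
    · have hv : idx (G.V e) = 0 := by simpa using hv
      have hterm : G.typeTerm idx (G.V e) e = (1 + G.B e) * 3 ^ (idx (G.U e) - 1) := by
        simp [EdgeList.typeTerm, hu, hv]
      have hp := hpart (G.V e)
      rw [hterm] at hp
      have h1B : 1 + G.B e ≤ 2 := by omega
      refine Runs.put (k := G.V e) (v := ∑ e' ∈ Finset.range (e + 1), G.typeTerm idx (G.V e) e') h1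
        (by simp) ?_ (by simp [h24, hV]) ?_ ⟨fun v => ?_, fun T => ?_, fun q => ?_⟩ (by simp)
      · simp [h24, hB, hV, hpu, hI6]
        omega
      · simp [h24, hB, hV, hpu, hI6, Finset.sum_range_succ, hterm]
      · by_cases hvV : v = G.V e
        · simp [hvV]
        · have : ∑ e' ∈ Finset.range (e + 1), G.typeTerm idx v e' = σ₁.arr 6 v := by
            rw [Finset.sum_range_succ, ← hI6]
            simp [hvV, EdgeList.typeTerm, hu]
          simp [hvV, this]
      · rw [EdgeList.edgeCount_succ]
        simp [hv, hI8]
      · rw [hadj, ← hI10]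
        simp [hv]
  · have hu : idx (G.U e) = 0 := by simpa using hu
    have hv : idx (G.V e) ≠ 0 := (hidx.cover e he).resolve_left (by simp [hu])
    have hpv := h5₁ (idx (G.V e) - 1) (by omega)
    have hterm : G.typeTerm idx (G.U e) e = (1 + G.B e) * 3 ^ (idx (G.V e) - 1) := by
      simp [EdgeList.typeTerm, hu]
    have hp := hpart (G.U e)
    rw [hterm] at hp
    have h1B : 1 + G.B e ≤ 2 := by omega
    refine Runs.put (k := G.U e) (v := ∑ e' ∈ Finset.range (e + 1), G.typeTerm idx (G.U e) e') h1
      (by simp) ?_ (by simp [h24, hU]) ?_ ⟨fun v => ?_, fun T => ?_, fun q => ?_⟩ (by simp)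
    · simp [h24, hB, hU, hpv, hI6]
      omega
    · simp [h24, hB, hU, hpv, hI6, Finset.sum_range_succ, hterm]
    · by_cases hvU : v = G.U e
      · simp [hvU]
      · have : ∑ e' ∈ Finset.range (e + 1), G.typeTerm idx v e' = σ₁.arr 6 v := by
          rw [Finset.sum_range_succ, ← hI6]
          simp [hvU, EdgeList.typeTerm, hu]
        simp [hvU, this]
    · rw [EdgeList.edgeCount_succ]
      simp [hu, hI8]
    · rw [hadj, ← hI10]
      simp [hu]

/-- Count the vertices outside the cover by type in array `7`. -/
def countVertices : Prog :=
  .for_ 24 1 (.branch (.get 4 (.var 24)) .skip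
    (.put 7 (.get 6 (.var 24)) (.get 7 (.get 6 (.var 24)) + .lit 1)))

theorem runs_countVertices {W : ℕ} {G : EdgeList} {idx : ℕ → ℕ} {σ : State}
    (h : Stores W G σ) (h4 : σ.arr 4 = idx) (h6 : ∀ v, σ.arr 6 v = G.vertexType idx v)
    (h7 : ∀ T, σ.arr 7 T = 0) :
    Runs W countVertices σ (100 * (G.n + 1)) fun σ' =>
      ∀ T, σ'.arr 7 T = G.vertexCount idx G.n T := by
  have h1 := h.one_lt
  refine Runs.for_ (I := fun j σ' => ∀ T, σ'.arr 7 T = G.vertexCount idx j T) 50 h1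
    (N := G.n) h.reg_n h.n_lt (by simp) (by simp [h7, EdgeList.vertexCount]) ?_ (by omega)
  intro v σ₁ hv h24 hf hI
  have h4₁ : σ₁.arr 4 = idx := (hf.arr 4 rfl).trans h4
  have h6₁ : σ₁.arr 6 v = G.vertexType idx v := by rw [hf.arr 6 rfl, h6]
  refine Runs.branch h1 (by simp) (by simp) (fun h0 => Runs.skip (fun T => ?_) (by simp))
    (fun h0 => ?_)
  · have h0 : idx v ≠ 0 := by simpa [h24, h4₁] using h0
    rw [EdgeList.vertexCount_succ, hI]
    simp [h0]
  · have h0 : idx v = 0 := by simpa [h24, h4₁] using h0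
    have hcount : G.vertexCount idx v (G.vertexType idx v) ≤ v := by
      refine (Finset.sum_le_card_nsmul _ _ 1 fun x _ => ?_).trans (by simp)
      split_ifs <;> omega
    have hnW := h.n_lt
    refine Runs.put (k := G.vertexType idx v)
      (v := G.vertexCount idx v (G.vertexType idx v) + 1) h1 (by simp) ?_ (by simp [h24, h6₁])
      (by simp [h24, h6₁, hI]) (fun T => ?_) (by simp)
    · simp [h24, h6₁, hI]
      omega
    · rw [EdgeList.vertexCount_succ]
      by_cases hT : T = G.vertexType idx v
      · simp [hT, h0]
      · simp [hT, Ne.symm hT, hI]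

/-- Compute the largest modulus to try, in register `5`. -/
def chooseBound : Prog :=
  .assign 20 (.var 1 + .var 2) ;;
  .assign 27 (.lit 0) ;;
  .while_ (.var 20) (.assign 27 (.var 27 + .lit 1) ;; .assign 20 (.var 20 / .lit 2)) ;;
  .assign 5 (.lit 2 * (.var 23 * .var 27 + .lit 1))

theorem runs_chooseBound {W s L : ℕ} {G : EdgeList} {σ : State} (h : Stores W G σ)
    (h23 : σ.reg 23 = s * s) (hL : L = (G.n + G.m).size) (hnm : G.n + G.m < W)
    (hQ : 2 * (s * s * L + 1) < W) :
    Runs W chooseBound σ (100 * (L + 1)) fun σ' => σ'.reg 5 = 2 * (s * s * L + 1) := by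
  have h1 := h.one_lt
  have hLW : L ≤ G.n + G.m := by
    rw [hL, Nat.size_le]
    exact Nat.lt_two_pow_self
  refine Runs.seq_assign (v := G.n + G.m) h1 (by simpa [h.reg_n, h.reg_m])
    (by simp [h.reg_n, h.reg_m]) (by simp; omega) ?_
  refine Runs.seq_assign (v := 0) h1 (by simp; omega) rfl (by simp; omega) ?_
  refine Runs.seq (T₁ := L * 60 + 10) (Q := fun σ' => σ'.reg 27 = L) ?_ (by simp; omega) ?_
  · refine (Runs.while_ (I := fun k σ' => k + σ'.reg 27 = L ∧
      σ'.reg 20 = (G.n + G.m) / 2 ^ σ'.reg 27) 40 h1 (k := L) (by simp) (by simp) ?_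
      (by simp; omega)).imp ?_
    · rintro k σ₁ hf ⟨hk, h20⟩ hne
      have hlt : σ₁.reg 27 < L := by
        rw [hL, Nat.lt_size]
        by_contra hc
        exact hne (by simp [h20, Nat.div_eq_of_lt (not_le.1 hc)])
      refine ⟨k - 1, by omega, ?_⟩
      refine Runs.seq_assign (v := σ₁.reg 27 + 1) h1 (by simp; omega) rfl (by simp) ?_
      refine Runs.assign (v := (G.n + G.m) / 2 ^ (σ₁.reg 27 + 1)) h1 (by simp; omega)
        (by simp [h20, Nat.div_div_eq_div_mul, pow_succ]) ⟨by simp; omega, by simp⟩ (by simp)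
    · rintro σ₁ hf ⟨h0, k, hk, h20⟩
      have : L ≤ σ₁.reg 27 := by
        rw [hL, Nat.size_le]
        have h0 : σ₁.reg 20 = 0 := h0
        rw [h20, Nat.div_eq_zero_iff] at h0
        exact h0.resolve_left (by positivity)
      omega
  · intro σ₁ hf h27
    have h23₁ : σ₁.reg 23 = s * s := (hf.reg 23 (by norm_num) rfl).trans (by simpa)
    refine Runs.assign (v := 2 * (s * s * L + 1)) h1 ?_ (by simp [h23₁, h27]) (by simp)
      (by simp; omega)
    simp [h23₁, h27]
    omega

end WordRAM

namespace EdgeWeighting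

open WordRAM

/-! ### A modulus that separates the colours -/

/-- If nonzero numbers have together fewer than `n` bits, not every number up to `2 n` divides one
of them: otherwise their product would be a multiple of the central binomial coefficient, all of whose
prime powers are at most `2 n`. -/
theorem exists_not_dvd {ι : Type*} (A : Finset ι) (d : ι → ℕ) (L : ℕ) (hd : ∀ i ∈ A, d i ≠ 0)
    (hL : ∀ i ∈ A, d i < 2 ^ L) :
    ∃ M < 2 * (A.card * L + 1), ∀ i ∈ A, ¬ (M + 1) ∣ d i := by
  by_contra! hc
  set n := A.card * L + 1 with hn
  have hdvd : n.centralBinom ∣ ∏ i ∈ A, d i := by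
    rw [Nat.dvd_iff_prime_pow_dvd_dvd]
    intro p k hp hk
    have hle : p ^ k ≤ 2 * n := by
      have h1 : k ≤ (n.centralBinom).factorization p :=
        (hp.pow_dvd_iff_le_factorization (Nat.centralBinom_ne_zero n)).1 hk
      refine (Nat.pow_le_pow_right hp.pos h1).trans ?_
      rw [Nat.centralBinom_eq_two_mul_choose]
      exact Nat.pow_factorization_choose_le (by omega)
    obtain ⟨i, hi, hpi⟩ := hc (p ^ k - 1) (by
      have := Nat.pow_pos (n := k) hp.pos
      omega)
    rw [Nat.sub_add_cancel (Nat.pow_pos hp.pos)] at hpi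
    exact hpi.trans (Finset.dvd_prod_of_mem d hi)
  have hpos : 0 < ∏ i ∈ A, d i := Finset.prod_pos fun i hi => Nat.pos_of_ne_zero (hd i hi)
  have h1 : n.centralBinom ≤ 2 ^ (A.card * L) := by
    refine (Nat.le_of_dvd hpos hdvd).trans ?_
    refine (Finset.prod_le_prod' fun i hi => (hL i hi).le).trans ?_
    rw [Finset.prod_const, ← pow_mul, mul_comm]
  have h2 := Nat.four_pow_le_two_mul_self_mul_centralBinom n (by omega)
  have h3 : n < 2 ^ n := Nat.lt_two_pow_self
  have h4 : (4 : ℕ) ^ n = 2 ^ n * 2 ^ n := by rw [← mul_pow]; norm_num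
  have h5 : 2 * n * 2 ^ (A.card * L) = n * 2 ^ n := by
    rw [hn, pow_succ]
    ring
  have h6 : 2 ^ n * 2 ^ n ≤ n * 2 ^ n := by
    rw [← h4, ← h5]
    exact h2.trans (Nat.mul_le_mul_left _ h1)
  have h7 : n * 2 ^ n < 2 ^ n * 2 ^ n := Nat.mul_lt_mul_of_pos_right h3 (by positivity)
  omega

/-- Some modulus up to `2 (s² L + 1)` separates any two different ones among `s` numbers below
`2 ^ L`. -/
theorem exists_modulus (s L : ℕ) (c : ℕ → ℕ) (hc : ∀ i < s, c i < 2 ^ L) :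
    ∃ M < 2 * (s * s * L + 1), ∀ B, ∀ i < s, ∀ j < s, c i ≠ c j →
      wrap B (M + 1) (c i) ≠ wrap B (M + 1) (c j) := by
  obtain ⟨M, hM, h⟩ := exists_not_dvd
    ((Finset.range s ×ˢ Finset.range s).filter fun p => c p.1 ≠ c p.2)
    (fun p => c p.1 - c p.2 + (c p.2 - c p.1)) L
    (fun p hp => by
      have := (Finset.mem_filter.1 hp).2
      omega)
    (fun p hp => by
      obtain ⟨hp, -⟩ := Finset.mem_filter.1 hp
      rw [Finset.mem_product, Finset.mem_range, Finset.mem_range] at hp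
      have := hc _ hp.1
      have := hc _ hp.2
      omega)
  refine ⟨M, hM.trans_le ?_, fun B i hi j hj hij heq => ?_⟩
  · have h1 := Finset.card_filter_le (Finset.range s ×ˢ Finset.range s) fun p => c p.1 ≠ c p.2
    rw [Finset.card_product, Finset.card_range] at h1
    have := Nat.mul_le_mul_right L h1
    omega
  · refine h (i, j) (Finset.mem_filter.2 ⟨by simp [hi, hj], hij⟩) ?_
    have hmod : c i ≡ c j [MOD M + 1] := by
      have h1 := wrap_modEq B (M + 1) (c i)
      rw [heq] at h1
      exact h1.symm.trans (wrap_modEq B (M + 1) (c j))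
    rcases le_total (c i) (c j) with h2 | h2
    · have := (Nat.modEq_iff_dvd' h2).1 hmod
      simpa [Nat.sub_eq_zero_of_le h2] using this
    · have := (Nat.modEq_iff_dvd' h2).1 hmod.symm
      simpa [Nat.sub_eq_zero_of_le h2] using this

/-! ### Weightings as sums of patterns -/

namespace EdgeList

/-- The colour of the vertex `v` under the weighting `ω` of the edges. -/
def color (G : EdgeList) (ω : ℕ → ℕ) (v : ℕ) : ℕ :=
  ∑ e ∈ Finset.range G.m, if G.U e = v ∨ G.V e = v then ω e else 0

/-- There is a proper weighting in which all marked edges have weight `1`. -/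
def HasWeighting (G : EdgeList) : Prop :=
  ∃ ω : ℕ → ℕ, ∀ e < G.m, ω e ≤ 1 ∧ G.B e ≤ ω e ∧ G.color ω (G.U e) ≠ G.color ω (G.V e)

/-- The edge `e` joins the vertex `v` to the cover vertex with index `i + 1`. -/
abbrev Joins (G : EdgeList) (idx : ℕ → ℕ) (e v i : ℕ) : Prop :=
  idx (G.U e) = i + 1 ∧ G.V e = v ∨ G.U e = v ∧ idx (G.V e) = i + 1

/-- The edge `e` is incident with the cover vertex with index `i + 1`. -/
abbrev Meets (G : EdgeList) (idx : ℕ → ℕ) (e i : ℕ) : Prop :=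
  idx (G.U e) = i + 1 ∨ idx (G.V e) = i + 1

/-- Both ends of the edge `e` are in the cover. -/
abbrev Inner (G : EdgeList) (idx : ℕ → ℕ) (e : ℕ) : Prop :=
  idx (G.U e) ≠ 0 ∧ idx (G.V e) ≠ 0

/-- The sum of the values of `f` on the edges that join `v` to the cover vertex with index
`i + 1`. -/
def joinSum (G : EdgeList) (idx : ℕ → ℕ) (f : ℕ → ℕ) (v i : ℕ) : ℕ :=
  ∑ e ∈ Finset.range G.m, if G.Joins idx e v i then f e else 0

/-- The sum of the values of `f` on the edges incident with the cover vertex with index `i + 1`. -/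
def meetSum (G : EdgeList) (idx : ℕ → ℕ) (f : ℕ → ℕ) (i : ℕ) : ℕ :=
  ∑ e ∈ Finset.range G.m, if G.Meets idx e i then f e else 0

variable {G : EdgeList} {s : ℕ} {idx : ℕ → ℕ}

theorem joins_unique (hG : G.Valid) (hidx : G.IsCoverIndex s idx) {v i e e' : ℕ}
    (he : e < G.m) (he' : e' < G.m) (h : G.Joins idx e v i) (h' : G.Joins idx e' v i) : e = e' := by
  refine hG.inj e he e' he' ?_
  rcases h with ⟨h1, h2⟩ | ⟨h1, h2⟩ <;> rcases h' with ⟨h3, h4⟩ | ⟨h3, h4⟩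
  · exact .inl ⟨hidx.inj _ _ (by omega) (by omega), by omega⟩
  · exact .inr ⟨hidx.inj _ _ (by omega) (by omega), by omega⟩
  · exact .inr ⟨by omega, hidx.inj _ _ (by omega) (by omega)⟩
  · exact .inl ⟨by omega, hidx.inj _ _ (by omega) (by omega)⟩

theorem joinSum_eq (hG : G.Valid) (hidx : G.IsCoverIndex s idx) {f : ℕ → ℕ} {v i e : ℕ}
    (he : e < G.m) (h : G.Joins idx e v i) : G.joinSum idx f v i = f e := by
  rw [joinSum, Finset.sum_eq_single e, if_pos h]
  · intro e' he' hne
    rw [if_neg]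
    exact fun h' => hne (joins_unique hG hidx (Finset.mem_range.1 he') he h' h)
  · exact fun hc => absurd (Finset.mem_range.2 he) hc

theorem joinSum_eq_zero {f : ℕ → ℕ} {v i : ℕ} (h : ∀ e < G.m, ¬ G.Joins idx e v i) :
    G.joinSum idx f v i = 0 :=
  Finset.sum_eq_zero fun e he => if_neg (h e (Finset.mem_range.1 he))

/-- The sum over all cover vertices to which an edge joins a vertex outside the cover has at most
one term. -/
theorem sum_joins (hG : G.Valid) (hidx : G.IsCoverIndex s idx) {v e : ℕ} (hv : idx v = 0)
    (he : e < G.m) (F : ℕ → ℕ) :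
    (∑ i ∈ Finset.range s, if G.Joins idx e v i then F i else 0) =
      if G.V e = v then F (idx (G.U e) - 1) else if G.U e = v then F (idx (G.V e) - 1) else 0 := by
  have hc := hidx.cover e he
  have hu := hidx.le (G.U e)
  have hw := hidx.le (G.V e)
  have hne := hG.U_ne_V e he
  split_ifs with h1 h2
  · have hU : idx (G.U e) ≠ 0 := by
      rw [h1, hv] at hc
      tauto
    rw [Finset.sum_eq_single (idx (G.U e) - 1), if_pos (.inl ⟨by omega, h1⟩)]
    · intro i _ hi
      rw [if_neg]
      rintro (⟨h2, -⟩ | ⟨h2, -⟩) <;> omega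
    · intro hc
      rw [Finset.mem_range] at hc
      omega
  · have hV : idx (G.V e) ≠ 0 := by
      rw [h2, hv] at hc
      tauto
    rw [Finset.sum_eq_single (idx (G.V e) - 1), if_pos (.inr ⟨h2, by omega⟩)]
    · intro i _ hi
      rw [if_neg]
      rintro (⟨-, h3⟩ | ⟨-, h3⟩) <;> omega
    · intro hc
      rw [Finset.mem_range] at hc
      omega
  · refine Finset.sum_eq_zero fun i _ => if_neg ?_
    rintro (⟨-, h3⟩ | ⟨h3, -⟩) <;> omega

theorem sum_meets (hG : G.Valid) (hidx : G.IsCoverIndex s idx) {e : ℕ} (hin : G.Inner idx e)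
    (he : e < G.m) (F : ℕ → ℕ) :
    (∑ i ∈ Finset.range s, if G.Meets idx e i then F i else 0) =
      F (idx (G.U e) - 1) + F (idx (G.V e) - 1) := by
  have hu := hidx.le (G.U e)
  have hw := hidx.le (G.V e)
  have hne : idx (G.U e) ≠ idx (G.V e) := fun h => hG.U_ne_V e he (hidx.inj _ _ h hin.1)
  have hin1 := hin.1
  have hin2 := hin.2
  have : ∀ i, (if G.Meets idx e i then F i else 0) =
      (if i = idx (G.U e) - 1 then F i else 0) + if i = idx (G.V e) - 1 then F i else 0 := by
    intro i
    split_ifs <;> simp only [Meets] at * <;> omega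
  simp only [this, Finset.sum_add_distrib, Finset.sum_ite_eq', Finset.mem_range]
  rw [if_pos (by omega), if_pos (by omega)]

theorem sum_joinSum (hG : G.Valid) (hidx : G.IsCoverIndex s idx) {v : ℕ} (hv : idx v = 0)
    (ω : ℕ → ℕ) : ∑ i ∈ Finset.range s, G.joinSum idx ω v i = G.color ω v := by
  simp only [joinSum]
  rw [Finset.sum_comm]
  refine Finset.sum_congr rfl fun e he => ?_
  rw [sum_joins hG hidx hv (Finset.mem_range.1 he) fun _ => ω e]
  split_ifs <;> tauto

theorem vertexType_eq_pack (hG : G.Valid) (hidx : G.IsCoverIndex s idx) {v : ℕ} (hv : idx v = 0) :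
    G.vertexType idx v = pack 3 s (G.joinSum idx (fun e => 1 + G.B e) v) := by
  simp only [pack, joinSum, Finset.sum_mul]
  rw [Finset.sum_comm, vertexType]
  refine Finset.sum_congr rfl fun e he => ?_
  have he := Finset.mem_range.1 he
  simp only [ite_mul, zero_mul]
  rw [sum_joins hG hidx hv he fun i => (1 + G.B e) * 3 ^ i, typeTerm]
  have hc := hidx.cover e he
  have hne := hG.U_ne_V e he
  by_cases h1 : G.V e = v
  · have h3 : idx (G.V e) = 0 := by rw [h1, hv]
    have h4 : idx (G.U e) ≠ 0 := hc.resolve_right (by simp [h3])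
    rw [if_pos ⟨h4, h3, h1.symm⟩, if_pos h1]
  · rw [if_neg (fun h => h1 h.2.2.symm), if_neg h1]
    by_cases h2 : G.U e = v
    · rw [if_pos h2, if_pos ⟨by rw [h2, hv], h2.symm⟩]
    · rw [if_neg h2, if_neg fun h => h2 h.2.symm]

theorem joinSum_lt (hG : G.Valid) (hidx : G.IsCoverIndex s idx) (v i : ℕ) :
    G.joinSum idx (fun e => 1 + G.B e) v i < 3 := by
  by_cases h : ∃ e < G.m, G.Joins idx e v i
  · obtain ⟨e, he, h⟩ := h
    rw [joinSum_eq hG hidx he h]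
    have := hG.B_le e he
    omega
  · rw [joinSum_eq_zero fun e he hj => h ⟨e, he, hj⟩]
    norm_num

theorem vertexType_lt (hG : G.Valid) (hidx : G.IsCoverIndex s idx) (v : ℕ) :
    G.vertexType idx v < 3 ^ s := by
  by_cases hv : idx v = 0
  · rw [vertexType_eq_pack hG hidx hv]
    exact pack_lt s fun i _ => joinSum_lt hG hidx v i
  · rw [vertexType, Finset.sum_eq_zero]
    · positivity
    · intro e _
      rw [typeTerm, if_neg, if_neg]
      · rintro ⟨h, rfl⟩
        exact hv h
      · rintro ⟨-, h, rfl⟩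
        exact hv h

theorem digit_vertexType (hG : G.Valid) (hidx : G.IsCoverIndex s idx) {v : ℕ} (hv : idx v = 0)
    {i : ℕ} (hi : i < s) :
    digit 3 (G.vertexType idx v) i = G.joinSum idx (fun e => 1 + G.B e) v i := by
  rw [vertexType_eq_pack hG hidx hv, digit_pack s (fun i _ => joinSum_lt hG hidx v i) hi]

theorem edgeType_eq_pack (hG : G.Valid) (hidx : G.IsCoverIndex s idx) {e : ℕ}
    (hin : G.Inner idx e) (he : e < G.m) :
    G.edgeType idx e = pack 3 s fun i => if G.Meets idx e i then 1 + G.B e else 0 := by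
  simp only [pack, ite_mul, zero_mul]
  rw [sum_meets hG hidx hin he fun i => (1 + G.B e) * 3 ^ i, edgeType, mul_add]

theorem ite_meets_lt (hG : G.Valid) {e : ℕ} (he : e < G.m) (i : ℕ) :
    (if G.Meets idx e i then 1 + G.B e else 0) < 3 := by
  have := hG.B_le e he
  split_ifs <;> omega

theorem edgeType_lt (hG : G.Valid) (hidx : G.IsCoverIndex s idx) {e : ℕ}
    (hin : G.Inner idx e) (he : e < G.m) : G.edgeType idx e < 3 ^ s := by
  rw [edgeType_eq_pack hG hidx hin he]
  exact pack_lt s fun i _ => ite_meets_lt hG he i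

theorem digit_edgeType (hG : G.Valid) (hidx : G.IsCoverIndex s idx) {e : ℕ}
    (hin : G.Inner idx e) (he : e < G.m) {i : ℕ} (hi : i < s) :
    digit 3 (G.edgeType idx e) i = if G.Meets idx e i then 1 + G.B e else 0 := by
  rw [edgeType_eq_pack hG hidx hin he, digit_pack s (fun i _ => ite_meets_lt hG he i) hi]

/-- The colour of a cover vertex is the sum of the contributions of the vertices outside the cover
and of the edges inside the cover. -/
theorem sum_contributions (hG : G.Valid) (hidx : G.IsCoverIndex s idx) (ω : ℕ → ℕ) (i : ℕ) :
    (∑ v ∈ Finset.range G.n, if idx v = 0 then G.joinSum idx ω v i else 0) +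
      (∑ e ∈ Finset.range G.m, if G.Inner idx e then if G.Meets idx e i then ω e else 0 else 0) =
    G.meetSum idx ω i := by
  have h1 : ∀ v, (if idx v = 0 then G.joinSum idx ω v i else 0) =
      ∑ e ∈ Finset.range G.m, if idx v = 0 ∧ G.Joins idx e v i then ω e else 0 := by
    intro v
    by_cases hv : idx v = 0
    · simp [hv, joinSum]
    · simp [hv]
  simp only [h1]
  rw [Finset.sum_comm, ← Finset.sum_add_distrib]
  refine Finset.sum_congr rfl fun e he => ?_
  have he := Finset.mem_range.1 he
  have hc := hidx.cover e he
  by_cases hin : G.Inner idx e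
  · rw [if_pos hin, Finset.sum_eq_zero, zero_add]
    intro v _
    rw [if_neg]
    rintro ⟨hv, (⟨-, rfl⟩ | ⟨rfl, -⟩)⟩
    · exact hin.2 hv
    · exact hin.1 hv
  · rw [if_neg hin, add_zero]
    by_cases hU : idx (G.U e) = 0
    · rw [Finset.sum_eq_single (G.U e)]
      · refine if_congr ?_ rfl rfl
        simp [Joins, Meets, hU]
      · intro v _ hv
        rw [if_neg]
        rintro ⟨-, (⟨h, -⟩ | ⟨h, -⟩)⟩
        · omega
        · exact hv h.symm
      · intro h
        exact absurd (Finset.mem_range.2 (hG.U_lt e he)) h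
    · have hV : idx (G.V e) = 0 := by
        by_contra hV
        exact hin ⟨hU, hV⟩
      rw [Finset.sum_eq_single (G.V e)]
      · refine if_congr ?_ rfl rfl
        simp [Joins, Meets, hV]
      · intro v _ hv
        rw [if_neg]
        rintro ⟨-, (⟨-, h⟩ | ⟨-, h⟩)⟩
        · exact hv h.symm
        · omega
      · intro h
        exact absurd (Finset.mem_range.2 (hG.V_lt e he)) h

theorem color_eq_meetSum (hidx : G.IsCoverIndex s idx) (ω : ℕ → ℕ) {v : ℕ} (hv : idx v ≠ 0) :
    G.color ω v = G.meetSum idx ω (idx v - 1) := by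
  refine Finset.sum_congr rfl fun e _ => if_congr ?_ rfl rfl
  have h : ∀ u, u = v ↔ idx u = idx v - 1 + 1 := fun u =>
    ⟨fun h => by rw [h]; omega, fun h => hidx.inj u v (by omega) (by omega)⟩
  rw [h, h]

end EdgeList

end EdgeWeighting

namespace WordRAM

/-! ### Targets and weightings -/

theorem multiple_add (b c : ℕ) (Y : Set (ℕ → ℕ)) :
    multiple (b + c) Y = multiple b Y + multiple c Y :=
  Finset.sum_range_add _ _ _

/-- Collecting the items by their types does not change the sum of their pattern sets. -/
theorem sum_multiple_count (N : ℕ) (P : ℕ → Set (ℕ → ℕ)) (p : ℕ → Prop) [DecidablePred p]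
    (ty : ℕ → ℕ) (j : ℕ) (h : ∀ a < j, p a → ty a < N) :
    ∑ T ∈ Finset.range N, multiple (∑ a ∈ Finset.range j, if p a ∧ ty a = T then 1 else 0) (P T) =
      ∑ a ∈ Finset.range j, if p a then P (ty a) else 0 := by
  induction j with
  | zero => simp [multiple]
  | succ j ih =>
    simp only [Finset.sum_range_succ, multiple_add, Finset.sum_add_distrib]
    rw [ih fun a ha => h a (by omega)]
    congr 1
    split_ifs with hp
    · rw [Finset.sum_eq_single (ty j)]
      · simp [multiple, hp]
      · intro T _ hT
        simp [multiple, hT.symm]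
      · intro hT
        exact absurd (Finset.mem_range.2 (h j (by omega) hp)) hT
    · simp [multiple, hp]

theorem mem_sum_ite_iff {j : ℕ} {p : ℕ → Prop} [DecidablePred p] {P : ℕ → Set (ℕ → ℕ)}
    {x : ℕ → ℕ} :
    (x ∈ ∑ a ∈ Finset.range j, if p a then P a else 0) ↔
      ∃ g : ℕ → ℕ → ℕ, (∀ a < j, p a → g a ∈ P a) ∧
        ∀ i, x i = ∑ a ∈ Finset.range j, if p a then g a i else 0 := by
  rw [Set.mem_finsetSum]
  constructor
  · rintro ⟨g, hg, rfl⟩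
    have hg' : ∀ a < j, g a ∈ if p a then P a else 0 := fun a ha => hg (Finset.mem_range.2 ha)
    refine ⟨g, fun a ha hp => by simpa [hp] using hg' a ha, fun i => ?_⟩
    rw [Finset.sum_apply]
    refine Finset.sum_congr rfl fun a ha => ?_
    split_ifs with hp
    · rfl
    · have := hg' a (Finset.mem_range.1 ha)
      rw [if_neg hp, Set.mem_zero] at this
      rw [this, Pi.zero_apply]
  · rintro ⟨g, hg, hx⟩
    refine ⟨fun a => if p a then g a else 0, fun {a} ha => ?_, ?_⟩
    · by_cases hp : p a
      · simpa [hp] using hg a (Finset.mem_range.1 ha) hp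
      · simp [hp]
    · ext i
      rw [hx, Finset.sum_apply]
      refine Finset.sum_congr rfl fun a _ => ?_
      split_ifs <;> rfl

end WordRAM

namespace EdgeWeighting

open WordRAM

namespace EdgeList

variable {G : EdgeList} {s : ℕ} {idx : ℕ → ℕ}

theorem mem_contributions_iff (hG : G.Valid) (hidx : G.IsCoverIndex s idx) {col x : ℕ → ℕ} :
    x ∈ contributions s (G.vertexCount idx G.n) (G.edgeCount idx G.m) col ↔
      ∃ g h : ℕ → ℕ → ℕ,
        (∀ v < G.n, idx v = 0 → g v ∈ patterns s (digit 3 (G.vertexType idx v)) col) ∧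
        (∀ e < G.m, G.Inner idx e → h e ∈ patterns s (digit 3 (G.edgeType idx e)) fun _ => 1) ∧
        ∀ i, x i = (∑ v ∈ Finset.range G.n, if idx v = 0 then g v i else 0) +
          ∑ e ∈ Finset.range G.m, if G.Inner idx e then h e i else 0 := by
  have h1 := sum_multiple_count (3 ^ s) (fun T => patterns s (digit 3 T) col) (fun v => idx v = 0)
    (G.vertexType idx) G.n fun v _ _ => vertexType_lt hG hidx v
  have h2 := sum_multiple_count (3 ^ s) (fun T => patterns s (digit 3 T) fun _ => 1)
    (G.Inner idx) (G.edgeType idx) G.m fun e he hin => edgeType_lt hG hidx hin he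
  simp only [and_assoc] at h2
  simp only [contributions, Finset.sum_add_distrib, vertexCount, edgeCount]
  rw [h1, h2, Set.mem_add]
  constructor
  · rintro ⟨y, hy, z, hz, rfl⟩
    obtain ⟨g, hg, hy⟩ := mem_sum_ite_iff.1 hy
    obtain ⟨h, hh, hz⟩ := mem_sum_ite_iff.1 hz
    exact ⟨g, h, hg, hh, fun i => by rw [Pi.add_apply, hy, hz]⟩
  · rintro ⟨g, h, hg, hh, hx⟩
    exact ⟨_, mem_sum_ite_iff.2 ⟨g, hg, fun _ => rfl⟩, _, mem_sum_ite_iff.2 ⟨h, hh, fun _ => rfl⟩,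
      funext fun i => (hx i).symm⟩

theorem lt_of_joins (hG : G.Valid) (hidx : G.IsCoverIndex s idx) {e v i : ℕ} (he : e < G.m)
    (h : G.Joins idx e v i) : v < G.n ∧ i < s := by
  rcases h with ⟨h1, rfl⟩ | ⟨rfl, h1⟩
  · exact ⟨hG.V_lt e he, by have := hidx.le (G.U e); omega⟩
  · exact ⟨hG.U_lt e he, by have := hidx.le (G.V e); omega⟩

theorem meetSum_lt {ω : ℕ → ℕ} {L : ℕ} (hω : ∀ e < G.m, ω e ≤ 1) (hL : G.m < 2 ^ L) (i : ℕ) :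
    G.meetSum idx ω i < 2 ^ L := by
  refine lt_of_le_of_lt ?_ hL
  have : G.meetSum idx ω i ≤ ∑ e ∈ Finset.range G.m, 1 := Finset.sum_le_sum fun e he => by
    have := hω e (Finset.mem_range.1 he)
    split_ifs <;> omega
  simpa using this

theorem joinSum_mem_patterns (hG : G.Valid) (hidx : G.IsCoverIndex s idx) {ω col : ℕ → ℕ} {v : ℕ}
    (hv : idx v = 0) (hω : ∀ e < G.m, ω e ≤ 1 ∧ G.B e ≤ ω e)
    (hcol : ∀ i, (∃ e < G.m, G.Joins idx e v i) → G.color ω v ≠ col i) :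
    G.joinSum idx ω v ∈ patterns s (digit 3 (G.vertexType idx v)) col := by
  intro i hi
  rw [digit_vertexType hG hidx hv hi, sum_joinSum hG hidx hv]
  by_cases h : ∃ e < G.m, G.Joins idx e v i
  · have hc := hcol i h
    obtain ⟨e, he, h⟩ := h
    rw [joinSum_eq hG hidx he h, joinSum_eq hG hidx he h]
    have := hω e he
    have := hG.B_le e he
    exact ⟨by omega, by omega, by omega, fun _ => hc⟩
  · have h' : ∀ e < G.m, ¬ G.Joins idx e v i := fun e he hj => h ⟨e, he, hj⟩
    simp [joinSum_eq_zero h']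

theorem ite_meets_mem_patterns (hG : G.Valid) (hidx : G.IsCoverIndex s idx) {ω : ℕ → ℕ} {e : ℕ}
    (hin : G.Inner idx e) (he : e < G.m) (hω : ω e ≤ 1 ∧ G.B e ≤ ω e) :
    (fun i => if G.Meets idx e i then ω e else 0) ∈
      patterns s (digit 3 (G.edgeType idx e)) fun _ => 1 := by
  intro i hi
  rw [digit_edgeType hG hidx hin he hi, sum_meets hG hidx hin he fun _ => ω e]
  have := hG.B_le e he
  refine ⟨?_, ?_, ?_, fun _ => show _ ≠ 1 by omega⟩ <;> dsimp only <;> split_ifs <;> omega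

theorem color_le (hG : G.Valid) (hidx : G.IsCoverIndex s idx) {ω : ℕ → ℕ} {v : ℕ} (hv : idx v = 0)
    (hω : ∀ e < G.m, ω e ≤ 1) : G.color ω v ≤ s := by
  rw [← sum_joinSum hG hidx hv]
  have : ∀ i ∈ Finset.range s, G.joinSum idx ω v i ≤ 1 := by
    intro i _
    by_cases h : ∃ e < G.m, G.Joins idx e v i
    · obtain ⟨e, he, h⟩ := h
      rw [joinSum_eq hG hidx he h]
      exact hω e he
    · rw [joinSum_eq_zero fun e he hj => h ⟨e, he, hj⟩]
      norm_num
  simpa using Finset.sum_le_sum this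

/-- The index pairs that the adjacency matrix of the cover enumerates. -/
theorem isAdj_iff (hidx : G.IsCoverIndex s idx) {q : ℕ} :
    IsAdj G s idx G.m q ↔ q < s * s ∧ ∃ e < G.m, G.Inner idx e ∧
      idx (G.U e) = q / s + 1 ∧ idx (G.V e) = q % s + 1 := by
  constructor
  · rintro ⟨e, he, h1, h2, rfl⟩
    have hu := hidx.le (G.U e)
    have hv := hidx.le (G.V e)
    have hs : 0 < s := by omega
    have hv' : idx (G.V e) - 1 < s := by omega
    refine ⟨?_, e, he, ⟨h1, h2⟩, ?_, ?_⟩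
    · calc (idx (G.U e) - 1) * s + (idx (G.V e) - 1)
          < (idx (G.U e) - 1) * s + s := by omega
        _ = (idx (G.U e) - 1 + 1) * s := by ring
        _ ≤ s * s := Nat.mul_le_mul_right s (by omega)
    · rw [mul_comm, Nat.mul_add_div hs, Nat.div_eq_of_lt hv']
      omega
    · rw [mul_comm, Nat.mul_add_mod, Nat.mod_eq_of_lt hv']
      omega
  · rintro ⟨_, e, he, hin, h1, h2⟩
    refine ⟨e, he, hin.1, hin.2, ?_⟩
    rw [h1, h2, Nat.add_sub_cancel, Nat.add_sub_cancel, Nat.div_add_mod']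

/-- A proper weighting yields a target, for a modulus that separates the colours of the cover. -/
theorem exists_isTarget (hG : G.Valid) (hidx : G.IsCoverIndex s idx) {adj : ℕ → ℕ}
    (hadj : ∀ q, adj q ≠ 0 ↔ IsAdj G s idx G.m q) {L : ℕ} (hL : G.m < 2 ^ L)
    (hw : G.HasWeighting) :
    ∃ M < 2 * (s * s * L + 1), ∃ τ < (s + 1 + (M + 1)) ^ s,
      IsTarget s (M + 1) (G.vertexCount idx G.n) (G.edgeCount idx G.m) adj τ := by
  obtain ⟨ω, hω⟩ := hw
  have hω1 : ∀ e < G.m, ω e ≤ 1 := fun e he => (hω e he).1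
  obtain ⟨M, hM, hsep⟩ := exists_modulus s L (G.meetSum idx ω)
    fun i _ => meetSum_lt hω1 hL i
  have hlt : ∀ i < s, wrap (s + 1) (M + 1) (G.meetSum idx ω i) < s + 1 + (M + 1) :=
    fun i _ => wrap_lt _ (by omega) _
  refine ⟨M, hM, pack _ s fun i => wrap (s + 1) (M + 1) (G.meetSum idx ω i), pack_lt s hlt, ?_, ?_⟩
  · intro q _ hq
    obtain ⟨hq, e, he, hin, h1, h2⟩ := (isAdj_iff hidx).1 ((hadj q).1 hq)
    have hs1 := hidx.le (G.U e)
    have hs2 := hidx.le (G.V e)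
    rw [digit_pack s hlt (by omega), digit_pack s hlt (by omega)]
    refine hsep _ _ (by omega) _ (by omega) ?_
    have := (hω e he).2.2
    rw [color_eq_meetSum hidx ω hin.1, color_eq_meetSum hidx ω hin.2, h1, h2] at this
    exact this
  · refine ⟨G.meetSum idx ω, ?_, rfl⟩
    rw [contributions_congr fun i hi => digit_pack s hlt hi, mem_contributions_iff hG hidx]
    refine ⟨G.joinSum idx ω, fun e i => if G.Meets idx e i then ω e else 0, ?_, ?_,
      fun i => (sum_contributions hG hidx ω i).symm⟩
    · intro v _ hv
      refine joinSum_mem_patterns hG hidx hv (fun e he => ⟨(hω e he).1, (hω e he).2.1⟩) ?_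
      rintro i ⟨e, he, h⟩ heq
      -- colours outside the cover are at most `s`, and `wrap` is injective there
      have hle := color_le hG hidx hv hω1
      have hlt : G.meetSum idx ω i < s + 1 := by
        by_contra hc
        have := le_wrap (M := M + 1) (not_lt.1 hc)
        omega
      rw [wrap_of_lt hlt] at heq
      have hne := (hω e he).2.2
      rcases h with ⟨h1, rfl⟩ | ⟨rfl, h1⟩
      · rw [color_eq_meetSum hidx ω (by omega), h1, Nat.add_sub_cancel] at hne
        exact hne heq.symm
      · rw [color_eq_meetSum hidx ω (v := G.V e) (by omega), h1, Nat.add_sub_cancel] at hne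
        exact hne heq
    · exact fun e he hin => ite_meets_mem_patterns hG hidx hin he ⟨(hω e he).1, (hω e he).2.1⟩

/-- A target yields a proper weighting. -/
theorem hasWeighting_of_isTarget (hG : G.Valid) (hidx : G.IsCoverIndex s idx) {adj : ℕ → ℕ}
    (hadj : ∀ q, adj q ≠ 0 ↔ IsAdj G s idx G.m q) {M τ : ℕ} (hM : 0 < M)
    (h : IsTarget s M (G.vertexCount idx G.n) (G.edgeCount idx G.m) adj τ) : G.HasWeighting := by
  obtain ⟨hne, x, hx, hτ⟩ := h
  have hdig : ∀ i < s, digit (s + 1 + M) τ i = wrap (s + 1) M (x i) := by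
    intro i hi
    rw [← hτ, digit_pack s (fun i _ => wrap_lt _ hM _) hi]
  obtain ⟨g, h, hg, hh, hx⟩ := (mem_contributions_iff hG hidx).1 hx
  -- the weight of an inner edge is that of its two equal halves; that of any other edge is given by
  -- the pattern of its end outside the cover
  set ω : ℕ → ℕ := fun e => if G.Inner idx e then h e (idx (G.U e) - 1)
    else if idx (G.V e) = 0 then g (G.V e) (idx (G.U e) - 1)
    else g (G.U e) (idx (G.V e) - 1) with hωdef
  have hωg : ∀ v i e, idx v = 0 → G.Joins idx e v i → ω e = g v i := by
    rintro v i e hv (⟨h1, rfl⟩ | ⟨rfl, h1⟩)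
    · simp [hωdef, hv, h1]
    · simp [hωdef, hv, h1]
  have hin : ∀ e < G.m, G.Inner idx e → ∀ i < s, h e i = if G.Meets idx e i then ω e else 0 := by
    intro e he hin
    have hu := hidx.le (G.U e)
    have hv := hidx.le (G.V e)
    have hin1 := hin.1
    have hin2 := hin.2
    have hpat := hh e he hin
    have h0 : ∀ i < s, h e i = if G.Meets idx e i then h e i else 0 := by
      intro i hi
      have := (hpat i hi).1
      rw [digit_edgeType hG hidx hin he hi] at this
      split_ifs at this ⊢ with hm <;> omega
    have hsum : ∑ i ∈ Finset.range s, h e i = h e (idx (G.U e) - 1) + h e (idx (G.V e) - 1) := by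
      rw [← sum_meets hG hidx hin he fun i => h e i]
      exact Finset.sum_congr rfl fun i hi => h0 i (Finset.mem_range.1 hi)
    -- the forbidden colour `1` in the middle of the edge makes its halves equal
    have heq : h e (idx (G.U e) - 1) = h e (idx (G.V e) - 1) := by
      have p1 := hpat (idx (G.U e) - 1) (by omega)
      have p2 := hpat (idx (G.V e) - 1) (by omega)
      have p3 := p1.2.2.2 (by
        rw [digit_edgeType hG hidx hin he (by omega), if_pos (.inl (by omega))]
        omega)
      rw [hsum] at p3
      change _ ≠ 1 at p3
      omega
    intro i hi
    rw [h0 i hi]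
    refine ite_congr rfl (fun hm => ?_) fun _ => rfl
    have hωe : ω e = h e (idx (G.U e) - 1) := if_pos hin
    rcases hm with hm | hm
    · rw [hωe, hm, Nat.add_sub_cancel]
    · rw [hωe, heq, hm, Nat.add_sub_cancel]
  have hout : ∀ v < G.n, idx v = 0 → ∀ i < s, g v i = G.joinSum idx ω v i := by
    intro v hvn hv i hi
    by_cases hj : ∃ e < G.m, G.Joins idx e v i
    · obtain ⟨e, he, hj⟩ := hj
      rw [joinSum_eq hG hidx he hj, hωg v i e hv hj]
    · have hj' : ∀ e < G.m, ¬ G.Joins idx e v i := fun e he h => hj ⟨e, he, h⟩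
      have := (hg v hvn hv i hi).1
      rw [digit_vertexType hG hidx hv hi, joinSum_eq_zero hj'] at this
      rw [joinSum_eq_zero hj']
      omega
  have hxω : ∀ i < s, x i = G.meetSum idx ω i := by
    intro i hi
    rw [hx, ← sum_contributions hG hidx ω i]
    congr 1
    · refine Finset.sum_congr rfl fun v hv => ?_
      split_ifs with h0
      · exact hout v (Finset.mem_range.1 hv) h0 i hi
      · rfl
    · refine Finset.sum_congr rfl fun e he => ite_congr rfl (fun h0 => ?_) fun _ => rfl
      exact hin e (Finset.mem_range.1 he) h0 i hi
  -- a colour outside the cover is at most `s`, where the class of a colour determines the colour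
  have houter : ∀ e < G.m, ∀ v i, idx v = 0 → G.Joins idx e v i →
      ω e ≤ 1 ∧ G.B e ≤ ω e ∧ G.color ω v ≠ G.meetSum idx ω i := by
    intro e he v i hv hj
    obtain ⟨hvn, hi⟩ := lt_of_joins hG hidx he hj
    have hp := hg v hvn hv i hi
    rw [digit_vertexType hG hidx hv hi, joinSum_eq hG hidx he hj, ← hωg v i e hv hj,
      hdig i hi, hxω i hi] at hp
    have hB := hG.B_le e he
    have hle : ∑ j ∈ Finset.range s, g v j ≤ s := by
      simpa using Finset.sum_le_sum fun j hj => (hg v hvn hv j (Finset.mem_range.1 hj)).2.1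
    have hcol : ∑ j ∈ Finset.range s, g v j = G.color ω v := by
      rw [← sum_joinSum hG hidx hv]
      exact Finset.sum_congr rfl fun j hj => hout v hvn hv j (Finset.mem_range.1 hj)
    rw [hcol] at hp hle
    refine ⟨by omega, by omega, fun heq => hp.2.2.2 (by omega) ?_⟩
    rw [wrap_of_lt (by omega), heq]
  refine ⟨ω, fun e he => ?_⟩
  have hu := hidx.le (G.U e)
  have hv := hidx.le (G.V e)
  by_cases hine : G.Inner idx e
  · have hin1 := hine.1
    have hin2 := hine.2
    have hB := hG.B_le e he
    have hp := hh e he hine (idx (G.U e) - 1) (by omega)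
    rw [digit_edgeType hG hidx hine he (by omega), if_pos (.inl (by omega))] at hp
    have hωe : ω e = h e (idx (G.U e) - 1) := if_pos hine
    rw [hωe]
    refine ⟨by omega, by omega, fun heq => ?_⟩
    have hsp : 0 < s := by omega
    have hq : IsAdj G s idx G.m ((idx (G.U e) - 1) * s + (idx (G.V e) - 1)) :=
      ⟨e, he, hin1, hin2, rfl⟩
    obtain ⟨hqs, -⟩ := (isAdj_iff hidx).1 hq
    refine hne _ hqs ((hadj _).2 hq) ?_
    rw [mul_comm, Nat.mul_add_div hsp, Nat.div_eq_of_lt (by omega : idx (G.V e) - 1 < s),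
      Nat.mul_add_mod, Nat.mod_eq_of_lt (by omega : idx (G.V e) - 1 < s), add_zero,
      hdig _ (by omega), hdig _ (by omega), hxω _ (by omega), hxω _ (by omega),
      ← color_eq_meetSum hidx ω hin1, ← color_eq_meetSum hidx ω hin2, heq]
  · have hc := hidx.cover e he
    by_cases hV : idx (G.V e) = 0
    · have hU : idx (G.U e) ≠ 0 := by tauto
      have := houter e he (G.V e) (idx (G.U e) - 1) hV (.inl ⟨by omega, rfl⟩)
      rw [← color_eq_meetSum hidx ω hU] at this
      exact ⟨this.1, this.2.1, this.2.2.symm⟩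
    · have hU : idx (G.U e) = 0 := by
        by_contra hU
        exact hine ⟨hU, hV⟩
      have := houter e he (G.U e) (idx (G.V e) - 1) hU (.inr ⟨rfl, by omega⟩)
      rw [← color_eq_meetSum hidx ω hV] at this
      exact this

theorem vertexCount_lt {L : ℕ} (hL : G.n < 2 ^ L) (T : ℕ) : G.vertexCount idx G.n T < 2 ^ L := by
  refine lt_of_le_of_lt ?_ hL
  have : G.vertexCount idx G.n T ≤ ∑ v ∈ Finset.range G.n, 1 := Finset.sum_le_sum fun v _ => by
    split_ifs <;> omega
  simpa using this

theorem edgeCount_lt {L : ℕ} (hL : G.m < 2 ^ L) (T : ℕ) : G.edgeCount idx G.m T < 2 ^ L := by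
  refine lt_of_le_of_lt ?_ hL
  have : G.edgeCount idx G.m T ≤ ∑ e ∈ Finset.range G.m, 1 := Finset.sum_le_sum fun e _ => by
    split_ifs <;> omega
  simpa using this

end EdgeList

end EdgeWeighting

namespace WordRAM

open EdgeWeighting

/-! ### The whole algorithm -/

/-- Decide whether the stored graph has a proper weighting. -/
def solve : Prog :=
  chooseCover ;; prepare ;; scanEdges ;; countVertices ;; chooseBound ;; search

/-- A bound for the number of steps on a graph with `n` vertices and `m` edges, if the chosen cover
has at most `s` vertices. -/
def solveTime (n m s : ℕ) : ℕ :=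
  1000 * (n + m + 1) + 2 * searchTime s (n + m).size (2 * (s * s * (n + m).size + 1))

theorem searchTime_mono {s s' Q Q' : ℕ} (L : ℕ) (hs : s ≤ s') (hQ : Q ≤ Q') :
    searchTime s L Q ≤ searchTime s' L Q' := by
  have h : (s + 1 + Q) ^ s ≤ (s' + 1 + Q') ^ s' :=
    (Nat.pow_le_pow_left (by omega) s).trans (Nat.pow_le_pow_right (by omega) hs)
  unfold searchTime
  gcongr
  norm_num

theorem le_searchTime (s L Q : ℕ) :
    6000 * ((Q + 1) * (s + 1) ^ 2) ≤ searchTime s L Q ∧ 6000 * 3 ^ s ≤ searchTime s L Q ∧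
      6000 * (s + 1 + Q) ^ s ≤ searchTime s L Q := by
  have ha : 1 ≤ Q + 1 := by omega
  have hb : 1 ≤ 3 ^ s := Nat.one_le_pow _ _ (by norm_num)
  have hc : 1 ≤ L + 1 := by omega
  have hd : 1 ≤ (s + 1) ^ 2 := Nat.one_le_pow _ _ (by omega)
  have he : 1 ≤ ((s + 1 + Q) ^ s + 1) ^ 3 := Nat.one_le_pow _ _ (by omega)
  have hN : (s + 1 + Q) ^ s ≤ ((s + 1 + Q) ^ s + 1) ^ 3 :=
    (Nat.le_succ _).trans (Nat.le_self_pow (by norm_num) _)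
  unfold searchTime
  refine ⟨Nat.mul_le_mul_left _ (Nat.mul_le_mul_left _ ?_), Nat.mul_le_mul_left _ ?_,
    Nat.mul_le_mul_left _ ?_⟩
  · calc (s + 1) ^ 2 = 1 * 1 * ((s + 1) ^ 2 * 1) := by ring
      _ ≤ _ := by gcongr
  · calc 3 ^ s = 1 * (3 ^ s * 1 * (1 * 1)) := by ring
      _ ≤ _ := by gcongr
  · calc (s + 1 + Q) ^ s = 1 * (1 * 1 * (1 * (s + 1 + Q) ^ s)) := by ring
      _ ≤ _ := by gcongr

/-- If the chosen cover has at most `K` vertices, the program `solve` takes at most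
`solveTime G.n G.m K` steps. -/
theorem runs_solve {W K : ℕ} {G : EdgeList} {σ : State} (h : Stores W G σ) (hG : G.Valid)
    (hr0 : σ.reg 0 = 0) (hs : σ.reg 3 = 0)
    (h4 : ∀ a, σ.arr 4 a = 0) (h6 : ∀ a, σ.arr 6 a = 0) (h7 : ∀ a, σ.arr 7 a = 0)
    (h8 : ∀ a, σ.arr 8 a = 0) (h10 : ∀ a, σ.arr 10 a = 0)
    (C : Finset ℕ) (hC : ∀ e < G.m, G.U e ∈ C ∨ G.V e ∈ C) (hK : 2 * C.card ≤ K)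
    (hW : solveTime G.n G.m K ≤ W) :
    Runs W solve σ (600 * (G.n + G.m + 1) +
      2 * searchTime K (G.n + G.m).size (2 * (K * K * (G.n + G.m).size + 1))) fun σ' =>
      (G.HasWeighting → σ'.reg 0 = 1) ∧ (¬ G.HasWeighting → σ'.reg 0 = 0) := by
  have h1 := h.one_lt
  unfold solveTime at hW
  set L := (G.n + G.m).size with hL
  have hLnm : L ≤ G.n + G.m := by
    rw [hL, Nat.size_le]
    exact Nat.lt_two_pow_self
  have hnmL : G.n + G.m < 2 ^ L := Nat.lt_size_self _
  have hK2 := (le_searchTime K L (2 * (K * K * L + 1))).1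
  have hKK : K + 1 ≤ (2 * (K * K * L + 1) + 1) * (K + 1) ^ 2 :=
    (Nat.le_self_pow (by norm_num) _).trans (Nat.le_mul_of_pos_left _ (by omega))
  refine (runs_chooseCover h hG hs h4 C hC (by omega)).seq (by omega) ?_
  rintro σ₁ hf₁ ⟨hidx, hle⟩
  generalize hs₁ : σ₁.reg 3 = s at hidx hle
  generalize hi₁ : σ₁.arr 4 = idx at hidx
  have hsK : s ≤ K := hle.trans hK
  have hQK : 2 * (s * s * L + 1) ≤ 2 * (K * K * L + 1) := by gcongr
  have hmono := searchTime_mono L hsK hQK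
  have hst := le_searchTime s L (2 * (s * s * L + 1))
  generalize searchTime K L (2 * (K * K * L + 1)) = R at *
  generalize hQ : 2 * (s * s * L + 1) = Q at *
  have hb1 : s + 1 + Q ≤ (Q + 1) * (s + 1) ^ 2 := by nlinarith
  have hb2 : s * (s + 1 + Q) ≤ (Q + 1) * (s + 1) ^ 2 := by nlinarith [Nat.zero_le (s * Q)]
  have hb3 : s * s ≤ (Q + 1) * (s + 1) ^ 2 := by nlinarith
  generalize (Q + 1) * (s + 1) ^ 2 = Y at *
  have hS₁ := h.of_frame hf₁
  refine (runs_prepare (s := s) (by omega) hs₁ (by omega) (by omega) (by omega)).seq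
    (by omega) ?_
  rintro σ₂ hf₂ ⟨h9, h23, h5, h13⟩
  have hS₂ := hS₁.of_frame hf₂
  have hs₂ : σ₂.reg 3 = s := (hf₂.reg 3 (by norm_num) rfl).trans hs₁
  have hi₂ : σ₂.arr 4 = idx := (hf₂.arr 4 rfl).trans hi₁
  refine (runs_scanEdges (s := s) hS₂ hG hidx hs₂ hi₂ h5
    (fun v => by rw [hf₂.arr 6 rfl, hf₁.arr 6 rfl, h6])
    (fun v => by rw [hf₂.arr 8 rfl, hf₁.arr 8 rfl, h8])
    (fun v => by rw [hf₂.arr 10 rfl, hf₁.arr 10 rfl, h10]) (by omega) (by omega) (by omega)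
    (EdgeList.vertexType_lt hG hidx)
    fun e he hU hV => EdgeList.edgeType_lt hG hidx ⟨hU, hV⟩ he).seq (by omega) ?_
  rintro σ₃ hf₃ ⟨h6₃, h8₃, h10₃⟩
  have hS₃ := hS₂.of_frame hf₃
  refine (runs_countVertices (idx := idx) hS₃ ((hf₃.arr 4 rfl).trans hi₂) h6₃
    (fun T => by rw [hf₃.arr 7 rfl, hf₂.arr 7 rfl, hf₁.arr 7 rfl, h7])).seq (by omega) ?_
  intro σ₄ hf₄ h7₄
  have hS₄ := hS₃.of_frame hf₄
  have h23₄ : σ₄.reg 23 = s * s := by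
    rw [hf₄.reg 23 (by norm_num) rfl, hf₃.reg 23 (by norm_num) rfl, h23]
  refine (runs_chooseBound (s := s) hS₄ h23₄ hL (by omega) (by omega)).seq (by omega) ?_
  intro σ₅ hf₅ h5₅
  have hsum : Summary W s L (G.vertexCount idx G.n) (G.edgeCount idx G.m) (σ₃.arr 10) σ₅ :=
    { types_lt := by omega
      sq_lt := by omega
      cv_lt := fun T _ => EdgeList.vertexCount_lt (by omega) T
      ce_lt := fun T _ => EdgeList.edgeCount_lt (by omega) T
      reg_types := by
        rw [hf₅.reg 9 (by norm_num) rfl, hf₄.reg 9 (by norm_num) rfl,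
          hf₃.reg 9 (by norm_num) rfl, h9]
      reg_sq := (hf₅.reg 23 (by norm_num) rfl).trans h23₄
      arr_cv := by
        rw [hf₅.arr 7 rfl]
        exact funext h7₄
      arr_ce := by
        rw [hf₅.arr 8 rfl, hf₄.arr 8 rfl]
        exact funext h8₃
      arr_adj := by rw [hf₅.arr 10 rfl, hf₄.arr 10 rfl]
      arr_ones := fun i hi => by rw [hf₅.arr 13 rfl, hf₄.arr 13 rfl, hf₃.arr 13 rfl, h13 i hi] }
  refine ((runs_search (s := s) (Q := Q) h1 ?_ ?_ (by omega) (by omega) (by omega) hsum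
    (h5₅.trans hQ) ?_).mono (by omega)).imp ?_
  · rw [hf₅.reg 3 (by norm_num) rfl, hf₄.reg 3 (by norm_num) rfl,
      hf₃.reg 3 (by norm_num) rfl, hs₂]
  · intro i hi
    rw [hf₅.arr 5 rfl, hf₄.arr 5 rfl, hf₃.arr 5 rfl, h5 i hi]
  · rw [hf₅.reg 0 (by norm_num) rfl, hf₄.reg 0 (by norm_num) rfl, hf₃.reg 0 (by norm_num) rfl,
      hf₂.reg 0 (by norm_num) rfl, hf₁.reg 0 (by norm_num) rfl, hr0]
  · rintro σ₆ - ⟨hyes, hno⟩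
    refine ⟨fun hw => hyes ?_, fun hw => hno ?_⟩
    · rw [← hQ]
      exact EdgeList.exists_isTarget hG hidx h10₃ (by omega) hw
    · rintro ⟨M, -, τ, -, ht⟩
      exact hw (EdgeList.hasWeighting_of_isTarget hG hidx h10₃ (Nat.succ_pos M) ht)

theorem decides_solve {W K : ℕ} {G : EdgeList} (hG : G.Valid) {input : List ℕ} {u v b : Expr}
    (hn : input.getD 0 0 = G.n) (hm : input.getD 1 0 = G.m)
    (hu : ∀ σ : State, σ.arr 0 = (init input).arr 0 → σ.reg 24 < G.m → u.Safe W σ ∧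
      u.eval σ = G.U (σ.reg 24))
    (hv : ∀ σ : State, σ.arr 0 = (init input).arr 0 → σ.reg 24 < G.m → v.Safe W σ ∧
      v.eval σ = G.V (σ.reg 24))
    (hb : ∀ σ : State, σ.arr 0 = (init input).arr 0 → σ.reg 24 < G.m → b.Safe W σ ∧
      b.eval σ = G.B (σ.reg 24)) (hcu : u.cost ≤ 20) (hcv : v.cost ≤ 20) (hcb : b.cost ≤ 20)
    (C : Finset ℕ) (hC : ∀ e < G.m, G.U e ∈ C ∨ G.V e ∈ C) (hK : 2 * C.card ≤ K)
    (hin : ∀ a ∈ input, a < W) (hW : solveTime G.n G.m K ≤ W) :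
    Decides (readEdges u v b ;; solve) W W input G.HasWeighting := by
  refine ⟨hin, ?_⟩
  have hW' := hW
  unfold solveTime at hW'
  have hfits : (init input).Fits W := by
    refine ⟨fun _ => by simp only [init]; omega, fun a i => ?_⟩
    simp only [init]
    split_ifs
    · rw [List.getD_eq_getElem?_getD]
      rcases hi : input[i]? with _ | c
      · simp only [Option.getD_none]
        omega
      · exact hin c (List.mem_of_getElem? hi)
    · omega
  have hruns : Runs W (readEdges u v b ;; solve) (init input) W fun σ' =>
      (G.HasWeighting → σ'.reg 0 = 1) ∧ (¬ G.HasWeighting → σ'.reg 0 = 0) := by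
    refine (runs_readEdges (by omega) (by omega) (by omega) (by simpa [init] using hn)
      (by simpa [init] using hm) hu hv hb hcu hcv hcb).seq (by omega) ?_
    intro σ hf hS
    have hreg : ∀ x < 100, (readEdges u v b).setsReg x = false → σ.reg x = 0 :=
      fun x hx h => hf.reg x hx h
    have harr : ∀ a ≠ 0, (readEdges u v b).setsArr a = false → ∀ i, σ.arr a i = 0 := by
      intro a ha h i
      rw [hf.arr a h]
      simp [init, ha]
    refine (runs_solve hS hG (hreg 0 (by norm_num) ?_) (hreg 3 (by norm_num) ?_)
      (harr 4 (by norm_num) ?_) (harr 6 (by norm_num) ?_) (harr 7 (by norm_num) ?_)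
      (harr 8 (by norm_num) ?_) (harr 10 (by norm_num) ?_) C hC hK hW).mono (by omega)
    all_goals simp [readEdges, Prog.for_, Prog.setsReg, Prog.setsArr, Prog.assign, Prog.put,
      Prog.while_]
  obtain ⟨t, r', s', he, ht, hsim, hq⟩ := hruns _ ⟨fun _ _ => rfl, rfl⟩ hfits
  refine ⟨t, r', he, ht, ?_⟩
  rw [hsim.1 0 (by norm_num)]
  exact hq

end WordRAM

namespace EdgeWeighting

open WordRAM

/-! ### Graph inputs as edge lists -/

theorem getD_flatMap {α : Type*} {k : ℕ} {f : α → List ℕ} (hf : ∀ a, (f a).length = k) (l : List α)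
    {e j : ℕ} (he : e < l.length) (hj : j < k) :
    (l.flatMap f).getD (k * e + j) 0 = (f l[e]).getD j 0 := by
  induction l generalizing e with
  | nil => simp at he
  | cons a l ih =>
    rw [List.flatMap_cons]
    cases e with
    | zero => rw [List.getD_append _ _ _ _ (by rw [hf]; omega)]; simp
    | succ e =>
      rw [List.getD_append_right _ _ _ _ (by rw [hf, mul_add]; omega), hf, mul_add,
        show k * e + k * 1 + j - k = k * e + j by omega]
      exact ih (by simpa using he)

namespace GraphInput

/-- The edges are numbered by their positions in the list. -/
noncomputable def edgeEquiv (x : GraphInput) : Fin x.edges.length ≃ x.G.edgeSet :=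
  Equiv.ofBijective
    (fun i => ⟨s(x.edges[i].1, x.edges[i].2),
      (x.mem_iff _).1 (List.mem_map_of_mem (List.getElem_mem i.2))⟩)
    ⟨fun i j h => by
      have h : (x.edges.map fun e => s(e.1, e.2))[i.1]'(by simp) =
          (x.edges.map fun e => s(e.1, e.2))[j.1]'(by simp) := by
        simpa using h
      exact Fin.ext ((x.nodup.getElem_inj_iff).1 h),
    fun ⟨e, he⟩ => by
      obtain ⟨i, hi, h⟩ := List.getElem_of_mem ((x.mem_iff e).2 he)
      exact ⟨⟨i, by simpa using hi⟩, Subtype.ext (by simpa using h)⟩⟩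

theorem coe_edgeEquiv (x : GraphInput) (i : Fin x.edges.length) :
    (x.edgeEquiv i : Sym2 (Fin x.n)) = s(x.edges[i].1, x.edges[i].2) := rfl

/-- The edge list with the marks `b`. -/
def toEdgeList (x : GraphInput) (b : Fin x.n × Fin x.n → ℕ) : EdgeList where
  n := x.n
  m := x.edges.length
  U e := if h : e < x.edges.length then x.edges[e].1 else 0
  V e := if h : e < x.edges.length then x.edges[e].2 else 0
  B e := if h : e < x.edges.length then b x.edges[e] else 0

variable {x : GraphInput} {b : Fin x.n × Fin x.n → ℕ}

theorem toEdgeList_U (i : Fin x.edges.length) : (x.toEdgeList b).U i = x.edges[i].1 :=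
  dif_pos i.2

theorem toEdgeList_V (i : Fin x.edges.length) : (x.toEdgeList b).V i = x.edges[i].2 :=
  dif_pos i.2

theorem toEdgeList_B (i : Fin x.edges.length) : (x.toEdgeList b).B i = b x.edges[i] :=
  dif_pos i.2

theorem adj_edges (i : Fin x.edges.length) : x.G.Adj x.edges[i].1 x.edges[i].2 :=
  (x.edgeEquiv i).2

theorem valid_toEdgeList (hb : ∀ p, b p ≤ 1) : (x.toEdgeList b).Valid where
  U_lt e he := by
    rw [toEdgeList_U ⟨e, he⟩]
    exact Fin.isLt _
  V_lt e he := by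
    rw [toEdgeList_V ⟨e, he⟩]
    exact Fin.isLt _
  U_ne_V e he := by
    rw [toEdgeList_U ⟨e, he⟩, toEdgeList_V ⟨e, he⟩]
    exact fun h => (adj_edges ⟨e, he⟩).ne (Fin.ext h)
  B_le e he := by
    rw [toEdgeList_B ⟨e, he⟩]
    exact hb _
  inj e he e' he' h := by
    rw [toEdgeList_U ⟨e, he⟩, toEdgeList_V ⟨e, he⟩, toEdgeList_U ⟨e', he'⟩,
      toEdgeList_V ⟨e', he'⟩] at h
    refine congrArg Fin.val (x.edgeEquiv.injective (a₁ := ⟨e, he⟩) (a₂ := ⟨e', he'⟩)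
      (Subtype.ext ?_))
    rw [coe_edgeEquiv, coe_edgeEquiv, Sym2.eq_iff]
    simpa only [Fin.ext_iff] using h

theorem color_toEdgeList {w : x.G.edgeSet → Fin 2} {ω : ℕ → ℕ}
    (h : ∀ i : Fin x.edges.length, ω i = w (x.edgeEquiv i)) (v : Fin x.n) :
    (x.toEdgeList b).color ω v = color w v := by
  classical
  rw [EdgeList.color, Finset.sum_range, color]
  refine Fintype.sum_equiv x.edgeEquiv _ _ fun i => ?_
  rw [h, coe_edgeEquiv, toEdgeList_U, toEdgeList_V]
  have hmem : v ∈ s(x.edges[i].1, x.edges[i].2) ↔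
      (x.edges[i].1 : ℕ) = v ∨ (x.edges[i].2 : ℕ) = v := by
    rw [Sym2.mem_iff, Fin.ext_iff, Fin.ext_iff, eq_comm, @eq_comm _ (v : ℕ)]
  split_ifs with h1 h2 h2
  · rfl
  · exact absurd (hmem.2 h1) h2
  · exact absurd (hmem.1 h2) h1
  · rfl

theorem isProper_iff {w : x.G.edgeSet → Fin 2} :
    IsProper w ↔ ∀ i : Fin x.edges.length, color w x.edges[i].1 ≠ color w x.edges[i].2 := by
  refine ⟨fun h i => h (adj_edges i), fun h u v huv => ?_⟩
  obtain ⟨i, hi⟩ := x.edgeEquiv.surjective ⟨s(u, v), huv⟩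
  have hi : s(x.edges[i].1, x.edges[i].2) = s(u, v) := congrArg Subtype.val hi
  rcases Sym2.eq_iff.1 hi with ⟨h1, h2⟩ | ⟨h1, h2⟩
  · rw [← h1, ← h2]
    exact h i
  · rw [← h1, ← h2]
    exact (h i).symm

theorem hasWeighting_toEdgeList : (x.toEdgeList b).HasWeighting ↔
    ∃ w : x.G.edgeSet → Fin 2, IsProper w ∧
      ∀ i : Fin x.edges.length, b x.edges[i] ≤ w (x.edgeEquiv i) := by
  constructor
  · rintro ⟨ω, hω⟩
    have hlt : ∀ i : Fin x.edges.length, ω i < 2 := fun i => Nat.lt_succ_of_le (hω i i.2).1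
    have hc := color_toEdgeList (b := b) (w := fun e => ⟨_, hlt (x.edgeEquiv.symm e)⟩) (ω := ω)
      fun i => by simp
    refine ⟨fun e => ⟨_, hlt (x.edgeEquiv.symm e)⟩, isProper_iff.2 fun i => ?_, fun i => ?_⟩
    · have := (hω i i.2).2.2
      rwa [toEdgeList_U, toEdgeList_V, hc, hc] at this
    · have := (hω i i.2).2.1
      rw [toEdgeList_B] at this
      simpa using this
  · rintro ⟨w, hw, hb⟩
    have hω : ∀ i : Fin x.edges.length,
        (if h : (i : ℕ) < x.edges.length then (w (x.edgeEquiv ⟨i, h⟩) : ℕ) else 0) =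
          w (x.edgeEquiv i) := fun i => dif_pos i.2
    have hc := color_toEdgeList (b := b)
      (ω := fun i => if h : i < x.edges.length then (w (x.edgeEquiv ⟨i, h⟩) : ℕ) else 0) hω
    refine ⟨fun i => if h : i < x.edges.length then (w (x.edgeEquiv ⟨i, h⟩) : ℕ) else 0,
      fun e he => ⟨?_, ?_, ?_⟩⟩
    · exact (hω ⟨e, he⟩).trans_le (Nat.le_of_lt_succ (Fin.isLt _))
    · rw [toEdgeList_B ⟨e, he⟩]
      exact (hb ⟨e, he⟩).trans (hω ⟨e, he⟩).ge
    · rw [toEdgeList_U ⟨e, he⟩, toEdgeList_V ⟨e, he⟩, hc, hc]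
      exact isProper_iff.1 hw ⟨e, he⟩

theorem exists_cover (x : GraphInput) : ∃ C : Finset (Fin x.n), C.card = x.vc ∧
    ∀ i : Fin x.edges.length, x.edges[i].1 ∈ C ∨ x.edges[i].2 ∈ C := by
  classical
  obtain ⟨C, hC, hcov⟩ := x.G.vertexCoverNum_exists
  refine ⟨C.toFinset, ?_, fun i => by simpa using hcov (adj_edges i)⟩
  rw [vc, ← hC, Set.encard_eq_coe_toFinset_card, ENat.toNat_natCast]

/-- A vertex cover with `k` elements meets at most `k n` edges. -/
theorem length_edges_le (x : GraphInput) : x.edges.length ≤ x.vc * x.n := by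
  obtain ⟨C, hC, hcov⟩ := x.exists_cover
  have hsub : (x.edges.map fun e => s(e.1, e.2)).toFinset ⊆
      (C ×ˢ (Finset.univ : Finset (Fin x.n))).image fun p => s(p.1, p.2) := by
    intro e he
    rw [List.mem_toFinset] at he
    obtain ⟨i, hi, rfl⟩ := List.getElem_of_mem he
    rw [List.getElem_map, Finset.mem_image]
    have hi : i < x.edges.length := by simpa using hi
    rcases hcov ⟨i, hi⟩ with h | h
    · exact ⟨(_, _), Finset.mem_product.2 ⟨h, Finset.mem_univ x.edges[i].2⟩, rfl⟩
    · exact ⟨(_, _), Finset.mem_product.2 ⟨h, Finset.mem_univ x.edges[i].1⟩, Sym2.eq_swap⟩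
  have := (Finset.card_le_card hsub).trans Finset.card_image_le
  rwa [List.toFinset_card_of_nodup x.nodup, List.length_map, Finset.card_product, hC,
    Finset.card_univ, Fintype.card_fin] at this

/-- The program `solve` decides on a graph input, if the ends and marks of the edges are read from
the input correctly. -/
theorem decides (x : GraphInput) {b : Fin x.n × Fin x.n → ℕ} (hb : ∀ p, b p ≤ 1) {T : ℕ}
    (hT : solveTime x.n x.edges.length (2 * x.vc) ≤ T) {input : List ℕ} {p q r : Expr}
    (hn : input.getD 0 0 = x.n) (hm : input.getD 1 0 = x.edges.length)
    (hin : ∀ a ∈ input, a < T)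
    (hread : ∀ (σ : State) (i : Fin x.edges.length), σ.arr 0 = (init input).arr 0 → σ.reg 24 = i →
      (p.Safe T σ ∧ p.eval σ = x.edges[i].1) ∧ (q.Safe T σ ∧ q.eval σ = x.edges[i].2) ∧
        r.Safe T σ ∧ r.eval σ = b x.edges[i])
    (hp : p.cost ≤ 20) (hq : q.cost ≤ 20) (hr : r.cost ≤ 20) :
    Decides (readEdges p q r ;; solve) T T input (x.toEdgeList b).HasWeighting := by
  obtain ⟨C, hC, hcov⟩ := x.exists_cover
  refine decides_solve (K := 2 * x.vc) (valid_toEdgeList hb) hn hm (fun σ h0 h24 => ?_)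
    (fun σ h0 h24 => ?_) (fun σ h0 h24 => ?_) hp hq hr (C.map Fin.valEmbedding) (fun e he => ?_)
    (by rw [Finset.card_map, hC]) hin hT
  · rw [toEdgeList_U ⟨_, h24⟩]
    exact (hread σ ⟨_, h24⟩ h0 rfl).1
  · rw [toEdgeList_V ⟨_, h24⟩]
    exact (hread σ ⟨_, h24⟩ h0 rfl).2.1
  · rw [toEdgeList_B ⟨_, h24⟩]
    exact (hread σ ⟨_, h24⟩ h0 rfl).2.2
  · rw [toEdgeList_U ⟨e, he⟩, toEdgeList_V ⟨e, he⟩]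
    exact (hcov ⟨e, he⟩).imp (fun h => Finset.mem_map_of_mem Fin.valEmbedding h)
      fun h => Finset.mem_map_of_mem Fin.valEmbedding h

end GraphInput

theorem lt_solveTime (n m s : ℕ) : n < solveTime n m s ∧ 3 * m + 10 < solveTime n m s := by
  unfold solveTime
  omega

/-- Read the edge number `i` from the cells `2 i + 2` and `2 i + 3`. -/
theorem solvableInTime_problem {T : ℕ → ℕ → ℕ}
    (hT : ∀ k n m, m ≤ k * n → solveTime n m (2 * k) ≤ T k n) : problem.SolvableInTime T := by
  refine ⟨readEdges (.get 0 (.lit 2 * .var 24 + .lit 2)) (.get 0 (.lit 2 * .var 24 + .lit 3))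
    (.lit 0) ;; solve, fun (x : GraphInput) => ?_⟩
  have hT := hT x.vc x.n x.edges.length x.length_edges_le
  have hlt := lt_solveTime x.n x.edges.length (2 * x.vc)
  change Decides _ (T x.vc x.n) (T x.vc x.n) _ (∃ w : x.G.edgeSet → Fin 2, IsProper w)
  have hyes : (∃ w : x.G.edgeSet → Fin 2, IsProper w) ↔ (x.toEdgeList fun _ => 0).HasWeighting := by
    rw [GraphInput.hasWeighting_toEdgeList]
    simp
  rw [hyes]
  generalize T x.vc x.n = W at *
  refine x.decides (fun _ => by omega) hT rfl rfl ?_ ?_ (by simp) (by simp) (by simp)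
  · intro a ha
    simp only [problem, List.mem_cons, List.mem_flatMap] at ha
    rcases ha with rfl | rfl | ⟨e, -, ha⟩
    · omega
    · omega
    · simp only [List.not_mem_nil, or_false] at ha
      rcases ha with rfl | rfl <;> omega
  · intro σ i h0 h24
    have hi := i.2
    have hget : ∀ j < 2, (init (problem.input x)).arr 0 (2 * i + (j + 2)) =
        [(x.edges[i].1 : ℕ), (x.edges[i].2 : ℕ)].getD j 0 := fun j hj =>
      getD_flatMap (f := fun e : Fin x.n × Fin x.n => [(e.1 : ℕ), (e.2 : ℕ)]) (fun _ => rfl)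
        x.edges hi hj
    refine ⟨⟨?_, ?_⟩, ⟨?_, ?_⟩, ?_, rfl⟩
    · simp [h24]; omega
    · simpa [h0, h24] using hget 0 (by omega)
    · simp [h24]; omega
    · simpa [h0, h24] using hget 1 (by omega)
    · simp; omega

/-- Read the edge number `i` from the cells `3 i + 2`, `3 i + 3` and `3 i + 4`. -/
theorem solvableInTime_onesPreProblem {T : ℕ → ℕ → ℕ}
    (hT : ∀ k n m, m ≤ k * n → solveTime n m (2 * k) ≤ T k n) :
    onesPreProblem.SolvableInTime T := by
  classical
  refine ⟨readEdges (.get 0 (.lit 3 * .var 24 + .lit 2)) (.get 0 (.lit 3 * .var 24 + .lit 3))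
    (.get 0 (.lit 3 * .var 24 + .lit 4)) ;; solve, fun (x : OnesPreInput) => ?_⟩
  have hT := hT x.vc x.n x.edges.length x.length_edges_le
  have hlt := lt_solveTime x.n x.edges.length (2 * x.vc)
  change Decides _ (T x.vc x.n) (T x.vc x.n) _
    (∃ w : x.G.edgeSet → Fin 2, IsProper w ∧ Extends w x.pre)
  set b : Fin x.n × Fin x.n → ℕ := fun e => if s(e.1, e.2) ∈ x.pre.dom then 1 else 0 with hb
  have hyes : (∃ w : x.G.edgeSet → Fin 2, IsProper w ∧ Extends w x.pre) ↔
      (x.toEdgeList b).HasWeighting := by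
    rw [GraphInput.hasWeighting_toEdgeList]
    refine exists_congr fun w => and_congr_right fun _ => ⟨fun h i => ?_, fun h e => ?_⟩
    · simp only [hb]
      split_ifs with hi
      · have := h ⟨_, hi⟩
        rw [x.ones] at this
        exact (congrArg Fin.val this).ge
      · exact Nat.zero_le _
    · obtain ⟨i, hi⟩ := x.edgeEquiv.surjective ⟨e, x.pre.dom_subset e.2⟩
      have hbi := h i
      have he : s(x.edges[i].1, x.edges[i].2) = e := congrArg Subtype.val hi
      rw [hi, hb] at hbi
      simp only [he, e.2, if_true] at hbi
      rw [x.ones]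
      exact Fin.ext (by have := (w ⟨e, x.pre.dom_subset e.2⟩).2; omega)
  rw [hyes]
  generalize T x.vc x.n = W at *
  refine x.decides (fun _ => by simp only [hb]; split_ifs <;> omega) hT rfl rfl ?_ ?_ (by simp)
    (by simp) (by simp)
  · intro a ha
    simp only [onesPreProblem, List.mem_cons, List.mem_flatMap] at ha
    rcases ha with rfl | rfl | ⟨e, -, ha⟩
    · omega
    · omega
    · simp only [List.not_mem_nil, or_false] at ha
      rcases ha with rfl | rfl | rfl
      · omega
      · omega
      · split_ifs <;> omega
  · intro σ i h0 h24
    have hi := i.2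
    have hget : ∀ j < 3, (init (onesPreProblem.input x)).arr 0 (3 * i + (j + 2)) =
        [(x.edges[i].1 : ℕ), (x.edges[i].2 : ℕ), b x.edges[i]].getD j 0 := by
      intro j hj
      have := getD_flatMap (f := fun e : Fin x.n × Fin x.n => [(e.1 : ℕ), (e.2 : ℕ), b e])
        (fun _ => rfl) x.edges hi hj
      exact this
    refine ⟨⟨?_, ?_⟩, ⟨?_, ?_⟩, ?_, ?_⟩
    · simp [h24]; omega
    · simpa [h0, h24] using hget 0 (by omega)
    · simp [h24]; omega
    · simpa [h0, h24] using hget 1 (by omega)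
    · simp [h24]; omega
    · simpa [h0, h24] using hget 2 (by omega)

end EdgeWeighting

namespace EdgeWeighting

open WordRAM

/-! ### The running time -/

/-- Powers of the logarithm are linear, up to a factor that depends only on the exponent. -/
theorem pow_le_pow_self_mul_two_pow {a : ℕ} (ha : 0 < a) (x : ℕ) : x ^ a ≤ a ^ a * 2 ^ x := by
  have h1 : x < a * (x / a + 1) := Nat.lt_mul_div_succ x ha
  have h2 : x / a + 1 ≤ 2 ^ (x / a) := Nat.lt_two_pow_self
  calc x ^ a ≤ (a * 2 ^ (x / a)) ^ a :=
        Nat.pow_le_pow_left (h1.le.trans (Nat.mul_le_mul_left a h2)) a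
    _ = a ^ a * 2 ^ (x / a * a) := by rw [mul_pow, ← pow_mul]
    _ ≤ a ^ a * 2 ^ x :=
        Nat.mul_le_mul_left _ (Nat.pow_le_pow_right (by norm_num) (Nat.div_mul_le_self x a))

/-- The factor `2 ^ (L + 1)` is linear in the size of the input, since `L` is its number of bits. -/
theorem searchTime_le (s L : ℕ) :
    searchTime s L (2 * (s * s * L + 1)) ≤ 2 ^ (15 * s ^ 2 + 24 * s + 22) * 2 ^ (L + 1) := by
  set E := s + 1 + 2 * (s * s * L + 1) with hE
  have hs : s + 1 ≤ 2 ^ s := Nat.lt_two_pow_self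
  have hs2 : (s + 1) ^ 2 ≤ 2 ^ (2 * s) := by
    rw [mul_comm, pow_mul]
    exact Nat.pow_le_pow_left hs 2
  have hEle : E ≤ 2 ^ (2 * s + 2) * (L + 1) := by
    calc E ≤ 4 * (s + 1) ^ 2 * (L + 1) := by
          rw [hE]
          nlinarith [Nat.zero_le (s * L), Nat.zero_le (s * s * L), Nat.zero_le (s * s)]
      _ ≤ _ := by
          rw [pow_add, mul_comm 4]
          gcongr
          norm_num
  have h3 : 3 ^ s ≤ 2 ^ (2 * s) := by
    rw [pow_mul]
    exact Nat.pow_le_pow_left (by norm_num) s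
  have hE1 : 1 ≤ E ^ s := Nat.one_le_pow _ _ (by omega)
  -- this turns the power of `L`, which grows with `s`, into a factor linear in the input size
  have hpow : (L + 1) ^ (3 * s + 2) ≤ 2 ^ ((3 * s + 2) * (3 * s + 2)) * 2 ^ (L + 1) := by
    refine (pow_le_pow_self_mul_two_pow (by omega) _).trans (Nat.mul_le_mul_right _ ?_)
    rw [pow_mul]
    exact Nat.pow_le_pow_left Nat.lt_two_pow_self.le _
  calc searchTime s L (2 * (s * s * L + 1))
      ≤ 6000 * (E * (3 ^ s * (L + 1) * ((s + 1) ^ 2 * (2 * E ^ s) ^ 3))) := by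
        unfold searchTime
        rw [← hE]
        gcongr <;> omega
    _ = 48000 * 3 ^ s * (s + 1) ^ 2 * (L + 1) * E ^ (3 * s + 1) := by
        rw [pow_succ E, mul_comm 3 s, pow_mul E]
        ring
    _ ≤ 2 ^ 16 * 2 ^ (2 * s) * 2 ^ (2 * s) * (L + 1) *
          (2 ^ (2 * s + 2) * (L + 1)) ^ (3 * s + 1) := by
        gcongr
        norm_num
    _ = 2 ^ (16 + 2 * s + 2 * s + (2 * s + 2) * (3 * s + 1)) * (L + 1) ^ (3 * s + 2) := by
        rw [mul_pow, ← pow_mul, pow_succ (L + 1) (3 * s + 1), pow_add, pow_add, pow_add]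
        ring
    _ ≤ 2 ^ (16 + 2 * s + 2 * s + (2 * s + 2) * (3 * s + 1)) *
          (2 ^ ((3 * s + 2) * (3 * s + 2)) * 2 ^ (L + 1)) := Nat.mul_le_mul_left _ hpow
    _ = 2 ^ (15 * s ^ 2 + 24 * s + 22) * 2 ^ (L + 1) := by
        rw [← mul_assoc, ← pow_add]
        congr 2
        ring

theorem solveTime_le {k n m : ℕ} (h : m ≤ k * n) :
    solveTime n m (2 * k) ≤ 2 ^ (140 * (k ^ 4 + 1)) * (n + 1) := by
  have hk : k + 1 ≤ 2 ^ k := Nat.lt_two_pow_self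
  have hN : n + m + 1 ≤ 2 ^ k * (n + 1) := by
    refine le_trans ?_ (Nat.mul_le_mul_right _ hk)
    nlinarith
  have hL : 2 ^ ((n + m).size + 1) ≤ 4 * (n + m + 1) := by
    rcases Nat.eq_zero_or_pos (n + m).size with h0 | h0
    · rw [h0]
      omega
    · have h1 : 2 ^ ((n + m).size - 1) ≤ n + m := Nat.lt_size.1 (by omega)
      have h2 : (n + m).size + 1 = (n + m).size - 1 + 2 := by omega
      rw [h2, pow_add]
      omega
  have h1 := searchTime_le (2 * k) (n + m).size
  set X := 2 ^ (15 * (2 * k) ^ 2 + 24 * (2 * k) + 22) with hX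
  have hX1 : 1000 ≤ X :=
    le_trans (by norm_num : 1000 ≤ 2 ^ 22) (Nat.pow_le_pow_right (by norm_num) (by omega))
  calc solveTime n m (2 * k)
      ≤ X * (n + m + 1) + 2 * (X * (4 * (n + m + 1))) := by
        unfold solveTime
        exact add_le_add (Nat.mul_le_mul_right _ hX1)
          (Nat.mul_le_mul_left _ (h1.trans (Nat.mul_le_mul_left _ hL)))
    _ ≤ 2 ^ 4 * X * (n + m + 1) := by
        nlinarith [Nat.zero_le (X * (n + m + 1))]
    _ ≤ 2 ^ 4 * X * (2 ^ k * (n + 1)) := Nat.mul_le_mul_left _ hN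
    _ = 2 ^ (4 + (15 * (2 * k) ^ 2 + 24 * (2 * k) + 22) + k) * (n + 1) := by
        rw [hX, ← mul_assoc, ← pow_add, ← pow_add]
    _ ≤ 2 ^ (140 * (k ^ 4 + 1)) * (n + 1) := by
        refine Nat.mul_le_mul_right _ (Nat.pow_le_pow_right (by norm_num) ?_)
        have h4 : k ≤ k ^ 4 := Nat.le_self_pow (by norm_num) k
        have h5 : k ^ 2 ≤ k ^ 4 := by
          rcases Nat.eq_zero_or_pos k with rfl | hk
          · norm_num
          · exact Nat.pow_le_pow_right hk (by norm_num)
        rw [mul_pow]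
        omega

theorem computable_pow (b : ℕ) : Computable fun k : ℕ => b ^ (140 * (k ^ 4 + 1)) := by
  have hpow : Primrec₂ fun x y : ℕ => x ^ y := Primrec₂.unpaired'.1 Nat.Primrec.pow
  refine Primrec.to_comp ?_
  exact hpow.comp (.const b) (Primrec.nat_mul.comp (.const 140)
    (Primrec.nat_add.comp (hpow.comp .id (.const 4)) (.const 1)))

end EdgeWeighting

theorem theorem3 :
    (EdgeWeighting.problem.IsFPT ∧
      ∃ C : ℕ, EdgeWeighting.problem.SolvableInTime
        (fun k n => 2 ^ (C * (k ^ 4 + 1)) * (n + 1))) ∧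
    (EdgeWeighting.onesPreProblem.IsFPT ∧
      ∃ C : ℕ, EdgeWeighting.onesPreProblem.SolvableInTime
        (fun k n => 3 ^ (C * (k ^ 4 + 1)) * (n + 1) ^ C)) := by
  refine ⟨⟨⟨_, 1, EdgeWeighting.computable_pow 2, ?_⟩, 140, ?_⟩,
    ⟨_, 1, EdgeWeighting.computable_pow 2, ?_⟩, 140, ?_⟩
  · refine EdgeWeighting.solvableInTime_problem fun k n m h => ?_
    simpa only [pow_one] using EdgeWeighting.solveTime_le h
  · exact EdgeWeighting.solvableInTime_problem fun k n m h => EdgeWeighting.solveTime_le h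
  · refine EdgeWeighting.solvableInTime_onesPreProblem fun k n m h => ?_
    simpa only [pow_one] using EdgeWeighting.solveTime_le h
  · refine EdgeWeighting.solvableInTime_onesPreProblem fun k n m h => ?_
    exact (EdgeWeighting.solveTime_le h).trans (Nat.mul_le_mul
      (Nat.pow_le_pow_left (by norm_num) _) (Nat.le_self_pow (by norm_num) _))
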